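/- Consider $N\ge 1$ identical agents $\dot x_i=Ax_i+Bu_i+E\omega_i$, $i=1,\dots,N$, with $x_i\in\mathbb R^n$, $u_i\in\mathbb R^m$, $\omega_i\in\mathbb R^w$, and real matrices $A,B,E$ (full-state coupling, $y_i=x_i$). The agents communicate over a weighted directed graph $G$ with weights $a_{ij}\ge0$, $a_{ii}=0$ ($a_{ij}>0$ means an edge from $j$ to $i$): agent $i$ receives $\zeta_i=\sum_j a_{ij}(x_i-x_j)$ and $\hat\zeta_i=\sum_j a_{ij}(\xi_i-\xi_j)$. A protocol is a family, parameterized by $\rho\ge 1$, $$\dot x_{i,c}=A_c(\rho)x_{i,c}+B_c(\rho)\zeta_i+C_c(\rho)\hat\zeta_i,\qquad u_i=F_c(\rho)x_{i,c},\qquad \xi_i=H_cx_{i,c}\in\mathbb R^n ,$$ the same for all agents and not depending on $N$ or $G$. It solves the scale-free $H_2$ almost state synchronization problem with localized information exchange for a class $\mathcal G$ of graphs (of any numbers of nodes $N\ge1$) if for every $G\in\mathcal G$: (i) for every $\rho\ge1$, if $\omega=0$, then $x_i(t)-x_j(t)\to0$ as $t\to\infty$ for all $i,j$ and all initial conditions;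 (ii) for every $\gamma>0$ there is $\rho_0\ge1$ such that for all $\rho\ge\rho_0$ and all $i,j$ the closed-loop transfer function $T_{\omega,x_i-x_j}$ from $\omega=(\omega_1,\dots,\omega_N)$ to $x_i-x_j$ satisfies $\|T_{\omega,x_i-x_j}\|_{H_2}<\gamma$. Here $\|T\|_{H_2}=\big(\operatorname{trace}\int_0^\infty g(t)g(t)^{T}\,dt\big)^{1/2}$ with $g$ the unit impulse response of $T$. **Theorem.** 1. Assume that $E\ne0$ or that $A$ is not Hurwitz stable (Hurwitz stable: all eigenvalues in the open left half-plane). Let $\mathcal G$ be a class of graphs which includes all weighted directed graphs that contain a directed spanning tree. Then some protocol solves the problem for $\mathcal G$ if and only if (a) $(A,B)$ is stabilizable; (b) all eigenvalues of $A$ lie in the closed left half-plane; (c) every graph in $\mathcal G$ contains a directed spanning tree; (d) $\operatorname{im}E\subseteq\operatorname{im}B$. 2. Assume (a), (b) and (d). Then the Riccati equation $A^{T}P+PA-PBB^{T}P+I=0$ has a unique positive definite solution $P$, and the protocol $$\dot\chi_i=A\chi_i+Bu_i+\rho\zeta_i-\rho\hat\zeta_i,\qquad u_i=-\rho B^{T}P\chi_i,\qquad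 \xi_i=\chi_i$$ solves the problem for the class of all graphs (with any number of nodes) that contain a directed spanning tree; in particular it achieves state synchronization for every $\rho\ge1$ and every such graph. Moreover, for every such graph there is a constant $M>0$ which does not depend on $\rho$, $i$, $j$ such that $\|T_{\omega,x_i-x_j}\|_{H_2}<M/\sqrt\rho$ for all $\rho\ge1$ and all $i,j$. -/

import Mathlib

open scoped Matrix Kronecker Topology ENNReal

noncomputable section

namespace MAS

/-! ### Communication graphs -/

/-- A weighted directed graph on the nodes `0, …, N - 1`, with `N ≥ 1`. There is an edge from
node `j` to node `i` exactly when `a i j > 0`, and `a i j` is then its weight. -/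
structure CommGraph where
  N : ℕ
  pos : 0 < N
  a : Matrix (Fin N) (Fin N) ℝ
  nonneg : ∀ i j, 0 ≤ a i j
  noLoop : ∀ i, a i i = 0

namespace CommGraph

/-- There is an edge from node `j` to node `i`. -/
def Edge (G : CommGraph) (j i : Fin G.N) : Prop := 0 < G.a i j

/-- The nodes `p` form a path from `r` to `k` along the edges of the relation `T`. -/
def IsPath {V : Type*} (T : V → V → Prop) (r k : V) (p : List V) : Prop :=
  p.IsChain T ∧ p.head? = some r ∧ p.getLast? = some k

/-- Some set `T` of edges of `G` is a directed tree containing all the nodes: for some root `r`,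
there is a unique path in `T` from `r` to each node. -/
def HasDirectedSpanningTree (G : CommGraph) : Prop :=
  ∃ T : Fin G.N → Fin G.N → Prop, (∀ j i, T j i → G.Edge j i) ∧
    ∃ r : Fin G.N, ∀ k : Fin G.N, ∃! p : List (Fin G.N), IsPath T r k p

/-- The Laplacian matrix. -/
def laplacian (G : CommGraph) : Matrix (Fin G.N) (Fin G.N) ℝ :=
  Matrix.of fun i j => if i = j then ∑ k, G.a i k else -G.a i j

/-- What agent `i` receives when agent `j` sends `v j`: the sum `∑ j, a i j (v i - v j)`. -/
def relative (G : CommGraph) {q : ℕ} (v : Fin G.N → Fin q → ℝ) (i : Fin G.N) : Fin q → ℝ :=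
  ∑ j, G.a i j • (v i - v j)

theorem relative_eq (G : CommGraph) {q : ℕ} (v : Fin G.N → Fin q → ℝ) (i : Fin G.N) :
    G.relative v i = ∑ j, G.laplacian i j • v j := by
  have h : ∀ j, G.laplacian i j • v j
      = (if i = j then (∑ k, G.a i k) • v j else 0) - G.a i j • v j := by
    intro j
    by_cases hij : i = j
    · subst hij
      simp [laplacian, G.noLoop]
    · simp [laplacian, hij]
  simp only [h, relative, smul_sub, Finset.sum_sub_distrib, Finset.sum_ite_eq, Finset.mem_univ,
    if_true, Finset.sum_smul]

end CommGraph

/-! ### Agents, protocols, closed loop -/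

/-- The agent `x' = A x + B u + E ω`, `y = C x`. -/
structure Agent (n m p w : ℕ) where
  A : Matrix (Fin n) (Fin n) ℝ
  B : Matrix (Fin n) (Fin m) ℝ
  C : Matrix (Fin p) (Fin n) ℝ
  E : Matrix (Fin n) (Fin w) ℝ

/-- A linear protocol parameterized by `ρ`, with state `x_c` of dimension `nc`:
`x_c' = A_c(ρ) x_c + B_c(ρ) ζ + C_c(ρ) ζ̂`, `u = F_c(ρ) x_c`, and communicated variable
`ξ = H_c x_c`. -/
structure Protocol (n m p : ℕ) where
  nc : ℕ
  Ac : ℝ → Matrix (Fin nc) (Fin nc) ℝ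
  Bc : ℝ → Matrix (Fin nc) (Fin p) ℝ
  Cc : ℝ → Matrix (Fin nc) (Fin n) ℝ
  Fc : ℝ → Matrix (Fin m) (Fin nc) ℝ
  Hc : Matrix (Fin n) (Fin nc) ℝ

variable {n m p w : ℕ}

/-- The derivative of the state of agent `i` in the closed loop. -/
def agentField (S : Agent n m p w) (K : Protocol n m p) (G : CommGraph) (ρ : ℝ)
    (x : Fin G.N → Fin n → ℝ) (xc : Fin G.N → Fin K.nc → ℝ) (ω : Fin G.N → Fin w → ℝ)
    (i : Fin G.N) : Fin n → ℝ :=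
  S.A *ᵥ x i + S.B *ᵥ (K.Fc ρ *ᵥ xc i) + S.E *ᵥ ω i

/-- The derivative of the protocol state of agent `i` in the closed loop. -/
def protocolField (S : Agent n m p w) (K : Protocol n m p) (G : CommGraph) (ρ : ℝ)
    (x : Fin G.N → Fin n → ℝ) (xc : Fin G.N → Fin K.nc → ℝ)
    (i : Fin G.N) : Fin K.nc → ℝ :=
  K.Ac ρ *ᵥ xc i + K.Bc ρ *ᵥ G.relative (fun j => S.C *ᵥ x j) i
    + K.Cc ρ *ᵥ G.relative (fun j => K.Hc *ᵥ xc j) i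

/-- `x` and `xc` are the trajectories, on `[0, ∞)`, of the agents and of their protocols under the
disturbance `ω`. -/
def IsTrajectory (S : Agent n m p w) (K : Protocol n m p) (G : CommGraph) (ρ : ℝ)
    (ω : ℝ → Fin G.N → Fin w → ℝ) (x : ℝ → Fin G.N → Fin n → ℝ)
    (xc : ℝ → Fin G.N → Fin K.nc → ℝ) : Prop :=
  ∀ t : ℝ, 0 ≤ t → ∀ i : Fin G.N,
    HasDerivWithinAt (fun s => x s i) (agentField S K G ρ (x t) (xc t) (ω t) i) (Set.Ici 0) t ∧
    HasDerivWithinAt (fun s => xc s i) (protocolField S K G ρ (x t) (xc t) i) (Set.Ici 0) t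

/-- State synchronization in the absence of disturbances, for all initial conditions. -/
def Synchronizes (S : Agent n m p w) (K : Protocol n m p) (G : CommGraph) (ρ : ℝ) : Prop :=
  ∀ (x : ℝ → Fin G.N → Fin n → ℝ) (xc : ℝ → Fin G.N → Fin K.nc → ℝ),
    IsTrajectory S K G ρ (fun _ => 0) x xc →
      ∀ i j : Fin G.N, Filter.Tendsto (fun t => x t i - x t j) Filter.atTop (𝓝 0)

/-! ### State-space realization and `H₂` norm -/

/-- The state matrix of the closed loop, acting on the stacked vector of all `x_i` and all
`x_{i,c}`. -/
def closedLoopMatrix (S : Agent n m p w) (K : Protocol n m p) (G : CommGraph) (ρ : ℝ) :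
    Matrix (Fin G.N × Fin n ⊕ Fin G.N × Fin K.nc) (Fin G.N × Fin n ⊕ Fin G.N × Fin K.nc) ℝ :=
  Matrix.fromBlocks
    ((1 : Matrix (Fin G.N) (Fin G.N) ℝ) ⊗ₖ S.A)
    ((1 : Matrix (Fin G.N) (Fin G.N) ℝ) ⊗ₖ (S.B * K.Fc ρ))
    (G.laplacian ⊗ₖ (K.Bc ρ * S.C))
    ((1 : Matrix (Fin G.N) (Fin G.N) ℝ) ⊗ₖ K.Ac ρ + G.laplacian ⊗ₖ (K.Cc ρ * K.Hc))

/-- The input matrix from the stacked disturbance `ω`. -/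
def inputMatrix (S : Agent n m p w) (K : Protocol n m p) (G : CommGraph) :
    Matrix (Fin G.N × Fin n ⊕ Fin G.N × Fin K.nc) (Fin G.N × Fin w) ℝ :=
  Matrix.fromRows ((1 : Matrix (Fin G.N) (Fin G.N) ℝ) ⊗ₖ S.E) 0

/-- The output matrix for the output `x_i - x_j`. -/
def diffOutputMatrix (K : Protocol n m p) (G : CommGraph) (i j : Fin G.N) :
    Matrix (Fin n) (Fin G.N × Fin n ⊕ Fin G.N × Fin K.nc) ℝ :=
  Matrix.of fun k s =>
    Sum.elim (fun q : Fin G.N × Fin n =>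
      if q.2 = k then (if q.1 = i then (1 : ℝ) else 0) - (if q.1 = j then 1 else 0) else 0)
      (fun _ => 0) s

/-- The stacked vector of agent and protocol states. -/
def stack {N a b : ℕ} (x : Fin N → Fin a → ℝ) (xc : Fin N → Fin b → ℝ) :
    Fin N × Fin a ⊕ Fin N × Fin b → ℝ :=
  Sum.elim (fun q => x q.1 q.2) (fun q => xc q.1 q.2)

/-- The matrices above realize the agent-wise closed loop. -/
theorem closedLoop_mulVec (S : Agent n m p w) (K : Protocol n m p) (G : CommGraph) (ρ : ℝ)
    (x : Fin G.N → Fin n → ℝ) (xc : Fin G.N → Fin K.nc → ℝ) (ω : Fin G.N → Fin w → ℝ) :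
    closedLoopMatrix S K G ρ *ᵥ stack x xc + inputMatrix S K G *ᵥ (fun q => ω q.1 q.2)
      = stack (agentField S K G ρ x xc ω) (protocolField S K G ρ x xc) := by
  have one {a b : ℕ} (X : Matrix (Fin a) (Fin b) ℝ) (v : Fin G.N → Fin b → ℝ) (i : Fin G.N)
      (k : Fin a) : (((1 : Matrix (Fin G.N) (Fin G.N) ℝ) ⊗ₖ X) *ᵥ fun q => v q.1 q.2) (i, k)
        = (X *ᵥ v i) k := by
    simp [Matrix.mulVec, dotProduct, Fintype.sum_prod_type, Matrix.kroneckerMap_apply,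
      Matrix.one_apply, Finset.sum_ite_eq]
  have lap {a b c : ℕ} (X : Matrix (Fin a) (Fin b) ℝ) (Y : Matrix (Fin b) (Fin c) ℝ)
      (v : Fin G.N → Fin c → ℝ) (i : Fin G.N) (k : Fin a) :
      ((G.laplacian ⊗ₖ (X * Y)) *ᵥ fun q => v q.1 q.2) (i, k)
        = (X *ᵥ G.relative (fun j => Y *ᵥ v j) i) k := by
    rw [G.relative_eq, Matrix.mulVec_sum, Finset.sum_apply]
    simp only [Matrix.mulVec_smul, Matrix.mulVec_mulVec, Pi.smul_apply, smul_eq_mul]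
    simp only [Matrix.mulVec, dotProduct, Fintype.sum_prod_type, Matrix.kroneckerMap_apply,
      mul_assoc, Finset.mul_sum]
  ext (⟨i, k⟩ | ⟨i, k⟩)
  · simp only [closedLoopMatrix, inputMatrix, stack, Pi.add_apply, Matrix.fromBlocks_mulVec,
      Matrix.fromRows_mulVec, Sum.elim_inl, agentField, Matrix.mulVec_mulVec]
    simp only [Function.comp_def, Sum.elim_inl, Sum.elim_inr, one]
  · simp only [closedLoopMatrix, inputMatrix, stack, Pi.add_apply, Matrix.fromBlocks_mulVec,
      Matrix.fromRows_mulVec, Sum.elim_inr, protocolField, Matrix.add_mulVec]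
    simp only [Function.comp_def, Sum.elim_inl, Sum.elim_inr, one, lap, Matrix.zero_mulVec,
      Pi.zero_apply]
    ring

theorem diffOutput_mulVec (K : Protocol n m p) (G : CommGraph) (i j : Fin G.N)
    (x : Fin G.N → Fin n → ℝ) (xc : Fin G.N → Fin K.nc → ℝ) :
    diffOutputMatrix K G i j *ᵥ stack x xc = x i - x j := by
  ext k
  simp [diffOutputMatrix, stack, Matrix.mulVec, dotProduct, Fintype.sum_prod_type, sub_mul,
    Finset.sum_sub_distrib]

/-- The unit impulse response matrix `C e^{Mt} D` of the transfer function `C (sI - M)⁻¹ D`. -/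
def impulseResponse {ι κ μ : Type*} [Fintype ι] [DecidableEq ι] (M : Matrix ι ι ℝ)
    (D : Matrix ι κ ℝ) (C : Matrix μ ι ℝ) (t : ℝ) : Matrix μ κ ℝ :=
  C * NormedSpace.exp (t • M) * D

/-- The `H₂` norm `(trace ∫₀^∞ g(t) g(t)ᵀ dt)^{1/2}` of the transfer function with unit impulse
response `g`. It is `∞` if the transfer function is not stable. -/
def h2Norm {κ μ : Type*} [Fintype κ] [Fintype μ] (g : ℝ → Matrix μ κ ℝ) : ℝ≥0∞ :=
  (∫⁻ t in Set.Ioi (0 : ℝ), ENNReal.ofReal (g t * (g t)ᵀ).trace) ^ (1 / 2 : ℝ)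

/-- The `H₂` norm of the closed-loop transfer function from `ω` to `x_i - x_j`. -/
def syncH2Norm (S : Agent n m p w) (K : Protocol n m p) (G : CommGraph) (ρ : ℝ)
    (i j : Fin G.N) : ℝ≥0∞ :=
  h2Norm (impulseResponse (closedLoopMatrix S K G ρ) (inputMatrix S K G)
    (diffOutputMatrix K G i j))

/-! ### The synchronization problem -/

/-- The protocol `K` solves the scale-free `H₂` almost state synchronization problem with localized
information exchange for all the communication graphs in the class `𝒢`. -/
def Solves (S : Agent n m p w) (K : Protocol n m p) (𝒢 : Set CommGraph) : Prop :=
  ∀ G ∈ 𝒢,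
    (∀ ρ : ℝ, 1 ≤ ρ → Synchronizes S K G ρ) ∧
    ∀ γ : ℝ, 0 < γ → ∃ ρ₀ : ℝ, 1 ≤ ρ₀ ∧ ∀ ρ : ℝ, ρ₀ ≤ ρ → ∀ i j : Fin G.N,
      syncH2Norm S K G ρ i j < ENNReal.ofReal γ

/-- The problem is solvable: one protocol, which may depend on the agent model only, works for all
the graphs in the class. -/
def Solvable (S : Agent n m p w) (𝒢 : Set CommGraph) : Prop :=
  ∃ K : Protocol n m p, Solves S K 𝒢

/-! ### Conditions on the agent model -/

/-- `μ` is a (complex) eigenvalue of the real matrix `A`. -/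
def IsEigenvalue (A : Matrix (Fin n) (Fin n) ℝ) (μ : ℂ) : Prop :=
  Module.End.HasEigenvalue (Matrix.toLin' (A.map (algebraMap ℝ ℂ))) μ

/-- All eigenvalues in the open left half-plane. -/
def Hurwitz (A : Matrix (Fin n) (Fin n) ℝ) : Prop := ∀ μ : ℂ, IsEigenvalue A μ → μ.re < 0

/-- `(A, B)` is stabilizable. -/
def Stabilizable (A : Matrix (Fin n) (Fin n) ℝ) (B : Matrix (Fin n) (Fin m) ℝ) : Prop :=
  ∃ F : Matrix (Fin m) (Fin n) ℝ, Hurwitz (A + B * F)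

/-- `P > 0` solves the Riccati equation `AᵀP + PA - PBBᵀP + I = 0`. -/
def IsRiccatiSolution (A : Matrix (Fin n) (Fin n) ℝ) (B : Matrix (Fin n) (Fin m) ℝ)
    (P : Matrix (Fin n) (Fin n) ℝ) : Prop :=
  P.PosDef ∧ Aᵀ * P + P * A - P * B * Bᵀ * P + 1 = 0

/-- The protocol `χ' = A χ + B u + ρ ζ - ρ ζ̂`, `u = -ρ Bᵀ P χ`, with communicated variable
`ξ = χ`. -/
def riccatiProtocol (A : Matrix (Fin n) (Fin n) ℝ) (B : Matrix (Fin n) (Fin m) ℝ)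
    (P : Matrix (Fin n) (Fin n) ℝ) : Protocol n m n where
  nc := n
  Ac ρ := A + B * (-ρ • (Bᵀ * P))
  Bc ρ := ρ • 1
  Cc ρ := -ρ • 1
  Fc ρ := -ρ • (Bᵀ * P)
  Hc := 1

end MAS

end

/-! Sufficiency. With `e_i = x_i - χ_i` and all quantities taken relative to their averages over the
agents, the closed loop becomes a cascade: `e' = (1 ⊗ A - ρ L̃ ⊗ 1) e` drives `x' = (A - ρ B Bᵀ P) x
+ ρ B Bᵀ P e`. Here `L̃` is the Laplacian made invertible on the consensus direction, and a spanning
tree makes `-L̃` Hurwitz (Gershgorin and a maximum principle). Because `A` has no eigenvalue in the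
open right half-plane, one matrix `R = X ⊗ Y` is a Lyapunov matrix for the error for all `ρ ≥ 1`
(`exists_kronecker_lyapunov`). For the `x` part, `P⁻¹` is one. The cross term and a disturbance
matched with the input, `E = B X`, are both dominated by the damping `-2ρ |Bᵀ p|²` and by that of
the error. Hence a single `S`, scaled by `1/ρ`, satisfies the Lyapunov inequality with input term `D
Dᵀ` (`exists_cascade_lyapunov`). Integrating it bounds the squared `H₂` norm by a constant times
`1/ρ` (`lintegral_impulseResponse_le`). The Riccati solution is a supersolution of minimal trace: a
policy improvement step would otherwise lower the trace.

Necessity. On two nodes joined by one edge, the leader may rest at zero, and the follower is then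
under dynamic state feedback with `x → 0`. A finite-horizon Gramian turns this into a static
stabilizing gain (`stabilizable_of_tendsto`), which is (a). For (b), the edge weight tends to `0`.
An unstable eigenvector of `A` is an eigenvector of the uncoupled loop, whereas for every positive
weight the relevant vectors are annihilated by a product of a fixed number of factors with roots in
the closed unit disk. By compactness such a product survives in the limit, which is a contradiction
(`dotProduct_eq_zero_of_tendsto_pow`).

For (c) and (d), consider `∑ q_i x_i` with `∑ q_i = 0`, a combination of the differences. If the
control does not act on a component of it, its derivative is again a combination of differences.
Small `H₂` norms make both small in `L¹[0,1]`, hence also the initial value, which is a multiple of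
an entry of `E` (`mul_vecMul_eq_zero_of_h2Norm`). The control is absent along a covector that kills
`B`, giving (d). It is also absent when `q` is a left null vector of the Laplacian, which exists
when there is no spanning tree; synchronization then forces `A` to be Hurwitz as well, giving (c).
-/

noncomputable section

namespace MAS

/-! ### Matrix exponentials and linear differential equations -/

section Exponential

set_option linter.unusedSectionVars false

open scoped Matrix.Norms.Operator

theorem hasDerivAt_matrix_mul {ι κ μ : Type*} [Fintype ι] [Fintype κ] [Fintype μ]
    {f : ℝ → Matrix ι κ ℝ} {g : ℝ → Matrix κ μ ℝ} {f' : Matrix ι κ ℝ}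
    {g' : Matrix κ μ ℝ} {t : ℝ} (hf : HasDerivAt f f' t) (hg : HasDerivAt g g' t) :
    HasDerivAt (fun s => f s * g s) (f' * g t + f t * g') t := by
  refine hasDerivAt_pi.2 fun i => hasDerivAt_pi.2 fun j => ?_
  have hf' := fun k => hasDerivAt_pi.1 (hasDerivAt_pi.1 hf i) k
  have hg' := fun k => hasDerivAt_pi.1 (hasDerivAt_pi.1 hg k) j
  have := HasDerivAt.fun_sum (u := Finset.univ) (fun k _ => (hf' k).mul (hg' k))
  simpa [Matrix.mul_apply, Matrix.add_apply, Finset.sum_add_distrib] using this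

variable {ι κ μ : Type*} [Fintype ι] [Fintype κ] [Fintype μ] [DecidableEq ι] [DecidableEq κ]

/-- The intertwining relation passes to powers and so to the exponential series. `Q` may be
rectangular or singular, which allows projections onto disagreement coordinates as changes of
variables. -/
theorem mul_exp_eq_exp_mul {𝕜 : Type*} [RCLike 𝕜] {Q : Matrix κ ι 𝕜} {X : Matrix ι ι 𝕜}
    {Y : Matrix κ κ 𝕜} (h : Q * X = Y * Q) :
    Q * NormedSpace.exp X = NormedSpace.exp Y * Q := by
  have hX := NormedSpace.exp_series_hasSum_exp' (𝕂 := 𝕜) X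
  have hY := NormedSpace.exp_series_hasSum_exp' (𝕂 := 𝕜) Y
  have hpow : ∀ k : ℕ, Q * X ^ k = Y ^ k * Q := by
    intro k
    induction k with
    | zero => simp
    | succ k ih => rw [pow_succ, ← Matrix.mul_assoc, ih, Matrix.mul_assoc, h, ← Matrix.mul_assoc,
        pow_succ]
  have h1 : HasSum (fun k : ℕ => Q * ((k.factorial⁻¹ : 𝕜) • X ^ k)) (Q * NormedSpace.exp X) :=
    hX.map (AddMonoidHom.mk' (fun Z : Matrix ι ι 𝕜 => Q * Z) (Matrix.mul_add Q))
      (by exact Continuous.matrix_mul continuous_const continuous_id)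
  have h2 : HasSum (fun k : ℕ => ((k.factorial⁻¹ : 𝕜) • Y ^ k) * Q) (NormedSpace.exp Y * Q) :=
    hY.map (AddMonoidHom.mk' (fun Z : Matrix κ κ 𝕜 => Z * Q) (fun a b => Matrix.add_mul a b Q))
      (by exact Continuous.matrix_mul continuous_id continuous_const)
  refine h1.unique ?_
  convert h2 using 2 with k
  rw [Matrix.mul_smul, Matrix.smul_mul, hpow]

theorem mul_exp_smul_eq_exp_smul_mul {Q : Matrix κ ι ℝ} {X : Matrix ι ι ℝ}
    {Y : Matrix κ κ ℝ} (h : Q * X = Y * Q) (t : ℝ) :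
    Q * NormedSpace.exp (t • X) = NormedSpace.exp (t • Y) * Q :=
  mul_exp_eq_exp_mul (by rw [Matrix.mul_smul, h, Matrix.smul_mul])

theorem exp_mulVec_of_eigenvector {X : Matrix ι ι ℂ} {v : ι → ℂ} {a : ℂ} (h : X *ᵥ v = a • v) :
    NormedSpace.exp X *ᵥ v = Complex.exp a • v := by
  -- An eigenvector, seen as a one-column matrix, intertwines `X` with the `1 × 1` matrix `a`.
  have h1 : Matrix.replicateCol Unit v * Matrix.diagonal (fun _ : Unit => a)
      = X * Matrix.replicateCol Unit v := by
    ext i j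
    have := congrFun h i
    simp [Matrix.mul_apply, Matrix.mulVec, dotProduct] at this ⊢
    rw [this, mul_comm]
  have h2 := mul_exp_eq_exp_mul h1.symm.symm
  rw [Matrix.exp_diagonal] at h2
  ext i
  have := congrFun (congrFun h2 i) ()
  simp [Matrix.mul_apply, Matrix.mulVec, dotProduct] at this ⊢
  rw [← this, Complex.exp_eq_exp_ℂ, mul_comm]

theorem hasDerivAt_exp_smul (M : Matrix ι ι ℝ) (t : ℝ) :
    HasDerivAt (fun s : ℝ => NormedSpace.exp (s • M)) (M * NormedSpace.exp (t • M)) t :=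
  hasDerivAt_exp_smul_const' M t

theorem exp_smul_commute (M : Matrix ι ι ℝ) (t : ℝ) :
    M * NormedSpace.exp (t • M) = NormedSpace.exp (t • M) * M :=
  mul_exp_smul_eq_exp_smul_mul rfl t

theorem continuous_exp_smul (M : Matrix ι ι ℝ) :
    Continuous (fun s : ℝ => NormedSpace.exp (s • M)) :=
  continuous_iff_continuousAt.2 fun t => (hasDerivAt_exp_smul M t).continuousAt

theorem exp_neg_smul_mul (M : Matrix ι ι ℝ) (t : ℝ) :
    NormedSpace.exp (t • M) * NormedSpace.exp ((-t) • M) = 1 := by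
  rw [← Matrix.exp_add_of_commute]
  · simp
  · exact ((Commute.refl M).smul_left _).smul_right _

theorem hasDerivAt_exp_smul_mulVec (M : Matrix ι ι ℝ) (v : ι → ℝ) (t : ℝ) :
    HasDerivAt (fun s : ℝ => NormedSpace.exp (s • M) *ᵥ v) (M *ᵥ (NormedSpace.exp (t • M) *ᵥ v)) t := by
  refine hasDerivAt_pi.2 fun i => ?_
  have h := fun k => hasDerivAt_pi.1 (hasDerivAt_pi.1 (hasDerivAt_exp_smul M t) i) k
  have := HasDerivAt.fun_sum (u := Finset.univ) (fun k _ => (h k).mul_const (v k))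
  rw [Matrix.mulVec_mulVec]
  exact this

/-- The solutions of `z' = M z` on `[0, ∞)` are given by the exponential. -/
theorem eq_exp_mulVec_of_hasDerivWithinAt {M : Matrix ι ι ℝ} {z : ℝ → ι → ℝ}
    (h : ∀ t, 0 ≤ t → HasDerivWithinAt z (M *ᵥ z t) (Set.Ici 0) t) {t : ℝ} (ht : 0 ≤ t) :
    z t = NormedSpace.exp (t • M) *ᵥ z 0 := by
  -- Variation of constants: `exp (-s M) z(s)` has zero derivative, hence is constant.
  have key : ∀ s, 0 ≤ s →
      HasDerivWithinAt (fun s : ℝ => NormedSpace.exp ((-s) • M) *ᵥ z s) 0 (Set.Ici 0) s := by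
    intro s hs
    refine hasDerivWithinAt_pi.2 fun i => ?_
    have hz := fun k => hasDerivWithinAt_pi.1 (h s hs) k
    have he : HasDerivAt (fun s : ℝ => NormedSpace.exp ((-s) • M))
        (-(NormedSpace.exp ((-s) • M) * M)) s := by
      have := (hasDerivAt_exp_smul M (-s)).scomp s (hasDerivAt_neg s)
      rw [exp_smul_commute] at this
      simp only [Function.comp_def, neg_smul, one_smul] at this ⊢
      exact this
    have he' := fun k => (hasDerivAt_pi.1 (hasDerivAt_pi.1 he i) k).hasDerivWithinAt (s := Set.Ici 0)
    have := HasDerivWithinAt.fun_sum (u := Finset.univ) (fun k _ => (he' k).mul (hz k))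
    convert this using 1
    · rfl
    simp only [Finset.sum_add_distrib]
    have e1 : (∑ k, (NormedSpace.exp ((-s) • M)) i k * (M *ᵥ z s) k)
        = ((NormedSpace.exp ((-s) • M) * M) *ᵥ z s) i := by
      rw [← Matrix.mulVec_mulVec]; rfl
    rw [e1]
    simp [Matrix.mulVec, dotProduct]
  have hconst : (NormedSpace.exp ((-t) • M) *ᵥ z t) = z 0 := by
    have := (convex_Ici (0 : ℝ)).is_const_of_fderivWithin_eq_zero (𝕜 := ℝ)
      (f := fun s : ℝ => NormedSpace.exp ((-s) • M) *ᵥ z s)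
      (fun s hs => (key s hs).differentiableWithinAt)
      (fun s hs => by
        have := (key s hs).hasFDerivWithinAt.fderivWithin (uniqueDiffOn_Ici 0 s hs)
        rw [this]; ext; simp) (x := t) (y := 0) ht (Set.mem_Ici.2 le_rfl)
    simpa using this
  rw [← hconst, Matrix.mulVec_mulVec, exp_neg_smul_mul, Matrix.one_mulVec]

/-! ### Stability -/

/-- The matrix exponential decays. -/
def Stable (M : Matrix ι ι ℝ) : Prop :=
  Filter.Tendsto (fun t : ℝ => NormedSpace.exp (t • M)) Filter.atTop (𝓝 0)

/-- All complex eigenvalues lie in the open left half-plane. -/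
def EigStable (M : Matrix ι ι ℝ) : Prop :=
  ∀ (a : ℂ) (v : ι → ℂ), v ≠ 0 → M.map (algebraMap ℝ ℂ) *ᵥ v = a • v → a.re < 0

theorem hurwitz_iff_eigStable {n : ℕ} (A : Matrix (Fin n) (Fin n) ℝ) :
    Hurwitz A ↔ EigStable A := by
  constructor
  · intro h a v hv hav
    refine h a (Module.End.hasEigenvalue_of_hasEigenvector (x := v) ⟨?_, hv⟩)
    rw [Module.End.mem_eigenspace_iff, Matrix.toLin'_apply, hav]
  · intro h a ha
    obtain ⟨v, hv⟩ := ha.exists_hasEigenvector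
    refine h a v hv.2 ?_
    have := hv.apply_eq_smul
    rwa [Matrix.toLin'_apply] at this

theorem exp_map_complex (M : Matrix ι ι ℝ) :
    (NormedSpace.exp M).map (algebraMap ℝ ℂ) = NormedSpace.exp (M.map (algebraMap ℝ ℂ)) := by
  have hc : Continuous ((algebraMap ℝ ℂ).mapMatrix : Matrix ι ι ℝ →+* Matrix ι ι ℂ) := by
    exact Continuous.matrix_map continuous_id Complex.continuous_ofReal
  exact NormedSpace.map_exp ((algebraMap ℝ ℂ).mapMatrix : Matrix ι ι ℝ →+* Matrix ι ι ℂ) hc M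

theorem Stable.transpose {M : Matrix ι ι ℝ} (h : Stable M) : Stable Mᵀ := by
  have h2 : Filter.Tendsto (fun t : ℝ => (NormedSpace.exp (t • M))ᵀ) Filter.atTop (𝓝 0ᵀ) :=
    (Continuous.matrix_transpose continuous_id).continuousAt.tendsto.comp h
  simpa only [Stable, ← Matrix.transpose_smul, Matrix.exp_transpose, Matrix.transpose_zero] using h2

theorem Stable.eigStable {M : Matrix ι ι ℝ} (h : Stable M) : EigStable M := by
  intro a v hv hav
  obtain ⟨i, hi⟩ := Function.ne_iff.1 hv
  have h1 : ∀ t : ℝ, ((NormedSpace.exp (t • M)).map (algebraMap ℝ ℂ) *ᵥ v) i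
      = Complex.exp (t * a) * v i := by
    intro t
    rw [exp_map_complex, exp_mulVec_of_eigenvector (a := t * a)]
    · simp
    · have : (t • M).map (algebraMap ℝ ℂ) = (t : ℂ) • M.map (algebraMap ℝ ℂ) := by
        ext; simp
      rw [this, Matrix.smul_mulVec, hav, smul_smul]
  have hc : Continuous (fun Z : Matrix ι ι ℝ => (Z.map (algebraMap ℝ ℂ) *ᵥ v) i) := by
    have h3 : Continuous fun Z : Matrix ι ι ℝ => Z.map (algebraMap ℝ ℂ) :=
      Continuous.matrix_map continuous_id Complex.continuous_ofReal
    exact (continuous_apply i).comp (Continuous.matrix_mulVec h3 continuous_const)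
  have h2 : Filter.Tendsto (fun t : ℝ => ‖Complex.exp (t * a) * v i‖) Filter.atTop (𝓝 0) := by
    have := (hc.continuousAt.tendsto.comp h).norm
    simp only [Function.comp_def, h1] at this
    simpa [Matrix.map_zero] using this
  by_contra hre
  push Not at hre
  have h4 : ∀ᶠ t : ℝ in Filter.atTop, ‖v i‖ ≤ ‖Complex.exp (t * a) * v i‖ := by
    filter_upwards [Filter.eventually_ge_atTop 0] with t ht
    rw [norm_mul, Complex.norm_exp]
    have : 1 ≤ Real.exp (t * a : ℂ).re := by
      rw [Real.one_le_exp_iff]; simp; positivity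
    nlinarith [norm_nonneg (v i)]
  have := ge_of_tendsto h2 h4
  exact hi (norm_le_zero_iff.1 this)

/-- Spectral mapping for the exponential: the eigenspace of `exp X` is invariant under `X`, which
commutes with it, and so contains an eigenvector of `X`. -/
theorem exists_eigenvector_of_exp {X : Matrix ι ι ℂ} {b : ℂ}
    (hb : b ∈ spectrum ℂ (NormedSpace.exp X)) :
    ∃ (a : ℂ) (v : ι → ℂ), v ≠ 0 ∧ X *ᵥ v = a • v ∧ Complex.exp a = b := by
  rw [← Matrix.spectrum_toLin', ← Module.End.hasEigenvalue_iff_mem_spectrum] at hb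
  have hmap : ∀ w ∈ Module.End.eigenspace (Matrix.toLin' (NormedSpace.exp X)) b,
      Matrix.toLin' X w ∈ Module.End.eigenspace (Matrix.toLin' (NormedSpace.exp X)) b := by
    intro w hw
    rw [Module.End.mem_eigenspace_iff, Matrix.toLin'_apply] at hw ⊢
    rw [Matrix.toLin'_apply, Matrix.mulVec_mulVec, ← mul_exp_eq_exp_mul (rfl : X * X = X * X),
      ← Matrix.mulVec_mulVec, hw, Matrix.mulVec_smul]
  have : Nontrivial (Module.End.eigenspace (Matrix.toLin' (NormedSpace.exp X)) b) :=
    Submodule.nontrivial_iff_ne_bot.2 hb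
  obtain ⟨a, ha⟩ := Module.End.exists_eigenvalue ((Matrix.toLin' X).restrict hmap)
  obtain ⟨v, hv⟩ := ha.exists_hasEigenvector
  have hXv : X *ᵥ (v : ι → ℂ) = a • (v : ι → ℂ) := by
    have := congrArg Subtype.val hv.apply_eq_smul
    simpa [Matrix.toLin'_apply] using this
  have hv0 : (v : ι → ℂ) ≠ 0 := fun h => hv.2 (Subtype.ext h)
  refine ⟨a, v, hv0, hXv, ?_⟩
  have h1 := exp_mulVec_of_eigenvector hXv
  have h2 := Module.End.mem_eigenspace_iff.1 v.2
  rw [Matrix.toLin'_apply, h1] at h2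
  exact smul_left_injective ℂ hv0 h2

/-- Gelfand's formula: the spectral radius is below some `r < 1`, so eventually `‖X ^ k‖ ≤ r ^ k`.
-/
theorem tendsto_pow_of_spectrum {X : Matrix ι ι ℂ} (h : ∀ b ∈ spectrum ℂ X, ‖b‖ < 1) :
    Filter.Tendsto (fun k : ℕ => X ^ k) Filter.atTop (𝓝 0) := by
  rcases isEmpty_or_nonempty ι with hι | hι
  · exact (tendsto_const_nhds (x := (0 : Matrix ι ι ℂ))).congr fun _ => Subsingleton.elim _ _
  have hr : spectralRadius ℂ X < 1 := by
    have := spectrum.spectralRadius_lt_of_forall_lt X (r := 1) (fun k hk => by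
      have := h k hk
      exact_mod_cast this)
    simpa using this
  obtain ⟨r, hr1, hr2⟩ := exists_between hr
  have hG := spectrum.pow_norm_pow_one_div_tendsto_nhds_spectralRadius X
  have hev := hG.eventually_lt_const hr1
  have hrr : r ≠ ⊤ := (hr2.trans ENNReal.one_lt_top).ne
  refine tendsto_zero_iff_norm_tendsto_zero.2 ?_
  have hr3 : r.toReal < 1 := by
    rw [← ENNReal.toReal_one]; exact (ENNReal.toReal_lt_toReal hrr ENNReal.one_ne_top).2 hr2
  refine squeeze_zero' (Filter.Eventually.of_forall fun _ => norm_nonneg _) ?_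
    (tendsto_pow_atTop_nhds_zero_of_lt_one ENNReal.toReal_nonneg hr3)
  filter_upwards [hev, Filter.eventually_gt_atTop 0] with k hk hk0
  have hk1 : ‖X ^ k‖ ^ (1 / k : ℝ) ≤ r.toReal := by
    rw [← ENNReal.ofReal_le_iff_le_toReal hrr]; exact hk.le
  have hk2 : (0 : ℝ) < k := by exact_mod_cast hk0
  calc ‖X ^ k‖ = (‖X ^ k‖ ^ (1 / k : ℝ)) ^ k := by
        rw [← Real.rpow_natCast, ← Real.rpow_mul (norm_nonneg _), one_div,
          inv_mul_cancel₀ hk2.ne', Real.rpow_one]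
    _ ≤ r.toReal ^ k := by gcongr

/-- The eigenvalues of `exp M` are exponentials of those of `M`, so they lie in the open unit disk
and the powers of `exp M` decay. For real `t`, the fractional part contributes a factor bounded on
`[0, 1]`. -/
theorem EigStable.stable {M : Matrix ι ι ℝ} (h : EigStable M) : Stable M := by
  have h1 : Filter.Tendsto (fun k : ℕ => (NormedSpace.exp (M.map (algebraMap ℝ ℂ))) ^ k)
      Filter.atTop (𝓝 0) := by
    refine tendsto_pow_of_spectrum fun b hb => ?_
    obtain ⟨a, v, hv, hav, rfl⟩ := exists_eigenvector_of_exp hb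
    rw [Complex.norm_exp, Real.exp_lt_one_iff]
    exact h a v hv hav
  have h2 : Filter.Tendsto (fun k : ℕ => (NormedSpace.exp M) ^ k) Filter.atTop (𝓝 0) := by
    have hc : Continuous (fun Z : Matrix ι ι ℂ => Z.map Complex.re) :=
      Continuous.matrix_map continuous_id Complex.continuous_re
    have h3 := hc.continuousAt.tendsto.comp h1
    have h4 : ∀ k : ℕ, ((NormedSpace.exp (M.map (algebraMap ℝ ℂ))) ^ k).map Complex.re
        = (NormedSpace.exp M) ^ k := by
      intro k
      have : (NormedSpace.exp (M.map (algebraMap ℝ ℂ))) ^ k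
          = ((NormedSpace.exp M) ^ k).map (algebraMap ℝ ℂ) := by
        rw [← exp_map_complex]
        exact (map_pow ((algebraMap ℝ ℂ).mapMatrix : Matrix ι ι ℝ →+* Matrix ι ι ℂ) _ k).symm
      rw [this]; ext; simp
    have h5 := h3.congr h4
    rwa [Matrix.map_zero _ Complex.zero_re] at h5
  obtain ⟨C, hC⟩ := (isCompact_Icc (a := (0 : ℝ)) (b := 1)).exists_bound_of_continuousOn
    (continuous_exp_smul M).continuousOn
  refine tendsto_zero_iff_norm_tendsto_zero.2 ?_
  have h5 : Filter.Tendsto (fun t : ℝ => ‖(NormedSpace.exp M) ^ ⌊t⌋₊‖ * C) Filter.atTop (𝓝 0) := by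
    have := (h2.norm.comp (tendsto_nat_floor_atTop (α := ℝ))).mul_const C
    simpa using this
  refine squeeze_zero' (Filter.Eventually.of_forall fun _ => norm_nonneg _) ?_ h5
  filter_upwards [Filter.eventually_ge_atTop 0] with t ht
  have h6 : NormedSpace.exp (t • M)
      = (NormedSpace.exp M) ^ ⌊t⌋₊ * NormedSpace.exp ((t - ⌊t⌋₊) • M) := by
    rw [← Matrix.exp_nsmul, ← Matrix.exp_add_of_commute]
    · congr 1
      rw [← Nat.cast_smul_eq_nsmul ℝ, ← add_smul]; congr 1; ring
    · exact ((Commute.refl M).smul_left _).smul_right _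
  rw [h6]
  refine (norm_mul_le _ _).trans ?_
  gcongr
  refine hC _ ⟨?_, ?_⟩
  · have := Nat.floor_le ht; linarith
  · have := (Nat.lt_floor_add_one t).le; linarith

end Exponential

/-! ### Lyapunov equations -/

section Lyapunov

set_option linter.unusedSectionVars false

open scoped Matrix.Norms.Operator

variable {ι κ μ : Type*} [Fintype ι] [Fintype κ] [Fintype μ] [DecidableEq ι] [DecidableEq κ]

theorem hasDerivAt_exp_mul_mul_exp (M : Matrix ι ι ℝ) (X : Matrix ι κ ℝ) (N : Matrix κ κ ℝ)
    (t : ℝ) :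
    HasDerivAt (fun s : ℝ => NormedSpace.exp (s • M) * X * NormedSpace.exp (s • N))
      (NormedSpace.exp (t • M) * (M * X + X * N) * NormedSpace.exp (t • N)) t := by
  have h1 := hasDerivAt_matrix_mul (hasDerivAt_exp_smul M t) (hasDerivAt_const t X)
  have h2 := hasDerivAt_matrix_mul h1 (hasDerivAt_exp_smul N t)
  convert h2 using 1
  rw [exp_smul_commute M]
  simp only [Matrix.mul_zero, add_zero, Matrix.mul_add, Matrix.add_mul, Matrix.mul_assoc]

theorem Stable.tendsto_exp_mul_mul_exp {M : Matrix ι ι ℝ} {N : Matrix κ κ ℝ} (hM : Stable M)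
    (hN : Stable N) (X : Matrix ι κ ℝ) :
    Filter.Tendsto (fun s : ℝ => NormedSpace.exp (s • M) * X * NormedSpace.exp (s • N))
      Filter.atTop (𝓝 0) := by
  have hc : Continuous fun p : Matrix ι ι ℝ × Matrix κ κ ℝ => p.1 * X * p.2 :=
    (continuous_fst.matrix_mul continuous_const).matrix_mul continuous_snd
  have h := (hc.tendsto (0, 0)).comp (hM.prodMk_nhds hN)
  simpa [Function.comp_def] using h

/-- The Sylvester equation with stable coefficients has no nonzero homogeneous solution. -/
theorem Stable.eq_zero_of_sylvester {M : Matrix ι ι ℝ} {N : Matrix κ κ ℝ} (hM : Stable M)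
    (hN : Stable N) {X : Matrix ι κ ℝ} (h : M * X + X * N = 0) : X = 0 := by
  -- The curve `exp (t M) X exp (t N)` is constant by the equation and tends to `0` by stability.
  have hd : ∀ t, HasDerivAt
      (fun s : ℝ => NormedSpace.exp (s • M) * X * NormedSpace.exp (s • N)) 0 t := by
    intro t
    have := hasDerivAt_exp_mul_mul_exp M X N t
    rwa [h, Matrix.mul_zero, Matrix.zero_mul] at this
  have hconst : ∀ t : ℝ, NormedSpace.exp (t • M) * X * NormedSpace.exp (t • N) = X := by
    intro t
    ext i j
    have hij := fun t => hasDerivAt_pi.1 (hasDerivAt_pi.1 (hd t) i) j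
    have := is_const_of_deriv_eq_zero (fun t => (hij t).differentiableAt)
      (fun t => (hij t).deriv) t 0
    simpa using this
  have h1 := hM.tendsto_exp_mul_mul_exp hN X
  simp only [hconst] at h1
  exact tendsto_nhds_unique tendsto_const_nhds h1

/-- The Lyapunov operator is injective, hence surjective on a finite-dimensional space. -/
theorem Stable.exists_lyapunov {M : Matrix ι ι ℝ} (hM : Stable M) (Q : Matrix ι ι ℝ) :
    ∃ X : Matrix ι ι ℝ, M * X + X * Mᵀ + Q = 0 := by
  let T : Matrix ι ι ℝ →ₗ[ℝ] Matrix ι ι ℝ :=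
    LinearMap.mulLeft ℝ M + LinearMap.mulRight ℝ Mᵀ
  have hinj : Function.Injective T := by
    rw [injective_iff_map_eq_zero]
    exact fun X hX => hM.eq_zero_of_sylvester hM.transpose hX
  obtain ⟨X, hX⟩ := LinearMap.injective_iff_surjective.1 hinj (-Q)
  exact ⟨X, by rw [show M * X + X * Mᵀ = -Q from hX]; simp⟩

theorem Stable.lyapunov_transpose {M X Q : Matrix ι ι ℝ} (hM : Stable M) (hQ : Qᵀ = Q)
    (h : M * X + X * Mᵀ + Q = 0) : Xᵀ = X := by
  rw [← sub_eq_zero]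
  refine hM.eq_zero_of_sylvester hM.transpose ?_
  have h' := congrArg Matrix.transpose h
  simp only [Matrix.transpose_add, Matrix.transpose_mul, Matrix.transpose_transpose, hQ,
    Matrix.transpose_zero] at h'
  calc M * (Xᵀ - X) + (Xᵀ - X) * Mᵀ
      = (M * Xᵀ + Xᵀ * Mᵀ) - (M * X + X * Mᵀ) := by
        simp only [Matrix.mul_sub, Matrix.sub_mul]; abel
    _ = 0 := by
        rw [eq_neg_of_add_eq_zero_left h, add_comm (M * Xᵀ), eq_neg_of_add_eq_zero_left h', sub_self]

theorem posSemidef_of_real {X : Matrix ι ι ℝ} (hX : Xᵀ = X) (h : ∀ y, 0 ≤ y ⬝ᵥ (X *ᵥ y)) :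
    X.PosSemidef :=
  .of_dotProduct_mulVec_nonneg (by rw [Matrix.IsHermitian, Matrix.conjTranspose_eq_transpose_of_trivial, hX])
    (by simpa using h)

theorem posDef_of_real {X : Matrix ι ι ℝ} (hX : Xᵀ = X) (h : ∀ y ≠ 0, 0 < y ⬝ᵥ (X *ᵥ y)) :
    X.PosDef :=
  .of_dotProduct_mulVec_pos (by rw [Matrix.IsHermitian, Matrix.conjTranspose_eq_transpose_of_trivial, hX])
    (by simpa using h)

theorem _root_.Matrix.PosSemidef.quad_nonneg {X : Matrix ι ι ℝ} (hX : X.PosSemidef) (y : ι → ℝ) :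
    0 ≤ y ⬝ᵥ (X *ᵥ y) := by simpa using hX.dotProduct_mulVec_nonneg y

theorem _root_.Matrix.PosDef.quad_pos {X : Matrix ι ι ℝ} (hX : X.PosDef) {y : ι → ℝ} (hy : y ≠ 0) :
    0 < y ⬝ᵥ (X *ᵥ y) := by simpa using hX.dotProduct_mulVec_pos hy

theorem _root_.Matrix.PosSemidef.transpose_eq {X : Matrix ι ι ℝ} (hX : X.PosSemidef) : Xᵀ = X := by
  have := hX.isHermitian
  rwa [Matrix.IsHermitian, Matrix.conjTranspose_eq_transpose_of_trivial] at this

theorem dotProduct_mul_mulVec (M : Matrix ι κ ℝ) (S : Matrix κ μ ℝ) (y : ι → ℝ) (z : μ → ℝ) :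
    y ⬝ᵥ ((M * S) *ᵥ z) = (Mᵀ *ᵥ y) ⬝ᵥ (S *ᵥ z) := by
  rw [← Matrix.mulVec_mulVec, Matrix.dotProduct_mulVec, ← Matrix.mulVec_transpose]

/-- The quadratic form of `exp (t M) X exp (t Mᵀ)` is nonincreasing in `t` with limit `0`, so it is
nonnegative at `t = 0`. -/
theorem Stable.posSemidef_of_lyapunov {M X Q : Matrix ι ι ℝ} (hM : Stable M) (hQ : Q.PosSemidef)
    (h : M * X + X * Mᵀ + Q = 0) : X.PosSemidef := by
  refine posSemidef_of_real (hM.lyapunov_transpose hQ.transpose_eq h) fun y => ?_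
  have hQ' : M * X + X * Mᵀ = -Q := eq_neg_of_add_eq_zero_left h
  have hc : Continuous fun Z : Matrix ι ι ℝ => y ⬝ᵥ (Z *ᵥ y) :=
    continuous_const.dotProduct (continuous_id.matrix_mulVec continuous_const)
  have hlim := (hc.tendsto 0).comp (hM.tendsto_exp_mul_mul_exp hM.transpose X)
  rw [Matrix.zero_mulVec, dotProduct_zero] at hlim
  have hd : ∀ t : ℝ, HasDerivAt
      (fun s : ℝ => y ⬝ᵥ ((NormedSpace.exp (s • M) * X * NormedSpace.exp (s • Mᵀ)) *ᵥ y))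
      (y ⬝ᵥ ((NormedSpace.exp (t • M) * (-Q) * NormedSpace.exp (t • Mᵀ)) *ᵥ y)) t := by
    intro t
    have h1 := hasDerivAt_exp_mul_mul_exp M X Mᵀ t
    rw [hQ'] at h1
    have h2 := fun i j => hasDerivAt_pi.1 (hasDerivAt_pi.1 h1 i) j
    exact HasDerivAt.fun_sum fun i _ => HasDerivAt.const_mul (y i)
      (HasDerivAt.fun_sum fun j _ => (h2 i j).mul_const (y j))
  have hanti : Antitone
      (fun s : ℝ => y ⬝ᵥ ((NormedSpace.exp (s • M) * X * NormedSpace.exp (s • Mᵀ)) *ᵥ y)) := by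
    refine antitone_of_hasDerivAt_nonpos hd fun t => ?_
    have := hQ.quad_nonneg (NormedSpace.exp (t • Mᵀ) *ᵥ y)
    have e : NormedSpace.exp (t • Mᵀ) = (NormedSpace.exp (t • M))ᵀ := by
      rw [← Matrix.exp_transpose, Matrix.transpose_smul]
    rw [e] at this ⊢
    rw [Matrix.mul_assoc, dotProduct_mul_mulVec, ← Matrix.mulVec_mulVec, Matrix.neg_mulVec,
      dotProduct_neg]
    simpa using this
  have := hanti.le_of_tendsto hlim 0
  simpa using this

theorem Stable.posDef_of_lyapunov {M X Q : Matrix ι ι ℝ} (hM : Stable M) (hQ : Q.PosDef)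
    (h : M * X + X * Mᵀ + Q = 0) : X.PosDef := by
  have hX := hM.posSemidef_of_lyapunov hQ.posSemidef h
  refine posDef_of_real hX.transpose_eq fun y hy => ?_
  refine lt_of_le_of_ne (hX.quad_nonneg y) fun h0 => ?_
  have h1 : X *ᵥ y = 0 := by
    have := hX.dotProduct_mulVec_zero_iff y
    simpa using this.1 (by simpa using h0.symm)
  have h2 := congrArg (fun Z : Matrix ι ι ℝ => y ⬝ᵥ (Z *ᵥ y)) h
  have h3 := hQ.quad_pos hy
  have h4 : y ⬝ᵥ ((X * Mᵀ) *ᵥ y) = 0 := by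
    rw [dotProduct_mul_mulVec, hX.transpose_eq, h1, zero_dotProduct]
  simp only [Matrix.add_mulVec, dotProduct_add, h4, dotProduct_mul_mulVec, h1,
    Matrix.zero_mulVec, dotProduct_zero] at h2
  linarith

/-- Lyapunov's criterion. -/
theorem stable_of_lyapunov {M S : Matrix ι ι ℝ} (hS : S.PosDef)
    (h : ∀ y ≠ 0, y ⬝ᵥ ((M * S + S * Mᵀ) *ᵥ y) < 0) : Stable M := by
  suffices EigStable Mᵀ by simpa using this.stable.transpose
  intro a v hv hav
  -- For an eigenvector `x + i y` of `Mᵀ`, adding the real forms at `x` and `y` cancels the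
  -- imaginary part of the eigenvalue and leaves `2 Re a` times the `S`-norm.
  set x : ι → ℝ := fun i => (v i).re with hx
  set y : ι → ℝ := fun i => (v i).im with hy
  have h1 : Mᵀ *ᵥ x = a.re • x - a.im • y := by
    ext i
    have := congrArg Complex.re (congrFun hav i)
    simpa [Matrix.mulVec, dotProduct, hx, hy] using this
  have h2 : Mᵀ *ᵥ y = a.re • y + a.im • x := by
    ext i
    have := congrArg Complex.im (congrFun hav i)
    simpa [Matrix.mulVec, dotProduct, hx, hy] using this
  have hsymm : ∀ p q : ι → ℝ, p ⬝ᵥ (S *ᵥ q) = q ⬝ᵥ (S *ᵥ p) := by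
    intro p q
    rw [Matrix.dotProduct_mulVec, ← Matrix.mulVec_transpose, hS.posSemidef.transpose_eq,
      dotProduct_comm]
  have hq : ∀ p : ι → ℝ, p ⬝ᵥ ((M * S + S * Mᵀ) *ᵥ p) = 2 * ((Mᵀ *ᵥ p) ⬝ᵥ (S *ᵥ p)) := by
    intro p
    rw [Matrix.add_mulVec, dotProduct_add, dotProduct_mul_mulVec, ← Matrix.mulVec_mulVec, hsymm p]
    ring
  have hle : ∀ p : ι → ℝ, p ⬝ᵥ ((M * S + S * Mᵀ) *ᵥ p) ≤ 0 := by
    intro p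
    rcases eq_or_ne p 0 with rfl | hp
    · simp
    · exact (h p hp).le
  have hxy : x ≠ 0 ∨ y ≠ 0 := by
    by_contra hcon
    push Not at hcon
    refine hv (funext fun i => Complex.ext ?_ ?_)
    · exact congrFun hcon.1 i
    · exact congrFun hcon.2 i
  have hsum : x ⬝ᵥ ((M * S + S * Mᵀ) *ᵥ x) + y ⬝ᵥ ((M * S + S * Mᵀ) *ᵥ y)
      = 2 * a.re * (x ⬝ᵥ (S *ᵥ x) + y ⬝ᵥ (S *ᵥ y)) := by
    rw [hq, hq, h1, h2]
    simp only [sub_dotProduct, add_dotProduct, smul_dotProduct, smul_eq_mul]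
    rw [hsymm y x]
    ring
  have hneg : x ⬝ᵥ ((M * S + S * Mᵀ) *ᵥ x) + y ⬝ᵥ ((M * S + S * Mᵀ) *ᵥ y) < 0 := by
    rcases hxy with h' | h'
    · linarith [h x h', hle y]
    · linarith [h y h', hle x]
  have hpos : 0 ≤ x ⬝ᵥ (S *ᵥ x) + y ⬝ᵥ (S *ᵥ y) :=
    add_nonneg (hS.posSemidef.quad_nonneg x) (hS.posSemidef.quad_nonneg y)
  rw [hsum] at hneg
  by_contra hre
  push Not at hre
  have := mul_nonneg (mul_nonneg zero_le_two hre) hpos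
  linarith

end Lyapunov

/-! ### The Riccati equation -/

section Riccati

set_option linter.unusedSectionVars false

variable {ι κ : Type*} [Fintype ι] [Fintype κ] [DecidableEq ι] [DecidableEq κ]

/-- The left-hand side of the Riccati equation. -/
def riccatiResidual (A : Matrix ι ι ℝ) (B : Matrix ι κ ℝ) (X : Matrix ι ι ℝ) : Matrix ι ι ℝ :=
  Aᵀ * X + X * A - X * B * Bᵀ * X + 1

variable {A X Y : Matrix ι ι ℝ} {B : Matrix ι κ ℝ}

/-- Rewrites the Riccati expression as a Lyapunov expression for the loop closed with the gain `-Bᵀ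
X`. It serves both for stability and for the improvement step. -/
theorem closed_lyapunov_eq (hX : Xᵀ = X) :
    (A - B * Bᵀ * X)ᵀ * X + X * (A - B * Bᵀ * X)
      = riccatiResidual A B X - 1 - (Bᵀ * X)ᵀ * (Bᵀ * X) := by
  simp only [riccatiResidual, Matrix.transpose_sub, Matrix.transpose_mul, Matrix.transpose_transpose,
    hX, Matrix.sub_mul, Matrix.mul_sub, Matrix.mul_assoc]
  abel

theorem quad_transpose_mul_self_nonneg (F : Matrix κ ι ℝ) (y : ι → ℝ) :
    0 ≤ y ⬝ᵥ ((Fᵀ * F) *ᵥ y) := by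
  rw [dotProduct_mul_mulVec, Matrix.transpose_transpose]
  exact Finset.sum_nonneg fun _ _ => mul_self_nonneg _

theorem dotProduct_self_pos {y : ι → ℝ} (hy : y ≠ 0) : 0 < y ⬝ᵥ y :=
  lt_of_le_of_ne (Finset.sum_nonneg fun _ _ => mul_self_nonneg _)
    fun h => hy (dotProduct_self_eq_zero.1 h.symm)

/-- On a kernel vector `y` of `X` the residual form reduces to `y ⬝ᵥ y`, which a nonpositive
residual forbids unless `y = 0`. -/
theorem posDef_of_supersolution (hX : X.PosSemidef) (hR : (-riccatiResidual A B X).PosSemidef) :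
    X.PosDef := by
  refine posDef_of_real hX.transpose_eq fun y hy => lt_of_le_of_ne (hX.quad_nonneg y) fun h0 => ?_
  have h1 : X *ᵥ y = 0 := by
    have := hX.dotProduct_mulVec_zero_iff y
    simpa using this.1 (by simpa using h0.symm)
  have h2 := hR.quad_nonneg y
  have h3 : (X * A) *ᵥ y = (X * A) *ᵥ y := rfl
  simp only [riccatiResidual, Matrix.neg_mulVec, Matrix.add_mulVec, Matrix.sub_mulVec,
    ← Matrix.mulVec_mulVec, h1, Matrix.mulVec_zero, dotProduct_neg, dotProduct_add,
    dotProduct_sub, dotProduct_zero, Matrix.one_mulVec] at h2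
  rw [Matrix.dotProduct_mulVec y X, ← Matrix.mulVec_transpose, hX.transpose_eq, h1,
    zero_dotProduct] at h2
  linarith [dotProduct_self_pos hy]

theorem stable_of_supersolution (hX : X.PosSemidef) (hR : (-riccatiResidual A B X).PosSemidef) :
    Stable (A - B * Bᵀ * X) := by
  suffices h : Stable (A - B * Bᵀ * X)ᵀ by simpa using h.transpose
  refine stable_of_lyapunov (posDef_of_supersolution hX hR) fun y hy => ?_
  rw [Matrix.transpose_transpose, closed_lyapunov_eq hX.transpose_eq]
  have h1 := quad_transpose_mul_self_nonneg (Bᵀ * X) y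
  have h2 := hR.quad_nonneg y
  simp only [Matrix.sub_mulVec, dotProduct_sub, Matrix.one_mulVec, Matrix.neg_mulVec,
    dotProduct_neg] at h2 ⊢
  linarith [dotProduct_self_pos hy]

/-- `X` is the quadratic cost of the feedback `F`. Completing the square gives the residual `-(F +
Bᵀ X)ᵀ (F + Bᵀ X)`. -/
theorem exists_supersolution_of_stable_gain {F : Matrix κ ι ℝ} (hF : Stable (A + B * F)) :
    ∃ X : Matrix ι ι ℝ, X.PosSemidef ∧ (-riccatiResidual A B X).PosSemidef ∧
      (A + B * F)ᵀ * X + X * (A + B * F) + (1 + Fᵀ * F) = 0 := by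
  obtain ⟨X, hX⟩ := hF.transpose.exists_lyapunov (1 + Fᵀ * F)
  rw [Matrix.transpose_transpose] at hX
  have hQ : (1 + Fᵀ * F).PosSemidef :=
    Matrix.PosSemidef.one.add (by simpa using Matrix.posSemidef_conjTranspose_mul_self F)
  have hpsd := hF.transpose.posSemidef_of_lyapunov hQ (by rwa [Matrix.transpose_transpose])
  refine ⟨X, hpsd, ?_, hX⟩
  have : -riccatiResidual A B X = (F + Bᵀ * X)ᵀ * (F + Bᵀ * X) := by
    rw [← sub_eq_zero, ← neg_eq_zero, ← hX]
    simp only [riccatiResidual, Matrix.transpose_add, Matrix.transpose_mul,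
      Matrix.transpose_transpose, hpsd.transpose_eq, Matrix.add_mul, Matrix.mul_add,
      Matrix.mul_assoc]
    abel
  rw [this]
  simpa using Matrix.posSemidef_conjTranspose_mul_self (F + Bᵀ * X)

/-- One step of policy iteration (Kleinman): `Y` is the cost of the gain `-Bᵀ X`. The difference `X
- Y` solves a Lyapunov equation whose source is minus the residual of `X`, so it is positive
semidefinite, and it can vanish only if the residual does. -/
theorem exists_improvement (hX : X.PosSemidef) (hR : (-riccatiResidual A B X).PosSemidef) :
    ∃ Y : Matrix ι ι ℝ, Y.PosSemidef ∧ (-riccatiResidual A B Y).PosSemidef ∧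
      (X - Y).PosSemidef ∧ (X = Y → riccatiResidual A B X = 0) := by
  have hst := stable_of_supersolution hX hR
  have hst' : Stable (A + B * (-(Bᵀ * X))) := by
    rwa [Matrix.mul_neg, ← Matrix.mul_assoc, ← sub_eq_add_neg]
  obtain ⟨Y, hY, hRY, hLY⟩ := exists_supersolution_of_stable_gain hst'
  have e : A + B * (-(Bᵀ * X)) = A - B * Bᵀ * X := by
    rw [Matrix.mul_neg, ← Matrix.mul_assoc, ← sub_eq_add_neg]
  rw [e] at hLY
  have key : (A - B * Bᵀ * X)ᵀ * (X - Y) + (X - Y) * (A - B * Bᵀ * X)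
      + (-riccatiResidual A B X) = 0 := by
    have h1 := closed_lyapunov_eq (A := A) (B := B) hX.transpose_eq
    calc _ = ((A - B * Bᵀ * X)ᵀ * X + X * (A - B * Bᵀ * X))
          - ((A - B * Bᵀ * X)ᵀ * Y + Y * (A - B * Bᵀ * X)) - riccatiResidual A B X := by
          simp only [Matrix.mul_sub, Matrix.sub_mul]; abel
      _ = 0 := by
          rw [h1, eq_neg_of_add_eq_zero_left hLY]
          simp only [Matrix.transpose_neg, Matrix.neg_mul, Matrix.mul_neg, neg_neg]
          abel
  refine ⟨Y, hY, hRY, ?_, fun hXY => ?_⟩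
  · exact hst.transpose.posSemidef_of_lyapunov hR (by rwa [Matrix.transpose_transpose])
  · rw [hXY, sub_self, Matrix.mul_zero, Matrix.zero_mul, zero_add, zero_add, neg_eq_zero] at key
    rwa [hXY]

theorem isClosed_posSemidef : IsClosed {X : Matrix ι ι ℝ | X.PosSemidef} := by
  have : {X : Matrix ι ι ℝ | X.PosSemidef}
      = {X | Xᵀ = X} ∩ ⋂ y : ι → ℝ, {X | 0 ≤ y ⬝ᵥ (X *ᵥ y)} := by
    ext X
    simp only [Set.mem_ofPred_eq, Set.mem_inter_iff, Set.mem_iInter]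
    exact ⟨fun h => ⟨h.transpose_eq, h.quad_nonneg⟩, fun h => posSemidef_of_real h.1 h.2⟩
  rw [this]
  refine (isClosed_eq (Continuous.matrix_transpose continuous_id) continuous_id).inter
    (isClosed_iInter fun y => isClosed_le continuous_const ?_)
  exact continuous_const.dotProduct (continuous_id.matrix_mulVec continuous_const)

theorem continuous_riccatiResidual : Continuous (riccatiResidual A B) := by
  unfold riccatiResidual
  fun_prop

theorem _root_.Matrix.PosSemidef.abs_apply_le_trace (hX : X.PosSemidef) (i j : ι) :
    |X i j| ≤ X.trace := by
  have hd : ∀ k, 0 ≤ X k k := fun k => hX.diag_nonneg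
  have htr : ∀ k, X k k ≤ X.trace := fun k =>
    Finset.single_le_sum (f := fun k => X k k) (fun k _ => hd k) (Finset.mem_univ k)
  have hs : X j i = X i j := congrFun (congrFun hX.transpose_eq i) j
  have h1 := hX.quad_nonneg (Pi.single i 1 + Pi.single j 1)
  have h2 := hX.quad_nonneg (Pi.single i 1 - Pi.single j 1)
  simp only [Matrix.mulVec_add, Matrix.mulVec_sub, add_dotProduct, sub_dotProduct, dotProduct_add,
    dotProduct_sub, Matrix.mulVec_single_one, single_one_dotProduct, Matrix.col_apply, hs] at h1 h2
  rw [abs_le]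
  constructor <;> linarith [htr i, htr j]

/-- Supersolutions of bounded trace form a compact set, since the trace of a positive semidefinite
matrix bounds its entries. At a minimizer of the trace the improvement step changes nothing, so the
residual is zero. -/
theorem exists_riccati_solution {F : Matrix κ ι ℝ} (hF : Stable (A + B * F)) :
    ∃ P : Matrix ι ι ℝ, P.PosDef ∧ riccatiResidual A B P = 0 := by
  obtain ⟨X₀, hX₀, hR₀, -⟩ := exists_supersolution_of_stable_gain hF
  let K : Set (Matrix ι ι ℝ) :=
    {X | X.PosSemidef} ∩ {X | (-riccatiResidual A B X).PosSemidef} ∩ {X | X.trace ≤ X₀.trace}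
  have hKclosed : IsClosed K :=
    (isClosed_posSemidef.inter (isClosed_posSemidef.preimage continuous_riccatiResidual.neg)).inter
      (isClosed_le (continuous_id.matrix_trace) continuous_const)
  have hbox : IsCompact {X : ι → ι → ℝ | ∀ i j, X i j ∈ Set.Icc (-X₀.trace) X₀.trace} := by
    have e : {X : ι → ι → ℝ | ∀ i j, X i j ∈ Set.Icc (-X₀.trace) X₀.trace}
        = Set.univ.pi fun _ => Set.univ.pi fun _ => Set.Icc (-X₀.trace) X₀.trace := by
      ext X
      simp only [Set.mem_ofPred_eq, Set.mem_pi, Set.mem_univ, forall_true_left]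
    rw [e]
    exact isCompact_univ_pi fun _ => isCompact_univ_pi fun _ => isCompact_Icc
  have hK : IsCompact K := hbox.of_isClosed_subset hKclosed fun X hX i j =>
    abs_le.1 ((hX.1.1.abs_apply_le_trace i j).trans hX.2)
  obtain ⟨P, hP, hmin⟩ := hK.exists_isMinOn ⟨X₀, ⟨hX₀, hR₀⟩, le_refl X₀.trace⟩
    (Continuous.matrix_trace continuous_id).continuousOn
  obtain ⟨Y, hY, hRY, hPY, himp⟩ := exists_improvement hP.1.1 hP.1.2
  have htr := hPY.trace_nonneg
  rw [Matrix.trace_sub] at htr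
  have htr' : Y.trace ≤ P.trace := by linarith
  have hYK : Y ∈ K := ⟨⟨hY, hRY⟩, htr'.trans hP.2⟩
  have hmin' : P.trace ≤ Y.trace := hmin hYK
  refine ⟨P, posDef_of_supersolution hP.1.1 hP.1.2, himp (sub_eq_zero.1 ?_)⟩
  exact hPY.trace_eq_zero_iff.1 (by rw [Matrix.trace_sub]; linarith)

theorem stable_of_riccati (hX : X.PosDef) (hR : riccatiResidual A B X = 0) :
    Stable (A - B * Bᵀ * X) :=
  stable_of_supersolution hX.posSemidef (by rw [hR, neg_zero]; exact .zero)

/-- The difference of the two residuals is a Sylvester expression in `X - Y`, whose coefficients are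
the two stable closed-loop matrices. -/
theorem riccati_unique (hX : X.PosDef) (hRX : riccatiResidual A B X = 0)
    (hY : Y.PosDef) (hRY : riccatiResidual A B Y = 0) : X = Y := by
  rw [← sub_eq_zero]
  refine (stable_of_riccati hX hRX).transpose.eq_zero_of_sylvester (stable_of_riccati hY hRY) ?_
  have h : riccatiResidual A B X - riccatiResidual A B Y = 0 := by rw [hRX, hRY, sub_zero]
  rw [← h]
  simp only [riccatiResidual, Matrix.transpose_sub, Matrix.transpose_mul, Matrix.transpose_transpose,
    hX.posSemidef.transpose_eq, Matrix.sub_mul, Matrix.mul_sub, Matrix.mul_assoc]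
  abel

theorem existsUnique_riccatiSolution {n m : ℕ} {A : Matrix (Fin n) (Fin n) ℝ}
    {B : Matrix (Fin n) (Fin m) ℝ} (h : Stabilizable A B) :
    ∃! P : Matrix (Fin n) (Fin n) ℝ, IsRiccatiSolution A B P := by
  obtain ⟨F, hF⟩ := h
  obtain ⟨P, hP, hR⟩ := exists_riccati_solution ((hurwitz_iff_eigStable _).1 hF).stable
  exact ⟨P, ⟨hP, hR⟩, fun Q hQ => riccati_unique hQ.1 hQ.2 hP hR⟩

end Riccati

/-! ### Spanning trees and the Laplacian matrix -/

namespace CommGraph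

/-- The nodes at distance at most `n`, in the sense of walks of length `n`, from `r`. -/
def WalkFrom {V : Type*} (R : V → V → Prop) (r : V) : ℕ → V → Prop
  | 0, k => k = r
  | n + 1, k => ∃ j, WalkFrom R r n j ∧ R j k

theorem exists_walkFrom {V : Type*} {R : V → V → Prop} {r k : V}
    (h : Relation.ReflTransGen R r k) : ∃ n, WalkFrom R r n k := by
  induction h with
  | refl => exact ⟨0, rfl⟩
  | tail _ hjk ih => exact ⟨ih.choose + 1, _, ih.choose_spec, hjk⟩

/-- The parent of `k` is the last but one node of a shortest walk from `r`; `d` is the length of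
such a walk. -/
theorem exists_parent {V : Type*} {R : V → V → Prop} {r : V}
    (h : ∀ k, Relation.ReflTransGen R r k) :
    ∃ (f : V → V) (d : V → ℕ), ∀ k, k ≠ r → R (f k) k ∧ d (f k) < d k := by
  classical
  have hw := fun k => exists_walkFrom (h k)
  have key : ∀ k, ∃ j, k ≠ r → R j k ∧ Nat.find (hw j) < Nat.find (hw k) := by
    intro k
    by_cases hk : k = r
    · exact ⟨k, fun h => absurd hk h⟩
    · have hs := Nat.find_spec (hw k)
      generalize hn : Nat.find (hw k) = n at hs
      cases n with
      | zero => exact absurd hs hk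
      | succ n =>
        obtain ⟨j, hj, hjk⟩ := hs
        exact ⟨j, fun _ => ⟨hjk, Nat.lt_succ_of_le (Nat.find_min' _ hj)⟩⟩
  choose f hf using key
  exact ⟨f, fun k => Nat.find (hw k), hf⟩

/-- No tree edge enters `r`, and the only one entering `k ≠ r` comes from `f k`. A path to `k` is
therefore a path to `f k` with `k` appended, and induction on depth applies. -/
theorem existsUnique_path_of_parent {V : Type*} {r : V} (f : V → V) (d : V → ℕ)
    (hd : ∀ k, k ≠ r → d (f k) < d k) (k : V) :
    ∃! p : List V, IsPath (fun j k => k ≠ r ∧ j = f k) r k p := by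
  induction hn : d k using Nat.strong_induction_on generalizing k with
  | _ n ih =>
  subst hn
  have hdecomp : ∀ p : List V, IsPath (fun j k => k ≠ r ∧ j = f k) r k p →
      (k = r ∧ p = [k]) ∨ (k ≠ r ∧ ∃ l, p = l ++ [k] ∧
        IsPath (fun j k => k ≠ r ∧ j = f k) r (f k) l) := by
    rintro p ⟨hc, hh, hl⟩
    obtain ⟨l, rfl⟩ : ∃ l, p = l ++ [k] := List.getLast?_eq_some_iff.1 hl
    rcases List.eq_nil_or_concat l with rfl | ⟨l', j, rfl⟩
    · left
      simpa using hh
    · right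
      simp only [List.concat_eq_append] at *
      have hc' := List.isChain_append.1 hc
      have hjk := hc'.2.2 j (by simp) k (by simp)
      refine ⟨hjk.1, _, rfl, hc'.1, ?_, by simp [hjk.2]⟩
      rw [List.head?_append_of_ne_nil _ (by simp)] at hh
      exact hh
  by_cases hk : k = r
  · subst hk
    refine ⟨[k], ⟨List.isChain_singleton _, rfl, rfl⟩, fun p hp => ?_⟩
    rcases hdecomp p hp with h | h
    · exact h.2
    · exact absurd rfl h.1
  · obtain ⟨q, hq, hqu⟩ := ih (d (f k)) (hd k hk) (f k) rfl
    refine ⟨q ++ [k], ⟨?_, ?_, by simp⟩, fun p hp => ?_⟩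
    · refine List.isChain_append.2 ⟨hq.1, List.isChain_singleton _, fun x hx y hy => ?_⟩
      rw [hq.2.2] at hx
      simp only [Option.mem_def, Option.some.injEq, List.head?_cons] at hx hy
      exact hy ▸ ⟨hk, hx.symm⟩
    · have : q ≠ [] := by rintro rfl; simpa using hq.2.1
      rw [List.head?_append_of_ne_nil _ this]
      exact hq.2.1
    · rcases hdecomp p hp with h | ⟨-, l, rfl, hl⟩
      · exact absurd h.1 hk
      · rw [hqu l hl]

variable {G : CommGraph}

theorem hasDirectedSpanningTree_of_reach {r : Fin G.N}
    (h : ∀ k, Relation.ReflTransGen G.Edge r k) : G.HasDirectedSpanningTree := by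
  obtain ⟨f, d, hfd⟩ := exists_parent h
  refine ⟨fun j k => k ≠ r ∧ j = f k, ?_, r, existsUnique_path_of_parent f d fun k hk => (hfd k hk).2⟩
  rintro j k ⟨hk, rfl⟩
  exact (hfd k hk).1

theorem HasDirectedSpanningTree.exists_reach (h : G.HasDirectedSpanningTree) :
    ∃ r : Fin G.N, ∀ k, Relation.ReflTransGen G.Edge r k := by
  obtain ⟨T, hT, r, hr⟩ := h
  refine ⟨r, fun k => ?_⟩
  obtain ⟨p, ⟨hc, hh, hl⟩, -⟩ := hr k
  have hne : p ≠ [] := by rintro rfl; simp at hh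
  have h1 := List.relationReflTransGen_of_exists_isChain p (hc.imp hT) hne
  have e1 : p.head hne = r := by
    rw [List.head?_eq_some_head hne] at hh; exact Option.some.inj hh
  have e2 : p.getLast hne = k := by
    rw [List.getLast?_eq_some_getLast hne] at hl; exact Option.some.inj hl
  rwa [e1, e2] at h1

theorem laplacian_mulVec (v : Fin G.N → ℝ) (i : Fin G.N) :
    (G.laplacian *ᵥ v) i = ∑ j, G.a i j * (v i - v j) := by
  have h := congrFun (G.relative_eq (q := 1) (fun j _ => v j) i) 0
  simp only [relative, Finset.sum_apply, Pi.smul_apply, Pi.sub_apply, smul_eq_mul] at h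
  exact h.symm

theorem laplacian_sum_row (i : Fin G.N) : ∑ j, G.laplacian i j = 0 := by
  have := G.laplacian_mulVec (fun _ => 1) i
  simpa [Matrix.mulVec, dotProduct] using this

/-- A nonempty set of nodes without incoming edges carries a left null vector of the Laplacian. -/
theorem exists_vecMul_eq_zero_of_closed {S : Set (Fin G.N)} (hS : S.Nonempty)
    (hcl : ∀ i ∈ S, ∀ j, G.Edge j i → j ∈ S) :
    ∃ q : Fin G.N → ℝ, q ≠ 0 ∧ (∀ i ∉ S, q i = 0) ∧ q ᵥ* G.laplacian = 0 := by
  classical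
  have hL : ∀ i ∈ S, ∀ j ∉ S, G.laplacian i j = 0 := by
    intro i hi j hj
    have hij : i ≠ j := by rintro rfl; exact hj hi
    have h0 : G.a i j = 0 := by
      by_contra hne
      exact hj (hcl i hi j (lt_of_le_of_ne (G.nonneg i j) (Ne.symm hne)))
    simp [laplacian, hij, h0]
  -- Rows of the Laplacian on `S`, identity rows elsewhere. The indicator of `S` is a right null
  -- vector, so a left null vector exists; it vanishes off `S` because the columns outside `S` are
  -- unit vectors.
  let M : Matrix (Fin G.N) (Fin G.N) ℝ :=
    Matrix.of fun i j => if i ∈ S then G.laplacian i j else if i = j then 1 else 0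
  have hM : M.det = 0 := by
    rw [← Matrix.exists_mulVec_eq_zero_iff]
    obtain ⟨s, hs⟩ := hS
    refine ⟨fun j => if j ∈ S then 1 else 0, fun h => by simpa [hs] using congrFun h s, ?_⟩
    ext i
    simp only [Matrix.mulVec, dotProduct, M, Matrix.of_apply, Pi.zero_apply]
    by_cases hi : i ∈ S
    · simp only [hi, if_true]
      rw [← G.laplacian_sum_row i]
      refine Finset.sum_congr rfl fun j _ => ?_
      by_cases hj : j ∈ S
      · simp [hj]
      · simp [hj, hL i hi j hj]
    · simp only [hi, if_false, ite_mul, one_mul, zero_mul]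
      rw [Finset.sum_ite_eq]
      simp [hi]
  obtain ⟨q, hq, hqM⟩ := Matrix.exists_vecMul_eq_zero_iff.2 hM
  have hq0 : ∀ j ∉ S, q j = 0 := by
    intro j hj
    have := congrFun hqM j
    simp only [Matrix.vecMul, dotProduct, M, Matrix.of_apply, Pi.zero_apply] at this
    rw [Finset.sum_eq_single j] at this
    · simpa [hj] using this
    · intro i _ hij
      by_cases hi : i ∈ S
      · simp [hi, hL i hi j hj]
      · simp [hi, hij]
    · simp
  refine ⟨q, hq, hq0, ?_⟩
  rw [← hqM]
  ext j
  simp only [Matrix.vecMul, dotProduct, M, Matrix.of_apply]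
  refine Finset.sum_congr rfl fun i _ => ?_
  by_cases hi : i ∈ S
  · simp [hi]
  · simp [hq0 i hi]

/-- Without a directed spanning tree, the Laplacian has a left null vector of zero sum. -/
theorem exists_vecMul_eq_zero_of_not_tree (h : ¬ G.HasDirectedSpanningTree) :
    ∃ q : Fin G.N → ℝ, q ≠ 0 ∧ ∑ i, q i = 0 ∧ q ᵥ* G.laplacian = 0 := by
  classical
  let anc : Fin G.N → Set (Fin G.N) := fun i => {j | Relation.ReflTransGen G.Edge j i}
  have hanc : ∀ i, ∀ k ∈ anc i, ∀ j, G.Edge j k → j ∈ anc i := fun i k hk j hjk =>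
    Relation.ReflTransGen.head hjk hk
  have : Nonempty (Fin G.N) := ⟨⟨0, G.pos⟩⟩
  -- A node with fewest ancestors lies in a source component: it reaches all its ancestors. It
  -- misses some `k`, so the ancestor sets of `i` and `k` are disjoint and carry independent left
  -- null vectors.
  obtain ⟨i, hi⟩ := Finite.exists_min fun i => (anc i).ncard
  have hmin : ∀ j ∈ anc i, Relation.ReflTransGen G.Edge i j := by
    intro j hj
    have hsub : anc j ⊆ anc i := fun k hk => Relation.ReflTransGen.trans hk hj
    have : anc j = anc i := Set.eq_of_subset_of_ncard_le hsub (hi j) (Set.toFinite _)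
    have hii : i ∈ anc i := Relation.ReflTransGen.refl
    rwa [← this] at hii
  obtain ⟨k, hk⟩ : ∃ k, ¬ Relation.ReflTransGen G.Edge i k := by
    by_contra hcon
    push Not at hcon
    exact h (hasDirectedSpanningTree_of_reach hcon)
  have hdisj : ∀ j ∈ anc i, j ∉ anc k := fun j hj hjk => hk ((hmin j hj).trans hjk)
  obtain ⟨q, hq, hqS, hqL⟩ :=
    exists_vecMul_eq_zero_of_closed (S := anc i) ⟨i, Relation.ReflTransGen.refl⟩ (hanc i)
  obtain ⟨p, hp, hpS, hpL⟩ :=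
    exists_vecMul_eq_zero_of_closed (S := anc k) ⟨k, Relation.ReflTransGen.refl⟩ (hanc k)
  by_cases hs : ∑ i, q i = 0
  · exact ⟨q, hq, hs, hqL⟩
  · refine ⟨(∑ i, p i) • q - (∑ i, q i) • p, fun h0 => ?_, ?_, ?_⟩
    · obtain ⟨j, hj⟩ := Function.ne_iff.1 hp
      have hjk : j ∈ anc k := by
        by_contra hjk
        exact hj (hpS j hjk)
      have hqj : q j = 0 := hqS j fun hji => hdisj j hji hjk
      have := congrFun h0 j
      simp [hqj, hs] at this
      exact hj this
    · simp only [Pi.sub_apply, Pi.smul_apply, smul_eq_mul, Finset.sum_sub_distrib, ← Finset.mul_sum]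
      ring
    · rw [Matrix.sub_vecMul, Matrix.smul_vecMul, Matrix.smul_vecMul, hqL, hpL]
      simp

/-- Maximum principle. -/
theorem eq_root_of_laplacian_mulVec_const {r : Fin G.N}
    (hr : ∀ k, Relation.ReflTransGen G.Edge r k) {v : Fin G.N → ℝ} {c : ℝ}
    (h : ∀ i, (G.laplacian *ᵥ v) i = c) (k : Fin G.N) : v k = v r := by
  have : Nonempty (Fin G.N) := ⟨r⟩
  obtain ⟨a, ha⟩ := Finite.exists_max v
  obtain ⟨b, hb⟩ := Finite.exists_min v
  simp only [laplacian_mulVec] at h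
  -- The constant is nonnegative at a maximum of `v` and nonpositive at a minimum, hence zero. Then
  -- maximality and minimality propagate backwards along edges, up to the root `r` in both cases.
  have hc0 : 0 ≤ c := by
    rw [← h a]
    exact Finset.sum_nonneg fun j _ => mul_nonneg (G.nonneg a j) (sub_nonneg.2 (ha j))
  have hc1 : c ≤ 0 := by
    rw [← h b]
    exact Finset.sum_nonpos fun j _ =>
      mul_nonpos_of_nonneg_of_nonpos (G.nonneg b j) (sub_nonpos.2 (hb j))
  have hc : c = 0 := le_antisymm hc1 hc0
  subst hc
  have hmax : ∀ i, Relation.ReflTransGen G.Edge i a → v i = v a := by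
    intro i hi
    induction hi using Relation.ReflTransGen.head_induction_on with
    | refl => rfl
    | @head i j hij _ ih =>
      have h0 := (Finset.sum_eq_zero_iff_of_nonneg fun l _ =>
        mul_nonneg (G.nonneg j l) (sub_nonneg.2 (ih ▸ ha l))).1 (h j) i (Finset.mem_univ _)
      rcases mul_eq_zero.1 h0 with h1 | h1
      · exact absurd h1 (ne_of_gt hij)
      · linarith
  have hmin : ∀ i, Relation.ReflTransGen G.Edge i b → v i = v b := by
    intro i hi
    induction hi using Relation.ReflTransGen.head_induction_on with
    | refl => rfl
    | @head i j hij _ ih =>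
      have h0 := (Finset.sum_eq_zero_iff_of_nonpos fun l _ =>
        mul_nonpos_of_nonneg_of_nonpos (G.nonneg j l) (sub_nonpos.2 (ih ▸ hb l))).1 (h j) i
          (Finset.mem_univ _)
      rcases mul_eq_zero.1 h0 with h1 | h1
      · exact absurd h1 (ne_of_gt hij)
      · linarith
  have := hmax r (hr a)
  have := hmin r (hr b)
  linarith [ha k, hb k]

/-- Gershgorin: the row discs have centre and radius both equal to the diagonal entry, so they meet
the closed left half-plane only at `0`. -/
theorem laplacian_eigenvalue_re_pos {b : ℂ} {w : Fin G.N → ℂ} (hw : w ≠ 0) (hb : b ≠ 0)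
    (h : G.laplacian.map (algebraMap ℝ ℂ) *ᵥ w = b • w) : 0 < b.re := by
  have hev : Module.End.HasEigenvalue (Matrix.toLin' (G.laplacian.map (algebraMap ℝ ℂ))) b :=
    Module.End.hasEigenvalue_of_hasEigenvector (x := w)
      ⟨by rw [Module.End.mem_eigenspace_iff, Matrix.toLin'_apply, h], hw⟩
  obtain ⟨k, hk⟩ := eigenvalue_mem_ball hev
  have hd : ∑ j ∈ Finset.univ.erase k, ‖(G.laplacian.map (algebraMap ℝ ℂ)) k j‖
      = G.laplacian k k := by
    have h1 : ∀ j ∈ Finset.univ.erase k, ‖(G.laplacian.map (algebraMap ℝ ℂ)) k j‖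
        = -G.laplacian k j := by
      intro j hj
      have hkj : k ≠ j := (Finset.ne_of_mem_erase hj).symm
      simp [laplacian, hkj, abs_of_nonneg (G.nonneg k j)]
    rw [Finset.sum_congr rfl h1, Finset.sum_neg_distrib]
    have := Finset.add_sum_erase Finset.univ (fun j => G.laplacian k j) (Finset.mem_univ k)
    rw [G.laplacian_sum_row] at this
    linarith
  have hd0 : 0 ≤ G.laplacian k k := by
    rw [← hd]; exact Finset.sum_nonneg fun _ _ => norm_nonneg _
  rw [hd, Metric.mem_closedBall, dist_eq_norm] at hk
  have h2 : ‖b - (G.laplacian k k : ℂ)‖ ^ 2 ≤ G.laplacian k k ^ 2 := by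
    have : ‖b - (G.laplacian k k : ℂ)‖ ≤ G.laplacian k k := hk
    gcongr
  rw [← Complex.normSq_eq_norm_sq, Complex.normSq_apply] at h2
  simp at h2
  by_contra hre
  push Not at hre
  have h3 : b.re * b.re + b.im * b.im ≤ 2 * (G.laplacian k k * b.re) := by nlinarith
  have h4 : G.laplacian k k * b.re ≤ 0 := mul_nonpos_of_nonneg_of_nonpos hd0 hre
  have h5 : b.re = 0 := by nlinarith [mul_self_nonneg b.re, mul_self_nonneg b.im]
  have h6 : b.im = 0 := by nlinarith [mul_self_nonneg b.re, mul_self_nonneg b.im]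
  exact hb (Complex.ext h5 h6)

variable (G)

/-- The averaging matrix. -/
def avg : Matrix (Fin G.N) (Fin G.N) ℝ := Matrix.of fun _ _ => (G.N : ℝ)⁻¹

/-- The Laplacian, restricted to vectors of zero mean and completed by the identity on constants. -/
def groundedLaplacian : Matrix (Fin G.N) (Fin G.N) ℝ := (1 - G.avg) * G.laplacian + G.avg

theorem laplacian_mul_avg : G.laplacian * G.avg = 0 := by
  ext i j
  simp [Matrix.mul_apply, avg, ← Finset.sum_mul, G.laplacian_sum_row]

theorem avg_mul_avg : G.avg * G.avg = G.avg := by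
  have : (G.N : ℝ) ≠ 0 := by exact_mod_cast G.pos.ne'
  ext i j
  simp [Matrix.mul_apply, avg, this]

theorem groundedLaplacian_mul :
    G.groundedLaplacian * (1 - G.avg) = (1 - G.avg) * G.laplacian := by
  rw [groundedLaplacian, Matrix.add_mul, Matrix.mul_assoc, Matrix.mul_sub G.laplacian,
    Matrix.mul_sub G.avg, laplacian_mul_avg, avg_mul_avg]
  simp

variable {G}

/-- Averaging the eigenvector equation gives `a = -1` unless the eigenvector has mean zero. In the
latter case `L v = -a v + c`. If `a = 0`, the maximum principle makes `v` constant, hence zero;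
otherwise a constant shift of `v` is an eigenvector of `L` for `-a ≠ 0`. -/
theorem HasDirectedSpanningTree.stable_neg_groundedLaplacian (h : G.HasDirectedSpanningTree) :
    Stable (-G.groundedLaplacian) := by
  obtain ⟨r, hr⟩ := h.exists_reach
  refine EigStable.stable fun a v hv hav => ?_
  have hN : (G.N : ℂ) ≠ 0 := by exact_mod_cast G.pos.ne'
  set Lc := G.laplacian.map (algebraMap ℝ ℂ) with hLc
  set m : ℂ := (G.N : ℂ)⁻¹ * ∑ i, v i with hm
  set c : ℂ := (G.N : ℂ)⁻¹ * ∑ i, (Lc *ᵥ v) i with hc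
  have havg : ∀ w : Fin G.N → ℂ, ∀ i, (G.avg.map (algebraMap ℝ ℂ) *ᵥ w) i
      = (G.N : ℂ)⁻¹ * ∑ i, w i := by
    intro w i
    simp [Matrix.mulVec, dotProduct, avg, Finset.mul_sum]
  have hmap : (-G.groundedLaplacian).map (algebraMap ℝ ℂ)
      = -(Lc - G.avg.map (algebraMap ℝ ℂ) * Lc + G.avg.map (algebraMap ℝ ℂ)) := by
    rw [groundedLaplacian, Matrix.sub_mul, Matrix.one_mul, ← (algebraMap ℝ ℂ).mapMatrix_apply,
      map_neg, map_add, map_sub, map_mul]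
    rfl
  have hi : ∀ i, (Lc *ᵥ v) i - c + m = (-a) * v i := by
    intro i
    have := congrFun hav i
    rw [hmap, Matrix.neg_mulVec, Matrix.add_mulVec, Matrix.sub_mulVec, ← Matrix.mulVec_mulVec] at this
    simp only [Pi.neg_apply, Pi.add_apply, Pi.sub_apply, havg, Pi.smul_apply, smul_eq_mul] at this
    linear_combination -this
  have hmm : m = (-a) * m := by
    have h1 := Finset.sum_congr (rfl : (Finset.univ : Finset (Fin G.N)) = _) fun i _ => hi i
    simp only [Finset.sum_add_distrib, Finset.sum_sub_distrib, Finset.sum_const, Finset.card_univ,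
      Fintype.card_fin, nsmul_eq_mul, ← Finset.mul_sum] at h1
    have h2 : (G.N : ℂ) * c = ∑ i, (Lc *ᵥ v) i := by rw [hc]; field_simp
    have h3 : (G.N : ℂ) * m = ∑ i, v i := by rw [hm]; field_simp
    rw [h2, sub_self, zero_add, ← h3] at h1
    exact mul_left_cancel₀ hN (by linear_combination h1)
  by_cases hm0 : m = 0
  swap
  · have : -a = 1 := by
      refine mul_right_cancel₀ hm0 ?_
      rw [one_mul, ← hmm]
    have ha : a = -1 := by linear_combination -this
    simp [ha]
  have hLi : ∀ i, (Lc *ᵥ v) i = (-a) * v i + c := fun i => by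
    linear_combination hi i - hm0
  have hnotconst : ∀ d : ℂ, ¬ ∀ i, v i = d := by
    intro d hd
    have : m = d := by
      rw [hm]; simp only [hd]; simp; field_simp
    exact hv (funext fun i => by rw [hd i, ← this, hm0]; rfl)
  by_cases ha : a = 0
  · exfalso
    have hre := eq_root_of_laplacian_mulVec_const hr (v := fun i => (v i).re) (c := c.re) fun i => by
      have := congrArg Complex.re (hLi i)
      simpa [Matrix.mulVec, dotProduct, hLc, ha] using this
    have him := eq_root_of_laplacian_mulVec_const hr (v := fun i => (v i).im) (c := c.im) fun i => by
      have := congrArg Complex.im (hLi i)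
      simpa [Matrix.mulVec, dotProduct, hLc, ha] using this
    exact hnotconst (v r) fun i => Complex.ext (hre i) (him i)
  · have hna : -a ≠ 0 := neg_ne_zero.2 ha
    have hconst : Lc *ᵥ (fun _ => c / (-a)) = 0 := by
      ext i
      have h1 : ∑ j, Lc i j = 0 := by
        simp only [hLc, Matrix.map_apply]
        rw [← map_sum, G.laplacian_sum_row, map_zero]
      simp only [Matrix.mulVec, dotProduct, ← Finset.sum_mul, h1, zero_mul, Pi.zero_apply]
    have hpos := laplacian_eigenvalue_re_pos (G := G) (w := v + fun _ => c / (-a)) (b := -a) ?_ hna ?_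
    · simpa using hpos
    · intro h0
      refine hnotconst (-(c / (-a))) fun i => ?_
      have := congrFun h0 i
      simp only [Pi.add_apply, Pi.zero_apply] at this
      linear_combination this
    · rw [Matrix.mulVec_add, hconst, add_zero]
      ext i
      rw [hLi]
      simp only [Pi.smul_apply, Pi.add_apply, smul_eq_mul]
      field_simp
      ring

end CommGraph

/-! ### Bounds on the `H₂` norm from Lyapunov inequalities -/

section H2Bound

open scoped Matrix.Norms.Operator

set_option linter.unusedSectionVars false

variable {ι κ μ : Type*} [Fintype ι] [Fintype κ] [Fintype μ] [DecidableEq ι]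

theorem trace_mul_mul_transpose (Z : Matrix μ ι ℝ) (K : Matrix ι ι ℝ) :
    (Z * K * Zᵀ).trace = ∑ i, Z i ⬝ᵥ (K *ᵥ Z i) := by
  refine Finset.sum_congr rfl fun i _ => ?_
  rw [Matrix.diag_apply, Matrix.mul_assoc, Matrix.mul_apply]
  rfl

theorem trace_mul_transpose_self_nonneg (g : Matrix μ κ ℝ) : 0 ≤ (g * gᵀ).trace :=
  Finset.sum_nonneg fun _ _ => Finset.sum_nonneg fun _ _ => mul_self_nonneg _

/-- The function `V t = trace (C exp (tM) S exp (tMᵀ) Cᵀ)` tends to `0` and `-V'` dominates the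
integrand, so the integral is at most `V 0`. An inequality for `S` suffices; the exact Gramian is
not needed. -/
theorem lintegral_impulseResponse_le {M S : Matrix ι ι ℝ} {D : Matrix ι κ ℝ} (C : Matrix μ ι ℝ)
    (hM : Stable M) (h : ∀ y, y ⬝ᵥ ((M * S + S * Mᵀ + D * Dᵀ) *ᵥ y) ≤ 0) :
    ∫⁻ t in Set.Ioi (0 : ℝ), ENNReal.ofReal
      (impulseResponse M D C t * (impulseResponse M D C t)ᵀ).trace
      ≤ ENNReal.ofReal (C * S * Cᵀ).trace := by
  set V : ℝ → ℝ := fun t =>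
    (C * (NormedSpace.exp (t • M) * S * NormedSpace.exp (t • Mᵀ)) * Cᵀ).trace with hV
  set V' : ℝ → ℝ := fun t =>
    (C * (NormedSpace.exp (t • M) * (M * S + S * Mᵀ) * NormedSpace.exp (t • Mᵀ)) * Cᵀ).trace with hV'
  have hd : ∀ t, HasDerivAt V (V' t) t := by
    intro t
    have h1 := hasDerivAt_matrix_mul (hasDerivAt_matrix_mul (hasDerivAt_const t C)
      (hasDerivAt_exp_mul_mul_exp M S Mᵀ t)) (hasDerivAt_const t Cᵀ)
    simp only [Matrix.zero_mul, zero_add, Matrix.mul_zero, add_zero] at h1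
    exact HasDerivAt.fun_sum fun i _ => hasDerivAt_pi.1 (hasDerivAt_pi.1 h1 i) i
  have hle : ∀ t, (impulseResponse M D C t * (impulseResponse M D C t)ᵀ).trace ≤ -V' t := by
    intro t
    have e : NormedSpace.exp (t • Mᵀ) = (NormedSpace.exp (t • M))ᵀ := by
      rw [← Matrix.exp_transpose, Matrix.transpose_smul]
    have h1 : (impulseResponse M D C t * (impulseResponse M D C t)ᵀ).trace + V' t
        = ((C * NormedSpace.exp (t • M)) * (M * S + S * Mᵀ + D * Dᵀ)
            * (C * NormedSpace.exp (t • M))ᵀ).trace := by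
      rw [hV', impulseResponse, ← Matrix.trace_add, e]
      congr 1
      simp only [Matrix.transpose_mul, Matrix.mul_add, Matrix.add_mul, Matrix.mul_assoc]
      abel
    have h2 : ((C * NormedSpace.exp (t • M)) * (M * S + S * Mᵀ + D * Dᵀ)
            * (C * NormedSpace.exp (t • M))ᵀ).trace ≤ 0 := by
      rw [trace_mul_mul_transpose]
      exact Finset.sum_nonpos fun i _ => h _
    linarith
  have hV'0 : ∀ t, V' t ≤ 0 := fun t => by
    linarith [hle t, trace_mul_transpose_self_nonneg (impulseResponse M D C t)]
  have hlim : Filter.Tendsto V Filter.atTop (𝓝 0) := by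
    have hc : Continuous fun Z : Matrix ι ι ℝ => (C * Z * Cᵀ).trace := by fun_prop
    have := (hc.tendsto 0).comp (hM.tendsto_exp_mul_mul_exp hM.transpose S)
    simpa [Function.comp_def] using this
  have hint := MeasureTheory.integrableOn_Ioi_deriv_of_nonpos' (a := (0 : ℝ)) (fun t _ => hd t)
    (fun t _ => hV'0 t) hlim
  have heq := MeasureTheory.integral_Ioi_of_hasDerivAt_of_nonpos' (a := (0 : ℝ)) (fun t _ => hd t)
    (fun t _ => hV'0 t) hlim
  calc _ ≤ ∫⁻ t in Set.Ioi (0 : ℝ), ENNReal.ofReal (-V' t) :=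
        MeasureTheory.lintegral_mono fun t => ENNReal.ofReal_le_ofReal (hle t)
    _ = ENNReal.ofReal (∫ t in Set.Ioi (0 : ℝ), -V' t) :=
        (MeasureTheory.ofReal_integral_eq_lintegral_ofReal hint.neg
          (Filter.Eventually.of_forall fun t => neg_nonneg.2 (hV'0 t))).symm
    _ = _ := by
        rw [MeasureTheory.integral_neg, heq]
        simp [hV]

end H2Bound

/-! ### Comparison of quadratic forms -/

section Comparison

set_option linter.unusedSectionVars false

variable {ι κ : Type*} [Fintype ι] [Fintype κ] [DecidableEq ι] [DecidableEq κ]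

/-- The quotient of the two forms is homogeneous of degree zero and bounded on the compact unit
sphere. -/
theorem exists_quad_le_mul_quad (F : Matrix ι ι ℝ) {Q : Matrix ι ι ℝ} (hQ : Q.PosDef) :
    ∃ c : ℝ, 0 < c ∧ ∀ y, y ⬝ᵥ (F *ᵥ y) ≤ c * (y ⬝ᵥ (Q *ᵥ y)) := by
  have hcont : ∀ Z : Matrix ι ι ℝ, Continuous fun y : ι → ℝ => y ⬝ᵥ (Z *ᵥ y) := fun Z =>
    continuous_id.dotProduct (continuous_const.matrix_mulVec continuous_id)
  have hne : ∀ y ∈ Metric.sphere (0 : ι → ℝ) 1, y ⬝ᵥ (Q *ᵥ y) ≠ 0 := by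
    intro y hy
    have : y ≠ 0 := by rintro rfl; simp at hy
    exact (hQ.quad_pos this).ne'
  obtain ⟨c, hc⟩ := (isCompact_sphere (0 : ι → ℝ) 1).exists_bound_of_continuousOn
    (f := fun y => (y ⬝ᵥ (F *ᵥ y)) / (y ⬝ᵥ (Q *ᵥ y)))
    ((hcont F).continuousOn.div (hcont Q).continuousOn hne)
  refine ⟨max c 1, by positivity, fun y => ?_⟩
  rcases eq_or_ne y 0 with rfl | hy
  · simp
  have hny : 0 < ‖y‖ := norm_pos_iff.2 hy
  have h1 := hc (‖y‖⁻¹ • y) (by simp [norm_smul, hny.ne'])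
  simp only [Matrix.mulVec_smul, smul_dotProduct, dotProduct_smul, smul_eq_mul] at h1
  have hq := hQ.quad_pos hy
  rw [mul_div_mul_left _ _ (inv_ne_zero hny.ne'), mul_div_mul_left _ _ (inv_ne_zero hny.ne'),
    Real.norm_eq_abs] at h1
  have h2 := (le_abs_self _).trans h1
  rw [div_le_iff₀ hq] at h2
  refine h2.trans (mul_le_mul_of_nonneg_right (le_max_left _ _) hq.le)

theorem exists_sq_le_mul_quad (F : Matrix κ ι ℝ) {Q : Matrix ι ι ℝ} (hQ : Q.PosDef) :
    ∃ c : ℝ, 0 < c ∧ ∀ y, (F *ᵥ y) ⬝ᵥ (F *ᵥ y) ≤ c * (y ⬝ᵥ (Q *ᵥ y)) := by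
  obtain ⟨c, hc, h⟩ := exists_quad_le_mul_quad (Fᵀ * F) hQ
  refine ⟨c, hc, fun y => ?_⟩
  have := h y
  rwa [dotProduct_mul_mulVec, Matrix.transpose_transpose] at this

theorem dotProduct_self_nonneg_real (y : ι → ℝ) : 0 ≤ y ⬝ᵥ y :=
  Finset.sum_nonneg fun _ _ => mul_self_nonneg _

theorem add_dotProduct_self_le (u v : ι → ℝ) :
    (u + v) ⬝ᵥ (u + v) ≤ 2 * (u ⬝ᵥ u) + 2 * (v ⬝ᵥ v) := by
  have := dotProduct_self_nonneg_real (u - v)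
  simp only [add_dotProduct, dotProduct_add, sub_dotProduct, dotProduct_sub] at this ⊢
  linarith [dotProduct_comm u v]

theorem two_mul_dotProduct_le {c : ℝ} (hc : 0 < c) (u v : ι → ℝ) :
    2 * (u ⬝ᵥ v) ≤ c * (u ⬝ᵥ u) + c⁻¹ * (v ⬝ᵥ v) := by
  have h := dotProduct_self_nonneg_real (c • u - v)
  simp only [sub_dotProduct, dotProduct_sub, smul_dotProduct, dotProduct_smul, smul_eq_mul,
    dotProduct_comm v u] at h
  have h2 : 0 ≤ c⁻¹ * (c * (c * (u ⬝ᵥ u)) - c * (u ⬝ᵥ v) - (c * (u ⬝ᵥ v) - v ⬝ᵥ v)) :=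
    mul_nonneg (inv_nonneg.2 hc.le) (by linarith)
  have h3 : c⁻¹ * (c * (c * (u ⬝ᵥ u)) - c * (u ⬝ᵥ v) - (c * (u ⬝ᵥ v) - v ⬝ᵥ v))
      = c * (u ⬝ᵥ u) - 2 * (u ⬝ᵥ v) + c⁻¹ * (v ⬝ᵥ v) := by
    field_simp; ring
  linarith

end Comparison

/-! ### The Lyapunov inequality for the high-gain cascade -/

section Cascade

variable {τ κ μ : Type*} [Fintype τ] [Fintype κ] [Fintype μ] [DecidableEq τ] [DecidableEq κ]
  [DecidableEq μ]

/-- The cascade of the estimation error `e' = (A - ρ Λ) e` and of the controlled state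
`x' = (A - ρ B Bᵀ P) x + ρ B Bᵀ P e`. -/
def cascade (A Λ P : Matrix τ τ ℝ) (B : Matrix τ κ ℝ) (ρ : ℝ) : Matrix (τ ⊕ τ) (τ ⊕ τ) ℝ :=
  Matrix.fromBlocks (A - ρ • (B * Bᵀ * P)) (ρ • (B * Bᵀ * P)) 0 (A - ρ • Λ)

theorem quad_add_transpose (M : Matrix τ τ ℝ) {S : Matrix τ τ ℝ} (hS : Sᵀ = S) (y : τ → ℝ) :
    y ⬝ᵥ ((M * S + S * Mᵀ) *ᵥ y) = 2 * ((Mᵀ *ᵥ y) ⬝ᵥ (S *ᵥ y)) := by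
  rw [Matrix.add_mulVec, dotProduct_add, dotProduct_mul_mulVec, dotProduct_mul_mulVec, hS,
    dotProduct_comm (S *ᵥ y)]
  ring

/-- With `W = P⁻¹` the feedback contributes exactly `-2ρ |Bᵀ p|²`, and the coupling to the error
passes through `Bᵀ p` only. -/
theorem cascade_quad_le {A Λ P W R Q : Matrix τ τ ℝ} {B : Matrix τ κ ℝ} {ρ a b : ℝ}
    (hW : W.PosDef) (hP : P.PosDef) (hPW : P * W = 1)
    (hric : A * W + W * Aᵀ = B * Bᵀ - W * W) (hR : R.PosDef)
    (hRQ : ∀ q, q ⬝ᵥ (((A - ρ • Λ) * R + R * (A - ρ • Λ)ᵀ) *ᵥ q) ≤ -(ρ * (q ⬝ᵥ (Q *ᵥ q))))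
    (hb : 0 ≤ b) (p q : τ → ℝ) :
    Sum.elim p q ⬝ᵥ ((cascade A Λ P B ρ * Matrix.fromBlocks (a • W) 0 0 (b • R)
      + Matrix.fromBlocks (a • W) 0 0 (b • R) * (cascade A Λ P B ρ)ᵀ) *ᵥ Sum.elim p q)
      ≤ a * ((Bᵀ *ᵥ p) ⬝ᵥ (Bᵀ *ᵥ p) - (W *ᵥ p) ⬝ᵥ (W *ᵥ p))
        - 2 * a * ρ * ((Bᵀ *ᵥ p) ⬝ᵥ (Bᵀ *ᵥ p))
        + 2 * b * ρ * ((Bᵀ *ᵥ p) ⬝ᵥ ((Bᵀ * P * R) *ᵥ q)) - b * ρ * (q ⬝ᵥ (Q *ᵥ q)) := by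
  have hWt := hW.posSemidef.transpose_eq
  have hPt := hP.posSemidef.transpose_eq
  have hRt := hR.posSemidef.transpose_eq
  have hS : (Matrix.fromBlocks (a • W) 0 0 (b • R))ᵀ = Matrix.fromBlocks (a • W) 0 0 (b • R) := by
    rw [Matrix.fromBlocks_transpose]; simp [hWt, hRt]
  have h1 := quad_add_transpose A hWt p
  have h2 := quad_add_transpose (A - ρ • Λ) hRt q
  have h3 := hRQ q
  rw [h2] at h3
  have h4 : (Bᵀ *ᵥ p) ⬝ᵥ (Bᵀ *ᵥ p) - (W *ᵥ p) ⬝ᵥ (W *ᵥ p) = 2 * ((Aᵀ *ᵥ p) ⬝ᵥ (W *ᵥ p)) := by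
    rw [← h1, hric, Matrix.sub_mulVec, dotProduct_sub, dotProduct_mul_mulVec,
      dotProduct_mul_mulVec, hWt]
  have h5 : ((B * Bᵀ * P)ᵀ *ᵥ p) ⬝ᵥ (W *ᵥ p) = (Bᵀ *ᵥ p) ⬝ᵥ (Bᵀ *ᵥ p) := by
    rw [← dotProduct_mul_mulVec, Matrix.mul_assoc, hPW, Matrix.mul_one, dotProduct_mul_mulVec]
  have h6 : ((B * Bᵀ * P)ᵀ *ᵥ p) ⬝ᵥ (R *ᵥ q) = (Bᵀ *ᵥ p) ⬝ᵥ ((Bᵀ * P * R) *ᵥ q) := by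
    rw [← dotProduct_mul_mulVec, Matrix.mul_assoc, Matrix.mul_assoc B, dotProduct_mul_mulVec,
      ← Matrix.mul_assoc]
  rw [quad_add_transpose _ hS, cascade, Matrix.fromBlocks_transpose, Matrix.fromBlocks_mulVec,
    Matrix.fromBlocks_mulVec, sumElim_dotProduct_sumElim, h4]
  simp only [Sum.elim_comp_inl, Sum.elim_comp_inr, Matrix.transpose_zero, Matrix.zero_mulVec,
    add_zero, zero_add, Matrix.smul_mulVec, Matrix.transpose_sub, Matrix.transpose_smul,
    Matrix.sub_mulVec, add_dotProduct, sub_dotProduct, smul_dotProduct, dotProduct_smul,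
    smul_eq_mul, h5, h6] at h3 ⊢
  nlinarith [mul_le_mul_of_nonneg_left h3 hb]

/-- A common Lyapunov function, up to scaling by `1 / ρ`, for the cascade with an input that is
matched with the control input. -/
theorem exists_cascade_lyapunov {A Λ P W R Q : Matrix τ τ ℝ} {B : Matrix τ κ ℝ} (X : Matrix κ μ ℝ)
    (hW : W.PosDef) (hP : P.PosDef) (hPW : P * W = 1)
    (hric : A * W + W * Aᵀ = B * Bᵀ - W * W) (hR : R.PosDef) (hQ : Q.PosDef)
    (hRQ : ∀ ρ : ℝ, 1 ≤ ρ → ∀ q,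
      q ⬝ᵥ (((A - ρ • Λ) * R + R * (A - ρ • Λ)ᵀ) *ᵥ q) ≤ -(ρ * (q ⬝ᵥ (Q *ᵥ q)))) :
    ∃ S : Matrix (τ ⊕ τ) (τ ⊕ τ) ℝ, S.PosDef ∧ ∀ ρ : ℝ, 1 ≤ ρ → ∀ y ≠ 0,
      y ⬝ᵥ ((cascade A Λ P B ρ * (ρ⁻¹ • S) + (ρ⁻¹ • S) * (cascade A Λ P B ρ)ᵀ
        + Matrix.fromRows (B * X) (B * X) * (Matrix.fromRows (B * X) (B * X))ᵀ) *ᵥ y) < 0 := by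
  obtain ⟨c₁, hc₁, h₁⟩ := exists_sq_le_mul_quad Xᵀ (Matrix.PosDef.one (n := κ) (R := ℝ))
  obtain ⟨c₂, hc₂, h₂⟩ := exists_sq_le_mul_quad (B * X)ᵀ hQ
  obtain ⟨c₃, hc₃, h₃⟩ := exists_sq_le_mul_quad (Bᵀ * P * R) hQ
  simp only [Matrix.one_mulVec] at h₁
  -- First `b`: half of `b θ` pays for the cross term, and the other half for the disturbance on the
  -- error, `2 c₂ θ`, with `θ` to spare. Then `a` pays for all multiples of `|Bᵀ p|²`, namely `2 c₁`
  -- and `2 b c₃`, with one to spare.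
  set b : ℝ := 4 * c₂ + 2 with hb
  set a : ℝ := 2 * c₁ + 2 * b * c₃ + 1 with ha
  have hb0 : 0 < b := by positivity
  have ha0 : 0 < a := by positivity
  have hWt := hW.posSemidef.transpose_eq
  have hRt := hR.posSemidef.transpose_eq
  refine ⟨Matrix.fromBlocks (a • W) 0 0 (b • R), posDef_of_real ?_ ?_, fun ρ hρ y hy => ?_⟩
  · rw [Matrix.fromBlocks_transpose]; simp [hWt, hRt]
  · intro y hy
    obtain ⟨p, q, rfl⟩ : ∃ p q, y = Sum.elim p q := ⟨_, _, (Sum.elim_comp_inl_inr y).symm⟩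
    rw [Matrix.fromBlocks_mulVec, sumElim_dotProduct_sumElim]
    simp only [Sum.elim_comp_inl, Sum.elim_comp_inr, Matrix.zero_mulVec, add_zero, zero_add,
      Matrix.smul_mulVec, dotProduct_smul, smul_eq_mul]
    have hp0 := hW.posSemidef.quad_nonneg p
    have hq0 := hR.posSemidef.quad_nonneg q
    rcases eq_or_ne p 0 with rfl | hp
    · have hq : q ≠ 0 := by rintro rfl; exact hy (by ext (i | i) <;> rfl)
      have := mul_pos hb0 (hR.quad_pos hq)
      have := mul_nonneg ha0.le hp0
      linarith
    · have := mul_pos ha0 (hW.quad_pos hp)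
      have := mul_nonneg hb0.le hq0
      linarith
  · obtain ⟨p, q, rfl⟩ : ∃ p q, y = Sum.elim p q := ⟨_, _, (Sum.elim_comp_inl_inr y).symm⟩
    have hρ0 : 0 < ρ := by linarith
    have hmain := cascade_quad_le (a := a) (b := b) hW hP hPW hric hR (hRQ ρ hρ) hb0.le p q
    have hD : Sum.elim p q ⬝ᵥ ((Matrix.fromRows (B * X) (B * X)
        * (Matrix.fromRows (B * X) (B * X))ᵀ) *ᵥ Sum.elim p q)
        ≤ 2 * c₁ * ((Bᵀ *ᵥ p) ⬝ᵥ (Bᵀ *ᵥ p)) + 2 * c₂ * (q ⬝ᵥ (Q *ᵥ q)) := by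
      have e : (Matrix.fromRows (B * X) (B * X))ᵀ *ᵥ Sum.elim p q
          = Xᵀ *ᵥ (Bᵀ *ᵥ p) + (B * X)ᵀ *ᵥ q := by
        rw [Matrix.transpose_fromRows, Matrix.fromCols_mulVec, Sum.elim_comp_inl, Sum.elim_comp_inr,
          Matrix.mulVec_mulVec, Matrix.transpose_mul]
      rw [dotProduct_mul_mulVec, e]
      refine (add_dotProduct_self_le _ _).trans ?_
      linarith [h₁ (Bᵀ *ᵥ p), h₂ q]
    rw [Matrix.add_mulVec, dotProduct_add, Matrix.mul_smul, Matrix.smul_mul, ← smul_add,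
      Matrix.smul_mulVec, dotProduct_smul, smul_eq_mul]
    set β := (Bᵀ *ᵥ p) ⬝ᵥ (Bᵀ *ᵥ p) with hβ
    set η := (Bᵀ *ᵥ p) ⬝ᵥ ((Bᵀ * P * R) *ᵥ q) with hη
    set θ := q ⬝ᵥ (Q *ᵥ q) with hθ
    set ϖ := (W *ᵥ p) ⬝ᵥ (W *ᵥ p) with hϖ
    have hβ0 : 0 ≤ β := dotProduct_self_nonneg_real _
    have hθ0 : 0 ≤ θ := hQ.posSemidef.quad_nonneg q
    have hϖ0 : 0 ≤ ϖ := dotProduct_self_nonneg_real _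
    -- Young's inequality with weight `2 c₃`, chosen so that the error term appears with coefficient
    -- `1/2`.
    have hη1 : 2 * η ≤ 2 * c₃ * β + θ / 2 := by
      have h5 := two_mul_dotProduct_le (c := 2 * c₃) (by positivity) (Bᵀ *ᵥ p) ((Bᵀ * P * R) *ᵥ q)
      have h6 := mul_le_mul_of_nonneg_left (h₃ q) (inv_nonneg.2 (by positivity : 0 ≤ 2 * c₃))
      have h7 : (2 * c₃)⁻¹ * (c₃ * θ) = θ / 2 := by field_simp
      rw [← hθ, h7] at h6
      linarith
    have hscaled := mul_le_mul_of_nonneg_left hmain (inv_nonneg.2 hρ0.le)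
    have hρinv : ρ⁻¹ * ρ = 1 := inv_mul_cancel₀ hρ0.ne'
    have e1 : ρ⁻¹ * (a * (β - ϖ) - 2 * a * ρ * β + 2 * b * ρ * η - b * ρ * θ)
        = ρ⁻¹ * (a * β) - ρ⁻¹ * (a * ϖ) - 2 * a * β + b * (2 * η) - b * θ := by
      linear_combination (-2 * a * β + 2 * b * η - b * θ) * hρinv
    rw [e1] at hscaled
    have h8 : ρ⁻¹ * (a * β) ≤ a * β :=
      mul_le_of_le_one_left (mul_nonneg ha0.le hβ0) (inv_le_one_of_one_le₀ hρ)
    have h9 := mul_le_mul_of_nonneg_left hη1 hb0.le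
    have h10 : ρ⁻¹ * (a * ϖ) + θ ≤ -(ρ⁻¹ * (Sum.elim p q ⬝ᵥ ((cascade A Λ P B ρ
        * Matrix.fromBlocks (a • W) 0 0 (b • R) + Matrix.fromBlocks (a • W) 0 0 (b • R)
        * (cascade A Λ P B ρ)ᵀ) *ᵥ Sum.elim p q)) + Sum.elim p q ⬝ᵥ ((Matrix.fromRows (B * X) (B * X)
        * (Matrix.fromRows (B * X) (B * X))ᵀ) *ᵥ Sum.elim p q)) := by
      have e2 : a * β = 2 * c₁ * β + b * (2 * c₃ * β) + β := by rw [ha]; ring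
      have e3 : b * θ = b * (θ / 2) + 2 * c₂ * θ + θ := by rw [hb]; ring
      linarith
    have hpos : 0 < ρ⁻¹ * (a * ϖ) + θ := by
      rcases eq_or_ne q 0 with rfl | hq
      · have hp : p ≠ 0 := by rintro rfl; exact hy (by ext (i | i) <;> rfl)
        have hWp : W *ᵥ p ≠ 0 := by
          intro h0
          have := congrArg (P *ᵥ ·) h0
          simp only [Matrix.mulVec_mulVec, hPW, Matrix.one_mulVec, Matrix.mulVec_zero] at this
          exact hp this
        have : 0 < ϖ := dotProduct_self_pos hWp
        positivity
      · have : 0 < θ := hQ.quad_pos hq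
        positivity
    linarith

end Cascade

/-! ### The Riccati protocol -/

section RiccatiProtocol

variable {n m w : ℕ}

theorem stable_sub_smul_one {A : Matrix (Fin n) (Fin n) ℝ}
    (hA : ∀ μ : ℂ, IsEigenvalue A μ → μ.re ≤ 0) {c : ℝ} (hc : 0 < c) :
    Stable (A - c • (1 : Matrix (Fin n) (Fin n) ℝ)) := by
  refine EigStable.stable fun a v hv hav => ?_
  have h1 : (A - c • (1 : Matrix (Fin n) (Fin n) ℝ)).map (algebraMap ℝ ℂ) *ᵥ v
      = A.map (algebraMap ℝ ℂ) *ᵥ v - (c : ℂ) • v := by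
    have : (A - c • (1 : Matrix (Fin n) (Fin n) ℝ)).map (algebraMap ℝ ℂ)
        = A.map (algebraMap ℝ ℂ) - (c : ℂ) • (1 : Matrix (Fin n) (Fin n) ℂ) := by
      ext i j
      simp only [Matrix.map_apply, Matrix.sub_apply, Matrix.smul_apply, Matrix.one_apply, map_sub]
      split_ifs <;> simp
    rw [this, Matrix.sub_mulVec, Matrix.smul_mulVec, Matrix.one_mulVec]
  have h2 : A.map (algebraMap ℝ ℂ) *ᵥ v = (a + c) • v := by
    rw [add_smul, ← hav, h1, sub_add_cancel]
  have h3 := hA (a + c) (Module.End.hasEigenvalue_of_hasEigenvector (x := v)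
    ⟨by rw [Module.End.mem_eigenspace_iff, Matrix.toLin'_apply, h2], hv⟩)
  simp only [Complex.add_re, Complex.ofReal_re] at h3
  linarith

/-- A common Lyapunov function for `A ⊗ 1 - ρ (1 ⊗ L)`, for all `ρ ≥ 1`. -/
theorem exists_kronecker_lyapunov {ν : Type*} [Fintype ν] [DecidableEq ν] {L : Matrix ν ν ℝ}
    (hL : Stable (-L)) {A : Matrix (Fin n) (Fin n) ℝ}
    (hA : ∀ μ : ℂ, IsEigenvalue A μ → μ.re ≤ 0) :
    ∃ R Q : Matrix (ν × Fin n) (ν × Fin n) ℝ, R.PosDef ∧ Q.PosDef ∧ ∀ ρ : ℝ, 1 ≤ ρ → ∀ q,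
      q ⬝ᵥ ((((1 : Matrix ν ν ℝ) ⊗ₖ A - ρ • (L ⊗ₖ (1 : Matrix (Fin n) (Fin n) ℝ))) * R
        + R * ((1 : Matrix ν ν ℝ) ⊗ₖ A - ρ • (L ⊗ₖ (1 : Matrix (Fin n) (Fin n) ℝ)))ᵀ) *ᵥ q)
        ≤ -(ρ * (q ⬝ᵥ (Q *ᵥ q))) := by
  obtain ⟨X, hX⟩ := hL.exists_lyapunov 1
  have hXpos := hL.posDef_of_lyapunov Matrix.PosDef.one hX
  obtain ⟨c, hc, hcX⟩ := exists_quad_le_mul_quad X (Matrix.PosDef.one (n := ν) (R := ℝ))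
  -- As `X ≤ c`, this gives `β X ≤ 1/2 ≤ ρ/2`. Shifting `A` by `β/2` makes it Hurwitz and costs the
  -- term `β X ⊗ Y`, which half of the damping `ρ 1 ⊗ Y` absorbs.
  set β : ℝ := (2 * c)⁻¹ with hβ
  have hβ0 : 0 < β := by positivity
  obtain ⟨Y, hY⟩ := (stable_sub_smul_one hA (half_pos hβ0)).exists_lyapunov 1
  have hYpos := (stable_sub_smul_one hA (half_pos hβ0)).posDef_of_lyapunov Matrix.PosDef.one hY
  have hX' : L * X + X * Lᵀ = 1 := by
    rw [Matrix.transpose_neg, Matrix.neg_mul, Matrix.mul_neg] at hX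
    rw [← sub_eq_zero, ← neg_eq_zero, ← hX]; abel
  have hY' : A * Y + Y * Aᵀ = β • Y - 1 := by
    have e : (A - (β / 2) • (1 : Matrix (Fin n) (Fin n) ℝ)) * Y
        + Y * (A - (β / 2) • (1 : Matrix (Fin n) (Fin n) ℝ))ᵀ = A * Y + Y * Aᵀ - β • Y := by
      simp only [Matrix.transpose_sub, Matrix.transpose_smul, Matrix.transpose_one, Matrix.sub_mul,
        Matrix.mul_sub, Matrix.smul_mul, Matrix.mul_smul, Matrix.one_mul, Matrix.mul_one]
      have : β • Y = (β / 2) • Y + (β / 2) • Y := by rw [← add_smul, add_halves]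
      rw [this]; abel
    rw [e] at hY
    rw [← sub_eq_zero, ← hY]; abel
  refine ⟨X ⊗ₖ Y, (1 / 2 : ℝ) • ((1 : Matrix ν ν ℝ) ⊗ₖ Y), hXpos.kronecker hYpos,
    (Matrix.PosDef.one.kronecker hYpos).smul (by norm_num), fun ρ hρ q => ?_⟩
  have hZ : ((ρ / 2) • (1 : Matrix ν ν ℝ) - β • X).PosSemidef := by
    refine posSemidef_of_real (by simp [hXpos.posSemidef.transpose_eq]) fun y => ?_
    have h1 := hcX y
    have h2 := mul_le_mul_of_nonneg_left h1 hβ0.le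
    have h3 : β * (c * (y ⬝ᵥ ((1 : Matrix ν ν ℝ) *ᵥ y))) = (1 / 2) * (y ⬝ᵥ y) := by
      rw [hβ, Matrix.one_mulVec]; field_simp
    rw [h3] at h2
    simp only [Matrix.sub_mulVec, Matrix.smul_mulVec, dotProduct_sub, dotProduct_smul, smul_eq_mul,
      Matrix.one_mulVec]
    nlinarith [dotProduct_self_nonneg_real y]
  have e : ((1 : Matrix ν ν ℝ) ⊗ₖ A - ρ • (L ⊗ₖ (1 : Matrix (Fin n) (Fin n) ℝ))) * (X ⊗ₖ Y)
        + (X ⊗ₖ Y) * ((1 : Matrix ν ν ℝ) ⊗ₖ A - ρ • (L ⊗ₖ (1 : Matrix (Fin n) (Fin n) ℝ)))ᵀ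
      = -(ρ • ((1 / 2 : ℝ) • ((1 : Matrix ν ν ℝ) ⊗ₖ Y)))
        - (X ⊗ₖ (1 : Matrix (Fin n) (Fin n) ℝ) + ((ρ / 2) • (1 : Matrix ν ν ℝ) - β • X) ⊗ₖ Y) := by
    have e1 : ((1 : Matrix ν ν ℝ) ⊗ₖ A - ρ • (L ⊗ₖ (1 : Matrix (Fin n) (Fin n) ℝ))) * (X ⊗ₖ Y)
        + (X ⊗ₖ Y) * ((1 : Matrix ν ν ℝ) ⊗ₖ A - ρ • (L ⊗ₖ (1 : Matrix (Fin n) (Fin n) ℝ)))ᵀ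
        = X ⊗ₖ (A * Y + Y * Aᵀ) - ρ • ((L * X + X * Lᵀ) ⊗ₖ Y) := by
      simp only [Matrix.transpose_sub, Matrix.transpose_smul, ← Matrix.kroneckerMap_transpose,
        Matrix.transpose_one, Matrix.sub_mul, Matrix.mul_sub, Matrix.smul_mul, Matrix.mul_smul,
        ← Matrix.mul_kronecker_mul, Matrix.one_mul, Matrix.mul_one, Matrix.kronecker_add,
        Matrix.add_kronecker, smul_add]
      abel
    rw [e1, hX', hY']
    ext ⟨i, k⟩ ⟨j, l⟩
    simp only [Matrix.sub_apply, Matrix.neg_apply, Matrix.add_apply, Matrix.smul_apply,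
      Matrix.kroneckerMap_apply, smul_eq_mul]
    ring
  have hnn := ((hXpos.posSemidef.kronecker (Matrix.PosSemidef.one (n := Fin n) (R := ℝ))).add
    (hZ.kronecker hYpos.posSemidef)).quad_nonneg q
  rw [e, Matrix.sub_mulVec, dotProduct_sub, Matrix.neg_mulVec, dotProduct_neg, Matrix.smul_mulVec,
    dotProduct_smul, smul_eq_mul]
  linarith

theorem exists_eq_mul_of_range_le {B : Matrix (Fin n) (Fin m) ℝ} {E : Matrix (Fin n) (Fin w) ℝ}
    (h : LinearMap.range E.mulVecLin ≤ LinearMap.range B.mulVecLin) :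
    ∃ X : Matrix (Fin m) (Fin w) ℝ, E = B * X := by
  have h1 : ∀ j, ∃ x, B *ᵥ x = E *ᵥ Pi.single j 1 := fun j => h ⟨Pi.single j 1, rfl⟩
  choose x hx using h1
  refine ⟨Matrix.of fun i j => x j i, ?_⟩
  ext i j
  have := congrFun (hx j) i
  rw [Matrix.mulVec_single_one] at this
  exact this.symm

/-- Congruence of the Riccati equation by `P⁻¹`. The dual form is needed because the `H₂` estimate
uses `M S + S Mᵀ`. -/
theorem inverse_riccati {A P : Matrix (Fin n) (Fin n) ℝ} {B : Matrix (Fin n) (Fin m) ℝ}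
    (h : IsRiccatiSolution A B P) : A * P⁻¹ + P⁻¹ * Aᵀ = B * Bᵀ - P⁻¹ * P⁻¹ := by
  have hu : IsUnit P.det := P.isUnit_iff_isUnit_det.1 h.1.isUnit
  have h1 : P⁻¹ * P = 1 := Matrix.nonsing_inv_mul _ hu
  have h2 : P * P⁻¹ = 1 := Matrix.mul_nonsing_inv _ hu
  have h3 := congrArg (fun Z => P⁻¹ * Z * P⁻¹) h.2
  simp only [Matrix.mul_add, Matrix.add_mul, Matrix.mul_sub, Matrix.sub_mul, Matrix.mul_zero,
    Matrix.zero_mul, Matrix.mul_one] at h3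
  have e1 : P⁻¹ * (Aᵀ * P) * P⁻¹ = P⁻¹ * Aᵀ := by
    rw [Matrix.mul_assoc, Matrix.mul_assoc Aᵀ, h2, Matrix.mul_one]
  have e2 : P⁻¹ * (P * A) * P⁻¹ = A * P⁻¹ := by rw [← Matrix.mul_assoc P⁻¹, h1, Matrix.one_mul]
  have e3 : P⁻¹ * (P * B * Bᵀ * P) * P⁻¹ = B * Bᵀ := by
    rw [Matrix.mul_assoc, Matrix.mul_assoc (P * B * Bᵀ), h2, Matrix.mul_one, Matrix.mul_assoc P,
      ← Matrix.mul_assoc P⁻¹, h1, Matrix.one_mul]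
  rw [e1, e2, e3] at h3
  rw [← sub_eq_zero, ← h3]
  abel

variable (G : CommGraph) (A : Matrix (Fin n) (Fin n) ℝ) (B : Matrix (Fin n) (Fin m) ℝ)
  (P : Matrix (Fin n) (Fin n) ℝ)

/-- The state matrix of the closed loop with the Riccati protocol. -/
def riccatiClosedLoop (ρ : ℝ) : Matrix (Fin G.N × Fin n ⊕ Fin G.N × Fin n)
    (Fin G.N × Fin n ⊕ Fin G.N × Fin n) ℝ :=
  Matrix.fromBlocks
    ((1 : Matrix (Fin G.N) (Fin G.N) ℝ) ⊗ₖ A)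
    ((1 : Matrix (Fin G.N) (Fin G.N) ℝ) ⊗ₖ (B * (-ρ • (Bᵀ * P))))
    (G.laplacian ⊗ₖ ((ρ • (1 : Matrix (Fin n) (Fin n) ℝ)) * (1 : Matrix (Fin n) (Fin n) ℝ)))
    ((1 : Matrix (Fin G.N) (Fin G.N) ℝ) ⊗ₖ (A + B * (-ρ • (Bᵀ * P)))
      + G.laplacian ⊗ₖ ((-ρ • (1 : Matrix (Fin n) (Fin n) ℝ)) * (1 : Matrix (Fin n) (Fin n) ℝ)))

/-- The output matrix for `x_i - x_j`. -/
def diffOutput (n : ℕ) (i j : Fin G.N) : Matrix (Fin n) (Fin G.N × Fin n ⊕ Fin G.N × Fin n) ℝ :=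
  Matrix.of fun k s =>
    Sum.elim (fun q : Fin G.N × Fin n =>
      if q.2 = k then (if q.1 = i then (1 : ℝ) else 0) - (if q.1 = j then 1 else 0) else 0)
      (fun _ => 0) s

/-- The differences of the agents and of the estimation errors `x_i - χ_i` to their averages. -/
def diffCoordinates (n : ℕ) : Matrix (Fin G.N × Fin n ⊕ Fin G.N × Fin n)
    (Fin G.N × Fin n ⊕ Fin G.N × Fin n) ℝ :=
  Matrix.fromBlocks ((1 - G.avg) ⊗ₖ 1) 0 ((1 - G.avg) ⊗ₖ 1) (-((1 - G.avg) ⊗ₖ 1))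

/-- The closed loop in the coordinates `diffCoordinates`. -/
def reducedMatrix (ρ : ℝ) : Matrix (Fin G.N × Fin n ⊕ Fin G.N × Fin n)
    (Fin G.N × Fin n ⊕ Fin G.N × Fin n) ℝ :=
  cascade ((1 : Matrix (Fin G.N) (Fin G.N) ℝ) ⊗ₖ A) (G.groundedLaplacian ⊗ₖ 1)
    ((1 : Matrix (Fin G.N) (Fin G.N) ℝ) ⊗ₖ P) ((1 : Matrix (Fin G.N) (Fin G.N) ℝ) ⊗ₖ B) ρ

variable {G A B P}

/-- The coordinate map is singular: it discards the average motion, which need not be stable. In the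
error coordinate the inputs cancel, which gives the cascade. -/
theorem diffCoordinates_mul_closedLoop (ρ : ℝ) :
    diffCoordinates G n * riccatiClosedLoop G A B P ρ
      = reducedMatrix G A B P ρ * diffCoordinates G n := by
  rw [diffCoordinates, reducedMatrix, cascade, riccatiClosedLoop, Matrix.fromBlocks_multiply,
    Matrix.fromBlocks_multiply]
  have hK : ((1 : Matrix (Fin G.N) (Fin G.N) ℝ) ⊗ₖ B) * ((1 : Matrix (Fin G.N) (Fin G.N) ℝ) ⊗ₖ B)ᵀ
      * ((1 : Matrix (Fin G.N) (Fin G.N) ℝ) ⊗ₖ P)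
      = (1 : Matrix (Fin G.N) (Fin G.N) ℝ) ⊗ₖ (B * (Bᵀ * P)) := by
    rw [← Matrix.kroneckerMap_transpose, ← Matrix.mul_kronecker_mul, ← Matrix.mul_kronecker_mul,
      Matrix.mul_assoc B]
    simp
  rw [hK]
  simp only [Matrix.mul_smul, Matrix.mul_one, Matrix.kronecker_add, Matrix.kronecker_smul,
    Matrix.mul_add, Matrix.sub_mul, Matrix.smul_mul, Matrix.neg_mul, Matrix.mul_neg,
    Matrix.zero_mul, Matrix.mul_zero, ← Matrix.mul_kronecker_mul, G.groundedLaplacian_mul,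
    Matrix.one_mul]
  congr 1
  · rw [smul_zero, add_zero, sub_add_cancel]
  · simp
  · simp [sub_eq_add_neg]
  · simp only [neg_smul, smul_neg, neg_neg, zero_add, neg_sub]; abel

theorem diffOutput_mul_diffCoordinates (i j : Fin G.N) :
    diffOutput G n i j * diffCoordinates G n = diffOutput G n i j := by
  ext k s
  simp only [Matrix.mul_apply, Fintype.sum_sum_type, Fintype.sum_prod_type, diffOutput,
    Matrix.of_apply, Sum.elim_inl, Sum.elim_inr, zero_mul, Finset.sum_const_zero, add_zero]
  rcases s with ⟨a, b⟩ | ⟨a, b⟩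
  · simp only [diffCoordinates, Matrix.fromBlocks_apply₁₁, Matrix.kroneckerMap_apply, Sum.elim_inl,
      Matrix.sub_apply, CommGraph.avg, Matrix.of_apply, Matrix.one_apply, ite_mul, zero_mul,
      Finset.sum_ite_eq', Finset.mem_univ, if_true, sub_mul, one_mul]
    simp only [Finset.sum_sub_distrib, Finset.sum_ite_eq', Finset.mem_univ, if_true]
    rcases eq_or_ne b k with rfl | hb
    · simp [eq_comm]
    · simp [hb, hb.symm]
  · simp [diffCoordinates]

theorem impulseResponse_riccatiProtocol (E : Matrix (Fin n) (Fin w) ℝ) (ρ : ℝ) (i j : Fin G.N)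
    (t : ℝ) :
    impulseResponse (closedLoopMatrix (⟨A, B, 1, E⟩ : Agent n m n w) (riccatiProtocol A B P) G ρ)
      (inputMatrix (⟨A, B, 1, E⟩ : Agent n m n w) (riccatiProtocol A B P) G)
      (diffOutputMatrix (riccatiProtocol A B P) G i j) t
    = impulseResponse (reducedMatrix G A B P ρ)
      (Matrix.fromRows ((1 - G.avg) ⊗ₖ E) ((1 - G.avg) ⊗ₖ E)) (diffOutput G n i j) t := by
  have h1 := mul_exp_smul_eq_exp_smul_mul
    (diffCoordinates_mul_closedLoop (G := G) (A := A) (B := B) (P := P) ρ) t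
  have h2 : diffCoordinates G n * Matrix.fromRows ((1 : Matrix (Fin G.N) (Fin G.N) ℝ) ⊗ₖ E)
        (0 : Matrix (Fin G.N × Fin n) (Fin G.N × Fin w) ℝ)
      = Matrix.fromRows ((1 - G.avg) ⊗ₖ E) ((1 - G.avg) ⊗ₖ E) := by
    rw [diffCoordinates, Matrix.fromBlocks_mul_fromRows]
    simp [← Matrix.mul_kronecker_mul]
  have h3 : impulseResponse (riccatiClosedLoop G A B P ρ)
      (Matrix.fromRows ((1 : Matrix (Fin G.N) (Fin G.N) ℝ) ⊗ₖ E)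
        (0 : Matrix (Fin G.N × Fin n) (Fin G.N × Fin w) ℝ)) (diffOutput G n i j) t
    = impulseResponse (reducedMatrix G A B P ρ)
      (Matrix.fromRows ((1 - G.avg) ⊗ₖ E) ((1 - G.avg) ⊗ₖ E)) (diffOutput G n i j) t := by
    unfold impulseResponse
    rw [← h2, ← diffOutput_mul_diffCoordinates i j, Matrix.mul_assoc (diffOutput G n i j), h1]
    conv_rhs => rw [diffOutput_mul_diffCoordinates]
    simp only [Matrix.mul_assoc]
  -- The matrices of the protocol unfold definitionally to those of `h3`, its state dimension being
  -- `n`.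
  exact h3

theorem exists_reducedMatrix_lyapunov (hG : G.HasDirectedSpanningTree)
    (hA : ∀ μ : ℂ, IsEigenvalue A μ → μ.re ≤ 0) (hP : IsRiccatiSolution A B P)
    (X : Matrix (Fin m) (Fin w) ℝ) :
    ∃ S : Matrix (Fin G.N × Fin n ⊕ Fin G.N × Fin n) (Fin G.N × Fin n ⊕ Fin G.N × Fin n) ℝ,
      S.PosDef ∧ ∀ ρ : ℝ, 1 ≤ ρ → ∀ y ≠ 0,
      y ⬝ᵥ ((reducedMatrix G A B P ρ * (ρ⁻¹ • S) + (ρ⁻¹ • S) * (reducedMatrix G A B P ρ)ᵀ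
        + Matrix.fromRows ((1 - G.avg) ⊗ₖ (B * X)) ((1 - G.avg) ⊗ₖ (B * X))
          * (Matrix.fromRows ((1 - G.avg) ⊗ₖ (B * X)) ((1 - G.avg) ⊗ₖ (B * X)))ᵀ) *ᵥ y) < 0 := by
  obtain ⟨R, Q, hR, hQ, hRQ⟩ := exists_kronecker_lyapunov hG.stable_neg_groundedLaplacian hA
  have hu : IsUnit P.det := P.isUnit_iff_isUnit_det.1 hP.1.isUnit
  have h2 : P * P⁻¹ = 1 := Matrix.mul_nonsing_inv _ hu
  have key := exists_cascade_lyapunov (A := (1 : Matrix (Fin G.N) (Fin G.N) ℝ) ⊗ₖ A)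
    (Λ := G.groundedLaplacian ⊗ₖ 1) (P := (1 : Matrix (Fin G.N) (Fin G.N) ℝ) ⊗ₖ P)
    (W := (1 : Matrix (Fin G.N) (Fin G.N) ℝ) ⊗ₖ P⁻¹) (B := (1 : Matrix (Fin G.N) (Fin G.N) ℝ) ⊗ₖ B)
    ((1 - G.avg) ⊗ₖ X) (Matrix.PosDef.one.kronecker hP.1.inv) (Matrix.PosDef.one.kronecker hP.1)
    ?_ ?_ hR hQ hRQ
  · have e : ((1 : Matrix (Fin G.N) (Fin G.N) ℝ) ⊗ₖ B) * ((1 - G.avg) ⊗ₖ X)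
        = (1 - G.avg) ⊗ₖ (B * X) := by
      rw [← Matrix.mul_kronecker_mul, Matrix.one_mul]
    rw [e] at key
    exact key
  · rw [← Matrix.mul_kronecker_mul, h2, Matrix.one_mul, Matrix.one_kronecker_one]
  · have h3 := congrArg (fun Z => (1 : Matrix (Fin G.N) (Fin G.N) ℝ) ⊗ₖ Z) (inverse_riccati hP)
    simp only [sub_eq_add_neg, Matrix.kronecker_add] at h3
    simp only [← Matrix.kroneckerMap_transpose, ← Matrix.mul_kronecker_mul, Matrix.one_mul,
      Matrix.transpose_one, h3]
    rw [sub_eq_add_neg]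
    congr 1
    ext ⟨i, k⟩ ⟨j, l⟩
    simp

theorem stack_eq_exp_mulVec {p : ℕ} {S : Agent n m p w} {K : Protocol n m p} {ρ : ℝ}
    {x : ℝ → Fin G.N → Fin n → ℝ} {xc : ℝ → Fin G.N → Fin K.nc → ℝ}
    (h : IsTrajectory S K G ρ (fun _ => 0) x xc) {t : ℝ} (ht : 0 ≤ t) :
    stack (x t) (xc t) = NormedSpace.exp (t • closedLoopMatrix S K G ρ) *ᵥ stack (x 0) (xc 0) := by
  refine eq_exp_mulVec_of_hasDerivWithinAt (z := fun t => stack (x t) (xc t)) (fun s hs => ?_) ht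
  have e := closedLoop_mulVec S K G ρ (x s) (xc s) (fun _ _ => 0)
  have e0 : inputMatrix S K G *ᵥ (fun _ => (0 : ℝ)) = 0 := Matrix.mulVec_zero _
  rw [e0, add_zero] at e
  rw [e]
  refine hasDerivWithinAt_pi.2 ?_
  rintro (⟨i, k⟩ | ⟨i, k⟩)
  · exact hasDerivWithinAt_pi.1 (h s hs i).1 k
  · exact hasDerivWithinAt_pi.1 (h s hs i).2 k

theorem stable_reducedMatrix (hG : G.HasDirectedSpanningTree)
    (hA : ∀ μ : ℂ, IsEigenvalue A μ → μ.re ≤ 0) (hP : IsRiccatiSolution A B P)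
    {ρ : ℝ} (hρ : 1 ≤ ρ) : Stable (reducedMatrix G A B P ρ) := by
  -- Without disturbance the inequality is Lyapunov's criterion.
  obtain ⟨S, hS, h⟩ := exists_reducedMatrix_lyapunov hG hA hP (0 : Matrix (Fin m) (Fin 1) ℝ)
  have hρ0 : 0 < ρ := by linarith
  refine stable_of_lyapunov (hS.smul (inv_pos.2 hρ0)) fun y hy => ?_
  have := h ρ hρ y hy
  simpa [Matrix.fromRows_zero] using this

theorem synchronizes_riccatiProtocol (hG : G.HasDirectedSpanningTree)
    (hA : ∀ μ : ℂ, IsEigenvalue A μ → μ.re ≤ 0) (hP : IsRiccatiSolution A B P)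
    (E : Matrix (Fin n) (Fin w) ℝ) {ρ : ℝ} (hρ : 1 ≤ ρ) :
    Synchronizes (⟨A, B, 1, E⟩ : Agent n m n w) (riccatiProtocol A B P) G ρ := by
  intro x xc h i j
  set C := diffOutput G n i j with hC
  obtain ⟨z, hz⟩ : ∃ z : Fin G.N × Fin n ⊕ Fin G.N × Fin n → ℝ, z = stack (x 0) (xc 0) := ⟨_, rfl⟩
  have h1 : ∀ t : ℝ, 0 ≤ t → x t i - x t j
      = (C * NormedSpace.exp (t • reducedMatrix G A B P ρ)) *ᵥ (diffCoordinates G n *ᵥ z) := by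
    intro t ht
    have h2 := mul_exp_smul_eq_exp_smul_mul
      (diffCoordinates_mul_closedLoop (G := G) (A := A) (B := B) (P := P) ρ) t
    have h3 : C * diffCoordinates G n = C := diffOutput_mul_diffCoordinates i j
    obtain ⟨y, hy⟩ : ∃ y : Fin G.N × Fin n ⊕ Fin G.N × Fin n → ℝ, y = stack (x t) (xc t) := ⟨_, rfl⟩
    have h4 : y = NormedSpace.exp (t • riccatiClosedLoop G A B P ρ) *ᵥ z := by
      rw [hy, hz]; exact stack_eq_exp_mulVec h ht
    have h5 : C *ᵥ y = x t i - x t j := by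
      rw [hy]; exact diffOutput_mulVec (riccatiProtocol A B P) G i j (x t) (xc t)
    rw [← h5, h4, Matrix.mulVec_mulVec, Matrix.mulVec_mulVec, Matrix.mul_assoc, ← h2,
      ← Matrix.mul_assoc, h3]
  have hc : Continuous fun Z : Matrix (Fin G.N × Fin n ⊕ Fin G.N × Fin n)
      (Fin G.N × Fin n ⊕ Fin G.N × Fin n) ℝ => (C * Z) *ᵥ (diffCoordinates G n *ᵥ z) :=
    (continuous_const.matrix_mul continuous_id).matrix_mulVec continuous_const
  have hlim := (hc.tendsto 0).comp (stable_reducedMatrix hG hA hP hρ)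
  rw [Matrix.mul_zero, Matrix.zero_mulVec] at hlim
  refine hlim.congr' ?_
  filter_upwards [Filter.eventually_ge_atTop 0] with t ht
  exact (h1 t ht).symm

theorem exists_h2Norm_bound (hG : G.HasDirectedSpanningTree)
    (hA : ∀ μ : ℂ, IsEigenvalue A μ → μ.re ≤ 0) (hP : IsRiccatiSolution A B P)
    {E : Matrix (Fin n) (Fin w) ℝ}
    (hE : LinearMap.range E.mulVecLin ≤ LinearMap.range B.mulVecLin) :
    ∃ M : ℝ, 0 < M ∧ ∀ ρ : ℝ, 1 ≤ ρ → ∀ i j : Fin G.N,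
      syncH2Norm (⟨A, B, 1, E⟩ : Agent n m n w) (riccatiProtocol A B P) G ρ i j
        < ENNReal.ofReal (M / Real.sqrt ρ) := by
  obtain ⟨X, rfl⟩ := exists_eq_mul_of_range_le hE
  obtain ⟨S, hS, hlyap⟩ := exists_reducedMatrix_lyapunov hG hA hP X
  set C := fun i j => diffOutput G n i j with hC
  have hnn : ∀ i j, 0 ≤ (C i j * S * (C i j)ᵀ).trace := by
    intro i j
    rw [trace_mul_mul_transpose]
    exact Finset.sum_nonneg fun k _ => hS.posSemidef.quad_nonneg _
  set c : ℝ := ∑ i, ∑ j, (C i j * S * (C i j)ᵀ).trace with hc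
  have hcle : ∀ i j, (C i j * S * (C i j)ᵀ).trace ≤ c := fun i j =>
    (Finset.single_le_sum (f := fun j => (C i j * S * (C i j)ᵀ).trace) (fun j _ => hnn i j)
      (Finset.mem_univ j)).trans
    (Finset.single_le_sum (f := fun i => ∑ j, (C i j * S * (C i j)ᵀ).trace)
      (fun i _ => Finset.sum_nonneg fun j _ => hnn i j) (Finset.mem_univ i))
  have hc0 : 0 ≤ c := Finset.sum_nonneg fun i _ => Finset.sum_nonneg fun j _ => hnn i j
  -- The sum `c` over all pairs makes the bound uniform in `i, j`; the `1` makes it strict.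
  refine ⟨Real.sqrt c + 1, by positivity, fun ρ hρ i j => ?_⟩
  have hρ0 : 0 < ρ := by linarith
  have hb := lintegral_impulseResponse_le (C i j) (stable_reducedMatrix hG hA hP hρ)
    (S := ρ⁻¹ • S) (D := Matrix.fromRows ((1 - G.avg) ⊗ₖ (B * X)) ((1 - G.avg) ⊗ₖ (B * X)))
    (fun y => by
      rcases eq_or_ne y 0 with rfl | hy
      · simp
      · exact (hlyap ρ hρ y hy).le)
  have hle : (C i j * (ρ⁻¹ • S) * (C i j)ᵀ).trace ≤ ρ⁻¹ * c := by
    rw [Matrix.mul_smul, Matrix.smul_mul, Matrix.trace_smul, smul_eq_mul]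
    exact mul_le_mul_of_nonneg_left (hcle i j) (inv_nonneg.2 hρ0.le)
  have h1 : syncH2Norm (⟨A, B, 1, B * X⟩ : Agent n m n w) (riccatiProtocol A B P) G ρ i j
      ≤ ENNReal.ofReal (ρ⁻¹ * c) ^ (1 / 2 : ℝ) := by
    rw [syncH2Norm, h2Norm]
    simp only [impulseResponse_riccatiProtocol]
    exact ENNReal.rpow_le_rpow (hb.trans (ENNReal.ofReal_le_ofReal hle)) (by norm_num)
  refine h1.trans_lt ?_
  rw [ENNReal.ofReal_rpow_of_nonneg (by positivity) (by norm_num), ← Real.sqrt_eq_rpow]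
  rw [ENNReal.ofReal_lt_ofReal_iff (by positivity), Real.sqrt_mul (inv_nonneg.2 hρ0.le),
    Real.sqrt_inv, div_eq_inv_mul]
  have : 0 < (Real.sqrt ρ)⁻¹ := by positivity
  exact mul_lt_mul_of_pos_left (lt_add_one _) this

theorem solves_riccatiProtocol (hA : ∀ μ : ℂ, IsEigenvalue A μ → μ.re ≤ 0)
    (hP : IsRiccatiSolution A B P) {E : Matrix (Fin n) (Fin w) ℝ}
    (hE : LinearMap.range E.mulVecLin ≤ LinearMap.range B.mulVecLin) :
    Solves (⟨A, B, 1, E⟩ : Agent n m n w) (riccatiProtocol A B P)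
      {G | G.HasDirectedSpanningTree} := by
  intro G hG
  refine ⟨fun ρ hρ => synchronizes_riccatiProtocol hG hA hP E hρ, fun γ hγ => ?_⟩
  obtain ⟨M, hM, h⟩ := exists_h2Norm_bound hG hA hP hE
  refine ⟨max 1 ((M / γ) ^ 2), le_max_left _ _, fun ρ hρ i j => ?_⟩
  have hρ1 : 1 ≤ ρ := (le_max_left _ _).trans hρ
  refine (h ρ hρ1 i j).trans_le (ENNReal.ofReal_le_ofReal ?_)
  have h2 : M / γ ≤ Real.sqrt ρ := Real.le_sqrt_of_sq_le ((le_max_right _ _).trans hρ)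
  rw [div_le_iff₀ hγ] at h2
  rw [div_le_iff₀ (by positivity)]
  linarith

end RiccatiProtocol

/-! ### Two agents -/

section Pair

variable {n m w p : ℕ}

/-- The graph on two nodes whose only edge, of weight `a`, goes from `0` to `1`. -/
def pairGraph (a : ℝ) (ha : 0 ≤ a) : CommGraph where
  N := 2
  pos := two_pos
  a := !![0, 0; a, 0]
  nonneg i j := by fin_cases i <;> fin_cases j <;> simp [ha]
  noLoop i := by fin_cases i <;> simp

theorem hasDirectedSpanningTree_pairGraph {a : ℝ} (ha : 0 < a) :
    (pairGraph a ha.le).HasDirectedSpanningTree := by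
  refine CommGraph.hasDirectedSpanningTree_of_reach (r := (0 : Fin 2)) ?_
  refine Fin.forall_fin_two.2 ⟨Relation.ReflTransGen.refl, Relation.ReflTransGen.single ?_⟩
  exact ha

theorem relative_pairGraph {a : ℝ} (ha : 0 ≤ a) {q : ℕ} (v : Fin 2 → Fin q → ℝ) :
    (pairGraph a ha).relative v = ![0, a • (v 1 - v 0)] := by
  funext i
  have h : (pairGraph a ha).relative v i = ∑ j : Fin 2, (!![0, 0; a, 0] : Matrix _ _ ℝ) i j • (v i - v j) := rfl
  rw [h, Fin.sum_univ_two]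
  revert i
  refine Fin.forall_fin_two.2 ⟨by simp, by simp⟩

/-- The closed-loop state matrix of an agent following an agent at rest, along an edge of weight
`a`. -/
def pairMatrix (S : Agent n m p w) (K : Protocol n m p) (ρ a : ℝ) :
    Matrix (Fin n ⊕ Fin K.nc) (Fin n ⊕ Fin K.nc) ℝ :=
  Matrix.fromBlocks S.A (S.B * K.Fc ρ) (a • (K.Bc ρ * S.C)) (K.Ac ρ + a • (K.Cc ρ * K.Hc))

section

variable (S : Agent n m p w) (K : Protocol n m p) (ρ : ℝ) {a : ℝ} (ha : 0 ≤ a)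
  (v : Fin n → ℝ) (u : Fin K.nc → ℝ)

theorem agentField_pairGraph_zero :
    agentField S K (pairGraph a ha) ρ ![0, v] ![0, u] (fun _ => 0) (0 : Fin 2) = 0 := by
  change S.A *ᵥ 0 + S.B *ᵥ (K.Fc ρ *ᵥ 0) + S.E *ᵥ 0 = 0
  simp

theorem agentField_pairGraph_one :
    agentField S K (pairGraph a ha) ρ ![0, v] ![0, u] (fun _ => 0) (1 : Fin 2)
      = S.A *ᵥ v + (S.B * K.Fc ρ) *ᵥ u := by
  change S.A *ᵥ v + S.B *ᵥ (K.Fc ρ *ᵥ u) + S.E *ᵥ 0 = _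
  simp

theorem protocolField_pairGraph_zero :
    protocolField S K (pairGraph a ha) ρ ![0, v] ![0, u] (0 : Fin 2) = 0 := by
  have h1 := congrFun (relative_pairGraph ha fun j : Fin 2 => S.C *ᵥ ![0, v] j) (0 : Fin 2)
  have h2 := congrFun (relative_pairGraph ha fun j : Fin 2 => K.Hc *ᵥ ![0, u] j) (0 : Fin 2)
  refine (congrArg₂ (fun x y => K.Ac ρ *ᵥ 0 + K.Bc ρ *ᵥ x + K.Cc ρ *ᵥ y) h1 h2).trans ?_
  simp

theorem protocolField_pairGraph_one :
    protocolField S K (pairGraph a ha) ρ ![0, v] ![0, u] (1 : Fin 2)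
      = (a • (K.Bc ρ * S.C)) *ᵥ v + (K.Ac ρ + a • (K.Cc ρ * K.Hc)) *ᵥ u := by
  have h1 := congrFun (relative_pairGraph ha fun j : Fin 2 => S.C *ᵥ ![0, v] j) (1 : Fin 2)
  have h2 := congrFun (relative_pairGraph ha fun j : Fin 2 => K.Hc *ᵥ ![0, u] j) (1 : Fin 2)
  refine (congrArg₂ (fun x y => K.Ac ρ *ᵥ u + K.Bc ρ *ᵥ x + K.Cc ρ *ᵥ y) h1 h2).trans ?_
  simp only [Matrix.cons_val_one, Matrix.cons_val_zero, Matrix.mulVec_zero, sub_zero,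
    Matrix.mulVec_smul, Matrix.add_mulVec, Matrix.smul_mulVec, Matrix.mulVec_mulVec]
  abel

end

/-- Node `0` receives nothing, so it may rest at zero; the difference is then the state of node `1`,
governed by `pairMatrix`. -/
theorem Synchronizes.tendsto_exp_pairMatrix {S : Agent n m p w} {K : Protocol n m p} {ρ a : ℝ}
    {ha : 0 ≤ a} (h : Synchronizes S K (pairGraph a ha) ρ) (k : Fin n) (l : Fin n ⊕ Fin K.nc) :
    Filter.Tendsto (fun t : ℝ => NormedSpace.exp (t • pairMatrix S K ρ a) (Sum.inl k) l)
      Filter.atTop (𝓝 0) := by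
  set z : ℝ → Fin n ⊕ Fin K.nc → ℝ := fun t =>
    NormedSpace.exp (t • pairMatrix S K ρ a) *ᵥ Pi.single l 1 with hz
  have hz' : ∀ t, HasDerivAt z (pairMatrix S K ρ a *ᵥ z t) t := fun t =>
    hasDerivAt_exp_smul_mulVec _ _ t
  have hsplit : ∀ t, z t = Sum.elim (fun k => z t (Sum.inl k)) (fun k => z t (Sum.inr k)) :=
    fun t => by ext (k | k) <;> rfl
  have key := h (fun t => ![0, fun k => z t (Sum.inl k)]) (fun t => ![0, fun k => z t (Sum.inr k)])
    ?_ (1 : Fin 2) (0 : Fin 2)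
  · have h1 := tendsto_pi_nhds.1 key k
    refine h1.congr fun t => ?_
    simp [hz]
  · intro t _
    have hd := hz' t
    rw [hsplit t, pairMatrix, Matrix.fromBlocks_mulVec] at hd
    refine Fin.forall_fin_two.2 ⟨⟨?_, ?_⟩, ?_, ?_⟩
    · exact (agentField_pairGraph_zero S K ρ ha _ _).symm ▸ hasDerivWithinAt_const _ _ _
    · exact (protocolField_pairGraph_zero S K ρ ha _ _).symm ▸ hasDerivWithinAt_const _ _ _
    · refine (agentField_pairGraph_one S K ρ ha _ _).symm ▸
        (hasDerivAt_pi.2 fun k => ?_).hasDerivWithinAt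
      exact hasDerivAt_pi.1 hd (Sum.inl k)
    · refine (protocolField_pairGraph_one S K ρ ha _ _).symm ▸
        (hasDerivAt_pi.2 fun k => ?_).hasDerivWithinAt
      exact hasDerivAt_pi.1 hd (Sum.inr k)

end Pair

/-! ### Stabilizability from output stability -/

section Stabilizability

theorem mulVec_transpose_sq_le {ι κ : Type*} [Fintype ι] [Fintype κ] (X : Matrix κ ι ℝ) (y : κ → ℝ) :
    (Xᵀ *ᵥ y) ⬝ᵥ (Xᵀ *ᵥ y) ≤ (X * Xᵀ).trace * (y ⬝ᵥ y) := by
  have h : ∀ k, (Xᵀ *ᵥ y) k * (Xᵀ *ᵥ y) k ≤ (∑ i, X i k ^ 2) * (y ⬝ᵥ y) := by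
    intro k
    have := Finset.sum_mul_sq_le_sq_mul_sq Finset.univ (fun i => X i k) y
    rw [← sq]
    simpa [Matrix.mulVec, dotProduct, sq] using this
  calc (Xᵀ *ᵥ y) ⬝ᵥ (Xᵀ *ᵥ y) ≤ ∑ k, (∑ i, X i k ^ 2) * (y ⬝ᵥ y) := Finset.sum_le_sum fun k _ => h k
    _ = (X * Xᵀ).trace * (y ⬝ᵥ y) := by
      rw [← Finset.sum_mul, Finset.sum_comm]
      simp [Matrix.trace, Matrix.mul_apply, sq]

variable {ι : Type*} [Fintype ι] [DecidableEq ι]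

/-- `S` is the integral of `exp (tM) exp (tMᵀ)` over `[0, T]`. The finite horizon matters: `M` need
not be stable. -/
theorem exists_gramian (M : Matrix ι ι ℝ) {T : ℝ} (hT : 0 < T) :
    ∃ S : Matrix ι ι ℝ, S.PosDef ∧
      M * S + S * Mᵀ = NormedSpace.exp (T • M) * (NormedSpace.exp (T • M))ᵀ - 1 := by
  set g : ℝ → Matrix ι ι ℝ := fun t => NormedSpace.exp (t • M) * NormedSpace.exp (t • Mᵀ) with hg
  have htr : ∀ t : ℝ, NormedSpace.exp (t • Mᵀ) = (NormedSpace.exp (t • M))ᵀ := fun t => by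
    rw [← Matrix.exp_transpose, Matrix.transpose_smul]
  have hd : ∀ t, HasDerivAt g (M * g t + g t * Mᵀ) t := by
    intro t
    have := hasDerivAt_exp_mul_mul_exp M 1 Mᵀ t
    simp only [Matrix.mul_one, Matrix.one_mul] at this
    convert this using 1
    rw [Matrix.mul_add, Matrix.add_mul, ← exp_smul_commute, hg, Matrix.mul_assoc M,
      Matrix.mul_assoc _ Mᵀ, exp_smul_commute Mᵀ, Matrix.mul_assoc]
  have hc : Continuous g := (continuous_exp_smul M).matrix_mul (continuous_exp_smul Mᵀ)
  have hce : ∀ i j, Continuous fun t => g t i j := fun i j => hc.matrix_elem i j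
  set S : Matrix ι ι ℝ := Matrix.of fun i j => ∫ t in (0 : ℝ)..T, g t i j with hS
  have hquad : ∀ y : ι → ℝ, y ⬝ᵥ (S *ᵥ y) = ∫ t in (0 : ℝ)..T, y ⬝ᵥ (g t *ᵥ y) := by
    intro y
    simp only [dotProduct, Matrix.mulVec, Finset.mul_sum]
    have h1 : ∀ i j, Continuous fun t => y i * (g t i j * y j) := fun i j =>
      continuous_const.mul ((hce i j).mul continuous_const)
    have h2 : ∀ i, Continuous fun t => ∑ j, y i * (g t i j * y j) := fun i =>
      continuous_finsetSum _ fun j _ => h1 i j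
    rw [intervalIntegral.integral_finsetSum fun i _ => (h2 i).intervalIntegrable _ _]
    refine Finset.sum_congr rfl fun i _ => ?_
    rw [intervalIntegral.integral_finsetSum fun j _ => (h1 i j).intervalIntegrable _ _]
    refine Finset.sum_congr rfl fun j _ => ?_
    rw [intervalIntegral.integral_const_mul, intervalIntegral.integral_mul_const]
    rfl
  refine ⟨S, posDef_of_real ?_ fun y hy => ?_, ?_⟩
  · ext i j
    simp only [hS, Matrix.transpose_apply, Matrix.of_apply]
    refine intervalIntegral.integral_congr fun t _ => ?_
    have : (g t)ᵀ = g t := by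
      simp only [hg, htr, Matrix.transpose_mul, Matrix.transpose_transpose]
    exact congrFun (congrFun this i) j
  · rw [hquad]
    refine intervalIntegral.intervalIntegral_pos_of_pos (Continuous.intervalIntegrable ?_ _ _)
      (fun t => ?_) hT
    · exact continuous_const.dotProduct (hc.matrix_mulVec continuous_const)
    · have e : y ⬝ᵥ (g t *ᵥ y)
          = ((NormedSpace.exp (t • M))ᵀ *ᵥ y) ⬝ᵥ ((NormedSpace.exp (t • M))ᵀ *ᵥ y) := by
        rw [hg]
        simp only [dotProduct_mul_mulVec, htr]
      rw [e]
      refine dotProduct_self_pos fun h0 => hy ?_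
      have h1 := congrArg (fun v => NormedSpace.exp ((-t) • Mᵀ) *ᵥ v) h0
      have h2 := exp_neg_smul_mul Mᵀ (-t)
      rw [neg_neg] at h2
      simp only [← htr, Matrix.mulVec_mulVec, h2, Matrix.one_mulVec, Matrix.mulVec_zero] at h1
      exact h1
  · ext i j
    have hint : ∀ s ∈ Set.uIcc 0 T, HasDerivAt (fun t => g t i j) ((M * g s + g s * Mᵀ) i j) s :=
      fun s _ => hasDerivAt_pi.1 (hasDerivAt_pi.1 (hd s) i) j
    have hcd : Continuous fun s => (M * g s + g s * Mᵀ) i j :=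
      ((continuous_const.matrix_mul hc).add (hc.matrix_mul continuous_const)).matrix_elem i j
    have := intervalIntegral.integral_eq_sub_of_hasDerivAt hint (hcd.intervalIntegrable _ _)
    have e0 : g 0 = 1 := by simp [hg]
    have eT : g T = NormedSpace.exp (T • M) * (NormedSpace.exp (T • M))ᵀ := by
      simp only [hg, htr]
    rw [← eT, Matrix.sub_apply, ← e0, ← this]
    simp only [Matrix.add_apply, Matrix.mul_apply, Matrix.transpose_apply]
    have h1 : ∀ k, Continuous fun t => M i k * g t k j := fun k => continuous_const.mul (hce k j)
    have h2 : ∀ k, Continuous fun t => g t i k * M j k := fun k => (hce i k).mul continuous_const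
    rw [intervalIntegral.integral_add
      ((continuous_finsetSum _ fun k _ => h1 k).intervalIntegrable _ _)
      ((continuous_finsetSum _ fun k _ => h2 k).intervalIntegrable _ _),
      intervalIntegral.integral_finsetSum fun k _ => (h1 k).intervalIntegrable _ _,
      intervalIntegral.integral_finsetSum fun k _ => (h2 k).intervalIntegrable _ _]
    simp only [intervalIntegral.integral_const_mul, intervalIntegral.integral_mul_const]
    rfl

/-- A pair `(A, B)` is stabilizable if some dynamic feedback makes the state tend to zero. -/
theorem stabilizable_of_tendsto {n m : ℕ} {A : Matrix (Fin n) (Fin n) ℝ}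
    {B : Matrix (Fin n) (Fin m) ℝ} {M : Matrix ι ι ℝ} {C : Matrix (Fin n) ι ℝ}
    {F : Matrix (Fin m) ι ℝ} (hC : C * Cᵀ = 1) (hM : C * M = A * C + B * F)
    (h : Filter.Tendsto (fun t : ℝ => C * NormedSpace.exp (t • M)) Filter.atTop (𝓝 0)) :
    Stabilizable A B := by
  have h1 : Filter.Tendsto (fun t : ℝ =>
      ((C * NormedSpace.exp (t • M)) * (C * NormedSpace.exp (t • M))ᵀ).trace)
      Filter.atTop (𝓝 0) := by
    have hcont : Continuous fun X : Matrix (Fin n) ι ℝ => (X * Xᵀ).trace :=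
      (continuous_id.matrix_mul continuous_id.matrix_transpose).matrix_trace
    have := (hcont.tendsto 0).comp h
    rwa [Matrix.zero_mul, Matrix.trace_zero] at this
  -- At this time the Frobenius norm of `C exp (TM)` is below `1`, so the compressed Lyapunov
  -- expression `C exp (TM) (C exp (TM))ᵀ - 1` is negative definite.
  obtain ⟨T, hT1, hT⟩ := ((h1.eventually_lt_const one_pos).and
    (Filter.eventually_gt_atTop 0)).exists
  obtain ⟨S, hS, hMS⟩ := exists_gramian M hT
  set X := C * S * Cᵀ with hX
  have hXpos : X.PosDef := by
    refine posDef_of_real ?_ fun y hy => ?_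
    · rw [hX, Matrix.transpose_mul, Matrix.transpose_mul, Matrix.transpose_transpose,
        hS.posSemidef.transpose_eq, Matrix.mul_assoc]
    · have e : y ⬝ᵥ (X *ᵥ y) = (Cᵀ *ᵥ y) ⬝ᵥ (S *ᵥ (Cᵀ *ᵥ y)) := by
        rw [hX, Matrix.mul_assoc, dotProduct_mul_mulVec, Matrix.mulVec_mulVec]
      rw [e]
      refine hS.quad_pos fun h0 => hy ?_
      have := congrArg (fun v => C *ᵥ v) h0
      simpa [Matrix.mulVec_mulVec, hC] using this
  have hu : IsUnit X.det := X.isUnit_iff_isUnit_det.1 hXpos.isUnit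
  -- The gain compresses the dynamic feedback `F` to the plant state, weighted by the Gramian, so
  -- that `(A + B F') X = C M S Cᵀ`.
  refine ⟨F * S * Cᵀ * X⁻¹, (hurwitz_iff_eigStable _).2 (Stable.eigStable
    (stable_of_lyapunov hXpos fun y hy => ?_))⟩
  have e1 : (A + B * (F * S * Cᵀ * X⁻¹)) * X = C * M * S * Cᵀ := by
    rw [Matrix.add_mul, Matrix.mul_assoc B, Matrix.mul_assoc _ X⁻¹, Matrix.nonsing_inv_mul _ hu,
      Matrix.mul_one, hM, hX]
    simp only [Matrix.add_mul, Matrix.mul_assoc]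
  have e2 : X * (A + B * (F * S * Cᵀ * X⁻¹))ᵀ = C * S * Mᵀ * Cᵀ := by
    have := congrArg Matrix.transpose e1
    rw [Matrix.transpose_mul, hXpos.posSemidef.transpose_eq] at this
    rw [this]
    simp only [Matrix.transpose_mul, Matrix.transpose_transpose, hS.posSemidef.transpose_eq,
      Matrix.mul_assoc]
  have e3 : (A + B * (F * S * Cᵀ * X⁻¹)) * X + X * (A + B * (F * S * Cᵀ * X⁻¹))ᵀ
      = (C * NormedSpace.exp (T • M)) * (C * NormedSpace.exp (T • M))ᵀ - 1 := by
    have : C * M * S * Cᵀ + C * S * Mᵀ * Cᵀ = C * (M * S + S * Mᵀ) * Cᵀ := by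
      simp only [Matrix.mul_add, Matrix.add_mul, Matrix.mul_assoc]
    rw [e1, e2, this, hMS, Matrix.mul_sub, Matrix.sub_mul, Matrix.mul_one, hC, Matrix.transpose_mul]
    simp only [Matrix.mul_assoc]
  rw [e3, Matrix.sub_mulVec, dotProduct_sub, Matrix.one_mulVec, dotProduct_mul_mulVec]
  have h2 := mulVec_transpose_sq_le (C * NormedSpace.exp (T • M)) y
  have h3 := dotProduct_self_pos hy
  nlinarith

end Stabilizability

/-! ### Stabilizability from synchronization of two agents -/

section Pair

variable {n m w : ℕ}

theorem stabilizable_of_synchronizes {A : Matrix (Fin n) (Fin n) ℝ} {B : Matrix (Fin n) (Fin m) ℝ}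
    {E : Matrix (Fin n) (Fin w) ℝ} {K : Protocol n m n} {ρ a : ℝ} {ha : 0 ≤ a}
    (h : Synchronizes (⟨A, B, 1, E⟩ : Agent n m n w) K (pairGraph a ha) ρ) :
    Stabilizable A B := by
  refine stabilizable_of_tendsto (M := pairMatrix (⟨A, B, 1, E⟩ : Agent n m n w) K ρ a)
    (C := Matrix.fromCols 1 0) (F := Matrix.fromCols 0 (K.Fc ρ)) ?_ ?_ ?_
  · rw [Matrix.transpose_fromCols, Matrix.fromCols_mul_fromRows]
    simp
  · rw [pairMatrix, Matrix.fromCols_mul_fromBlocks, Matrix.mul_fromCols, Matrix.mul_fromCols]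
    ext i (j | j) <;> simp
  · refine tendsto_pi_nhds.2 fun k => tendsto_pi_nhds.2 fun l => ?_
    refine (h.tendsto_exp_pairMatrix k l).congr fun t => ?_
    simp [Matrix.mul_apply, Matrix.one_apply]

end Pair

/-! ### Spectrum of the agents and weak coupling -/

section WeakCoupling

open Polynomial

variable {ι : Type*} [Fintype ι] [DecidableEq ι]

theorem aeval_prod_X_sub_C (N : Matrix ι ι ℂ) (l : List ℂ) :
    aeval N (l.map fun μ => X - C μ).prod
      = (l.map fun μ => N - μ • (1 : Matrix ι ι ℂ)).prod := by
  rw [map_list_prod, List.map_map]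
  congr 1
  refine List.map_congr_left fun μ _ => ?_
  simp [Algebra.algebraMap_eq_smul_one]

/-- A vector whose orbit under `N` tends to zero is annihilated by the factors of any annihilating
product that have their root in the open unit disk. -/
theorem aeval_prod_mulVec_eq_zero {N : Matrix ι ι ℂ} (l : List ℂ) {u : ι → ℂ}
    (hu : Filter.Tendsto (fun k : ℕ => N ^ k *ᵥ u) Filter.atTop (𝓝 0))
    (h : aeval N (l.map fun μ => X - C μ).prod *ᵥ u = 0) :
    aeval N (l.map fun μ => X - C (if ‖μ‖ < 1 then μ else 0)).prod *ᵥ u = 0 := by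
  have hlim : ∀ (Q : Matrix ι ι ℂ) (v : ι → ℂ), Commute N Q →
      Filter.Tendsto (fun k : ℕ => N ^ k *ᵥ v) Filter.atTop (𝓝 0) →
      Filter.Tendsto (fun k : ℕ => N ^ k *ᵥ (Q *ᵥ v)) Filter.atTop (𝓝 0) := by
    intro Q v hQ hv
    have h1 : Continuous fun x : ι → ℂ => Q *ᵥ x := continuous_const.matrix_mulVec continuous_id
    have h2 := (h1.tendsto 0).comp hv
    rw [Matrix.mulVec_zero] at h2
    refine h2.congr fun k => ?_
    rw [Function.comp_apply, Matrix.mulVec_mulVec, Matrix.mulVec_mulVec, (hQ.pow_left k).eq]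
  have hcomm : ∀ q : ℂ[X], Commute N (aeval N q) := fun q => by
    have := Commute.all (X : ℂ[X]) q
    simpa using this.map (aeval N)
  induction l generalizing u with
  | nil => simpa using h
  | cons μ l ih =>
    rw [List.map_cons, List.prod_cons] at h ⊢
    have h1 := ih (u := aeval N (X - C μ) *ᵥ u) (hlim _ _ (hcomm _) hu) (by
      rwa [Matrix.mulVec_mulVec, ← map_mul, mul_comm])
    split_ifs with hμ
    · rwa [mul_comm, map_mul, ← Matrix.mulVec_mulVec]
    -- For `‖μ‖ ≥ 1` the vector `v` is fixed up to the factor `μ` by `N`, while its orbit tends to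
    -- zero, so `v = 0`. The useless factor is replaced by one with root `0`, which keeps the number
    -- of factors.
    · set v := aeval N (l.map fun μ => X - C (if ‖μ‖ < 1 then μ else 0)).prod *ᵥ u with hv
      have h2 : aeval N (X - C μ) *ᵥ v = 0 := by
        rw [hv, Matrix.mulVec_mulVec, ← map_mul, mul_comm, map_mul, ← Matrix.mulVec_mulVec, h1]
      have h3 : N *ᵥ v = μ • v := by
        rw [← sub_eq_zero, ← h2]
        simp [Algebra.algebraMap_eq_smul_one, Matrix.sub_mulVec, Matrix.smul_mulVec]
      have h4 : ∀ k : ℕ, N ^ k *ᵥ v = μ ^ k • v := by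
        intro k
        induction k with
        | zero => simp
        | succ k ihk =>
          rw [pow_succ, ← Matrix.mulVec_mulVec, h3, Matrix.mulVec_smul, ihk, smul_smul, pow_succ,
            mul_comm]
      have h5 : Filter.Tendsto (fun k : ℕ => N ^ k *ᵥ v) Filter.atTop (𝓝 0) :=
        hlim _ _ (hcomm _) hu
      have h6 : v = 0 := by
        ext i
        have h7 := (tendsto_pi_nhds.1 h5 i).norm
        simp only [h4, Pi.smul_apply, smul_eq_mul, norm_mul, norm_pow, Pi.zero_apply,
          norm_zero] at h7
        have h8 := ge_of_tendsto' h7 (b := ‖v i‖) fun k =>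
          le_mul_of_one_le_left (norm_nonneg _) (one_le_pow₀ (not_lt.1 hμ))
        exact norm_le_zero_iff.1 h8
      rw [map_mul, ← Matrix.mulVec_mulVec, ← hv, h6, Matrix.mulVec_zero]

/-- Cayley–Hamilton, with the roots outside the open disk replaced by `0`. The number of factors
depends only on the dimension, as the compactness argument needs. -/
theorem exists_prod_mulVec_eq_zero {N : Matrix ι ι ℂ} {u : ι → ℂ}
    (hu : Filter.Tendsto (fun k : ℕ => N ^ k *ᵥ u) Filter.atTop (𝓝 0)) :
    ∃ μ : Fin (Fintype.card ι) → ℂ, (∀ i, ‖μ i‖ ≤ 1) ∧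
      ((List.finRange (Fintype.card ι)).map fun i => N - μ i • (1 : Matrix ι ι ℂ)).prod *ᵥ u
        = 0 := by
  set l := N.charpoly.roots.toList with hl
  have hs : N.charpoly.Splits := IsAlgClosed.splits _
  have hlen : l.length = Fintype.card ι := by
    rw [hl, Multiset.length_toList, ← hs.natDegree_eq_card_roots, Matrix.charpoly_natDegree_eq_dim]
  have hprod : (l.map fun μ => X - C μ).prod = N.charpoly := by
    have h1 := hs.eq_prod_roots_of_monic N.charpoly_monic
    rw [h1, ← Multiset.prod_coe, ← Multiset.map_coe, hl, Multiset.coe_toList, ← h1]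
  have h2 := aeval_prod_mulVec_eq_zero l hu (by
    rw [hprod, Matrix.aeval_self_charpoly, Matrix.zero_mulVec])
  set g : ℂ → ℂ := fun μ => if ‖μ‖ < 1 then μ else 0 with hg
  have h3 : (l.map fun μ => X - C (if ‖μ‖ < 1 then μ else 0)) = (l.map g).map fun μ => X - C μ := by
    rw [List.map_map]; rfl
  rw [h3, aeval_prod_X_sub_C] at h2
  refine ⟨fun i => g (l.get (i.cast hlen.symm)), fun i => ?_, ?_⟩
  · simp only [hg]
    split_ifs with h
    · exact h.le
    · simp
  · convert h2 using 3
    refine List.ext_get (by simp [hlen]) fun k _ _ => ?_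
    simp

theorem prod_mulVec_dotProduct {N : Matrix ι ι ℂ} {z : ι → ℂ} {b : ℂ} (h : Nᵀ *ᵥ z = b • z)
    {κ : Type*} (l : List κ) (μ : κ → ℂ) (u : ι → ℂ) :
    ((l.map fun i => N - μ i • (1 : Matrix ι ι ℂ)).prod *ᵥ u) ⬝ᵥ z
      = (l.map fun i => b - μ i).prod * (u ⬝ᵥ z) := by
  induction l with
  | nil => simp
  | cons i l ih =>
    rw [List.map_cons, List.prod_cons, List.map_cons, List.prod_cons, ← Matrix.mulVec_mulVec,
      Matrix.sub_mulVec, Matrix.smul_mulVec, Matrix.one_mulVec, sub_dotProduct, smul_dotProduct,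
      ← Matrix.vecMul_transpose, ← Matrix.dotProduct_mulVec, h, dotProduct_smul, ih]
    simp only [smul_eq_mul]
    ring

/-- The roots `μ i` stay in a compact polydisk, so the relation obtained for small `a > 0` persists
at `a = 0` for some `μ`. Pairing with `z` turns it into `∏ (b - μ i) * (u ⬝ᵥ z) = 0`, and `‖b‖ > 1 ≥
‖μ i‖`. -/
theorem dotProduct_eq_zero_of_tendsto_pow {N : ℝ → Matrix ι ι ℂ} (hN : Continuous N)
    {u z : ι → ℂ} {b : ℂ} (hb : 1 < ‖b‖) (h0 : (N 0)ᵀ *ᵥ z = b • z)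
    (h : ∀ a, 0 < a → Filter.Tendsto (fun k : ℕ => N a ^ k *ᵥ u) Filter.atTop (𝓝 0)) :
    u ⬝ᵥ z = 0 := by
  set D := Fintype.card ι
  set f : ℝ × (Fin D → ℂ) → ℂ := fun q =>
    (((List.finRange D).map fun i => N q.1 - q.2 i • (1 : Matrix ι ι ℂ)).prod *ᵥ u) ⬝ᵥ z with hf
  have hfc : Continuous f := by
    refine (Continuous.matrix_mulVec ?_ continuous_const).dotProduct continuous_const
    exact continuous_list_prod _ fun i _ => (hN.comp continuous_fst).sub
      (((continuous_apply i).comp continuous_snd).smul continuous_const)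
  set Z : Set (ℝ × (Fin D → ℂ)) :=
    (Set.Icc 0 1 ×ˢ Set.pi Set.univ fun _ => Metric.closedBall 0 1) ∩ f ⁻¹' {0} with hZ
  have hZc : IsCompact Z := (isCompact_Icc.prod
    (isCompact_univ_pi fun _ => isCompact_closedBall _ _)).inter_right
      (isClosed_singleton.preimage hfc)
  have hcl : IsClosed (Prod.fst '' Z) := (hZc.image continuous_fst).isClosed
  have hmem : ∀ k : ℕ, (1 / ((k : ℝ) + 1)) ∈ Prod.fst '' Z := by
    intro k
    have hk : (0 : ℝ) < 1 / ((k : ℝ) + 1) := by positivity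
    obtain ⟨μ, hμ, hμ0⟩ := exists_prod_mulVec_eq_zero (h _ hk)
    refine ⟨(1 / ((k : ℝ) + 1), μ), ⟨⟨⟨hk.le, ?_⟩, fun i _ => by simpa using hμ i⟩, ?_⟩, rfl⟩
    · rw [div_le_one (by positivity)]
      simp
    · simp only [hf, Set.mem_preimage, Set.mem_singleton_iff]
      rw [hμ0, zero_dotProduct]
  obtain ⟨⟨a, μ⟩, ⟨⟨-, hμ⟩, hfa⟩, rfl⟩ :=
    hcl.mem_of_tendsto tendsto_one_div_add_atTop_nhds_zero_nat (Filter.Eventually.of_forall hmem)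
  simp only [hf, Set.mem_preimage, Set.mem_singleton_iff] at hfa
  rw [prod_mulVec_dotProduct h0, mul_eq_zero] at hfa
  refine hfa.resolve_left fun h1 => ?_
  rw [List.prod_eq_zero_iff, List.mem_map] at h1
  obtain ⟨i, -, hi⟩ := h1
  rw [sub_eq_zero.1 hi] at hb
  have := hμ i (Set.mem_univ i)
  rw [mem_closedBall_zero_iff] at this
  exact absurd hb (not_lt.2 this)

end WeakCoupling

/-! ### Eigenvalues of the agents, from vanishing coupling -/

section

variable {n m w : ℕ}

open scoped Matrix.Norms.Operator in
theorem continuous_exp_pairMatrix (S : Agent n m n w) (K : Protocol n m n) (ρ : ℝ) :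
    Continuous fun a => ((NormedSpace.exp (pairMatrix S K ρ a)).map (algebraMap ℝ ℂ))ᵀ := by
  have h1 : Continuous fun a => pairMatrix S K ρ a := by
    refine Continuous.matrix_fromBlocks continuous_const continuous_const ?_ ?_
    · exact continuous_id.smul continuous_const
    · exact continuous_const.add (continuous_id.smul continuous_const)
  exact (((NormedSpace.exp_continuous).comp h1).matrix_map Complex.continuous_ofReal).matrix_transpose

-- At weight `0`, `(v, 0)` is an eigenvector of the pair matrix for `μ`. For positive weights the
-- agent rows of its exponential decay, so the powers of the transposed exponential send `(star v,
-- 0)` to zero. If `Re μ > 0`, this yields `star v ⬝ᵥ v = 0`.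
open scoped ComplexOrder in
theorem eigenvalue_re_nonpos {A : Matrix (Fin n) (Fin n) ℝ} {B : Matrix (Fin n) (Fin m) ℝ}
    {E : Matrix (Fin n) (Fin w) ℝ} {K : Protocol n m n} {ρ : ℝ}
    (h : ∀ (a : ℝ) (ha : 0 < a),
      Synchronizes (⟨A, B, 1, E⟩ : Agent n m n w) K (pairGraph a ha.le) ρ)
    {μ : ℂ} (hμ : IsEigenvalue A μ) : μ.re ≤ 0 := by
  by_contra! hre
  obtain ⟨v, hv⟩ := Module.End.HasEigenvalue.exists_hasEigenvector hμ
  have hv1 : A.map (algebraMap ℝ ℂ) *ᵥ v = μ • v := by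
    have := Module.End.HasEigenvector.apply_eq_smul hv
    rwa [Matrix.toLin'_apply] at this
  set S : Agent n m n w := ⟨A, B, 1, E⟩ with hS
  have key := dotProduct_eq_zero_of_tendsto_pow (continuous_exp_pairMatrix S K ρ)
    (u := Sum.elim (star v) 0) (z := Sum.elim v 0) (b := Complex.exp μ) ?_ ?_ ?_
  · rw [sumElim_dotProduct_sumElim, zero_dotProduct, add_zero,
      dotProduct_star_self_eq_zero] at key
    exact hv.2 key
  · rw [Complex.norm_exp]
    exact Real.one_lt_exp_iff.2 hre
  · rw [Matrix.transpose_transpose, exp_map_complex]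
    refine exp_mulVec_of_eigenvector ?_
    rw [pairMatrix, Matrix.fromBlocks_map, Matrix.fromBlocks_mulVec, Sum.elim_comp_inl,
      Sum.elim_comp_inr, Matrix.mulVec_zero, Matrix.mulVec_zero, add_zero, add_zero, zero_smul]
    change Sum.elim (A.map (algebraMap ℝ ℂ) *ᵥ v) _ = _
    rw [hv1]
    ext (k | k)
    · simp
    · simp
  · intro a ha
    refine tendsto_pi_nhds.2 fun s => ?_
    have h1 : ∀ k : ℕ, ((((NormedSpace.exp (pairMatrix S K ρ a)).map (algebraMap ℝ ℂ))ᵀ) ^ k *ᵥ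
        Sum.elim (star v) 0) s = ∑ i, ((NormedSpace.exp ((k : ℝ) • pairMatrix S K ρ a)
          (Sum.inl i) s : ℝ) : ℂ) * star (v i) := by
      intro k
      have e1 : NormedSpace.exp ((k : ℝ) • pairMatrix S K ρ a)
          = NormedSpace.exp (pairMatrix S K ρ a) ^ k := by
        rw [Nat.cast_smul_eq_nsmul, Matrix.exp_nsmul]
      have e2 : (((NormedSpace.exp (pairMatrix S K ρ a)).map (algebraMap ℝ ℂ))ᵀ) ^ k
          = ((NormedSpace.exp ((k : ℝ) • pairMatrix S K ρ a)).map (algebraMap ℝ ℂ))ᵀ := by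
        rw [e1, ← Matrix.transpose_pow]
        congr 1
        exact (map_pow ((algebraMap ℝ ℂ).mapMatrix) (NormedSpace.exp (pairMatrix S K ρ a)) k).symm
      rw [e2]
      simp [Matrix.mulVec, dotProduct]
    simp only [h1]
    have h2 := tendsto_finsetSum Finset.univ fun i (_ : i ∈ Finset.univ) =>
      (((Complex.continuous_ofReal.tendsto 0).comp
        (((h a ha).tendsto_exp_pairMatrix i s).comp
          tendsto_natCast_atTop_atTop)).mul_const (star (v i)))
    simpa using h2

end

/-! ### Weighted sums of the agents -/

section Impulse

open MeasureTheory

/-- One-dimensional Sobolev inequality: bound `|y 0|` by `|y t|` plus the integral of `|y'|`, and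
average over `t`. -/
theorem abs_le_integral_add_integral {y y' : ℝ → ℝ} (hy : ∀ t, HasDerivAt y (y' t) t)
    (hc : Continuous y') :
    |y 0| ≤ (∫ t in (0 : ℝ)..1, |y t|) + ∫ t in (0 : ℝ)..1, |y' t| := by
  have hyc : Continuous y := continuous_iff_continuousAt.2 fun t => (hy t).continuousAt
  have h1 : ∀ t ∈ Set.Icc (0 : ℝ) 1, |y 0| - (∫ s in (0 : ℝ)..1, |y' s|) ≤ |y t| := by
    intro t ht
    have e := intervalIntegral.integral_eq_sub_of_hasDerivAt (a := 0) (b := t)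
      (fun s _ => hy s) (hc.intervalIntegrable _ _)
    have h2 : |∫ s in (0 : ℝ)..t, y' s| ≤ ∫ s in (0 : ℝ)..t, |y' s| :=
      intervalIntegral.abs_integral_le_integral_abs ht.1
    have h3 : ∫ s in (0 : ℝ)..t, |y' s| ≤ ∫ s in (0 : ℝ)..1, |y' s| :=
      intervalIntegral.integral_mono_interval le_rfl ht.1 ht.2
        (Filter.Eventually.of_forall fun s => abs_nonneg _) (hc.abs.intervalIntegrable _ _)
    have h4 : |y 0| ≤ |y t| + |∫ s in (0 : ℝ)..t, y' s| := by
      rw [e]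
      have := abs_sub_abs_le_abs_sub (y 0) (y t)
      rw [abs_sub_comm] at this
      linarith
    linarith
  have h2 := intervalIntegral.integral_mono_on zero_le_one
    (continuous_const.intervalIntegrable (μ := volume) _ _) (hyc.abs.intervalIntegrable _ _) h1
  rw [intervalIntegral.integral_const, sub_zero, one_smul] at h2
  linarith

theorem integral_abs_le_of_h2Norm_lt {κ μ : Type*} [Fintype κ] [Fintype μ]
    {g : ℝ → Matrix μ κ ℝ} (hg : Continuous g) {γ : ℝ} (hγ : 0 < γ)
    (h : h2Norm g < ENNReal.ofReal γ) (k : μ) (l : κ) :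
    ∫ t in (0 : ℝ)..1, |g t k l| ≤ γ := by
  have hgc : Continuous fun t => g t k l := hg.matrix_elem k l
  have hT : Continuous fun t => (g t * (g t)ᵀ).trace :=
    (hg.matrix_mul hg.matrix_transpose).matrix_trace
  have h1 : (∫⁻ t in Set.Ioi (0 : ℝ), ENNReal.ofReal (g t * (g t)ᵀ).trace)
      ≤ ENNReal.ofReal (γ ^ 2) := by
    have h2 := (ENNReal.rpow_lt_rpow (z := 2) h two_pos).le
    rw [h2Norm, ← ENNReal.rpow_mul, ENNReal.ofReal_rpow_of_pos hγ] at h2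
    norm_num at h2
    exact h2
  have h3 : ∫ t in (0 : ℝ)..1, (g t * (g t)ᵀ).trace ≤ γ ^ 2 := by
    rw [intervalIntegral.integral_of_le zero_le_one]
    rw [← ENNReal.ofReal_le_ofReal_iff (by positivity), ofReal_integral_eq_lintegral_ofReal
      (hT.integrableOn_Icc.mono_set Set.Ioc_subset_Icc_self)
      (Filter.Eventually.of_forall fun t => trace_mul_transpose_self_nonneg _)]
    exact (lintegral_mono_set fun t ht => ht.1).trans h1
  -- Arithmetic-geometric mean with weight `γ`; integrated, each of the two terms contributes at
  -- most `γ / 2`.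
  have h4 : ∀ t ∈ Set.Icc (0 : ℝ) 1,
      |g t k l| ≤ γ / 2 + (2 * γ)⁻¹ * (g t * (g t)ᵀ).trace := by
    intro t _
    have h5 : g t k l ^ 2 ≤ (g t * (g t)ᵀ).trace := by
      have e : (g t * (g t)ᵀ).trace = ∑ i, ∑ j, g t i j ^ 2 := by
        simp [Matrix.trace, Matrix.mul_apply, sq]
      rw [e]
      exact (Finset.single_le_sum (f := fun j => g t k j ^ 2) (fun j _ => sq_nonneg _)
        (Finset.mem_univ l)).trans (Finset.single_le_sum (f := fun i => ∑ j, g t i j ^ 2)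
          (fun i _ => Finset.sum_nonneg fun j _ => sq_nonneg _) (Finset.mem_univ k))
    have h6 : |g t k l| ≤ γ / 2 + (2 * γ)⁻¹ * g t k l ^ 2 := by
      have h7 : 0 ≤ (2 * γ)⁻¹ * (γ - |g t k l|) ^ 2 := by positivity
      have h8 : (2 * γ)⁻¹ * (γ - |g t k l|) ^ 2
          = γ / 2 + (2 * γ)⁻¹ * g t k l ^ 2 - |g t k l| := by
        rw [sub_sq, sq_abs]; field_simp; ring
      linarith
    have : 0 < (2 * γ)⁻¹ := by positivity
    nlinarith
  have hc1 : Continuous fun t => (2 * γ)⁻¹ * (g t * (g t)ᵀ).trace := continuous_const.mul hT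
  have hc2 : Continuous fun t => γ / 2 + (2 * γ)⁻¹ * (g t * (g t)ᵀ).trace :=
    continuous_const.add hc1
  have h5 := intervalIntegral.integral_mono_on zero_le_one
    (hgc.abs.intervalIntegrable (μ := volume) _ _) (hc2.intervalIntegrable _ _) h4
  rw [intervalIntegral.integral_add (continuous_const.intervalIntegrable _ _)
    (hc1.intervalIntegrable _ _), intervalIntegral.integral_const,
    intervalIntegral.integral_const_mul, sub_zero, one_smul] at h5
  have h6 : (2 * γ)⁻¹ * ∫ t in (0 : ℝ)..1, (g t * (g t)ᵀ).trace ≤ (2 * γ)⁻¹ * γ ^ 2 :=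
    mul_le_mul_of_nonneg_left h3 (by positivity)
  have h7 : (2 * γ)⁻¹ * γ ^ 2 = γ / 2 := by field_simp
  linarith

end Impulse

/-! ### Dynamics of weighted sums of the agents -/

section WeightedSum

variable {n m p w : ℕ} (S : Agent n m p w) (K : Protocol n m p) (G : CommGraph) (ρ : ℝ)
  (q : Fin G.N → ℝ)

/-- The output matrix for `∑ i, q i x_i`. -/
def weightedState : Matrix (Fin n) (Fin G.N × Fin n ⊕ Fin G.N × Fin K.nc) ℝ :=
  Matrix.of fun k s =>
    Sum.elim (fun r : Fin G.N × Fin n => if r.2 = k then q r.1 else 0) (fun _ => 0) s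

/-- The output matrix for `∑ i, q i x_{i,c}`. -/
def weightedProtocol : Matrix (Fin K.nc) (Fin G.N × Fin n ⊕ Fin G.N × Fin K.nc) ℝ :=
  Matrix.of fun k s =>
    Sum.elim (fun _ => 0) (fun r : Fin G.N × Fin K.nc => if r.2 = k then q r.1 else 0) s

theorem weightedState_mul_closedLoopMatrix :
    weightedState K G q * closedLoopMatrix S K G ρ
      = S.A * weightedState K G q + (S.B * K.Fc ρ) * weightedProtocol K G q := by
  ext k (⟨i, l⟩ | ⟨i, l⟩) <;>
  simp [weightedState, weightedProtocol, closedLoopMatrix, Matrix.mul_apply (M := Matrix.of _),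
    Matrix.mul_apply (M := S.A), Matrix.mul_apply (M := S.B * K.Fc ρ), Fintype.sum_prod_type,
    Matrix.one_apply, mul_comm]

-- Both communicated signals enter through the Laplacian, so a left null vector `q` removes all
-- coupling: the weighted protocol state evolves autonomously.
variable {q} in
theorem weightedProtocol_mul_closedLoopMatrix (hq : q ᵥ* G.laplacian = 0) :
    weightedProtocol K G q * closedLoopMatrix S K G ρ = K.Ac ρ * weightedProtocol K G q := by
  have hq' : ∀ (i : Fin G.N) (c : ℝ), ∑ j, G.laplacian j i * c * q j = 0 := by
    intro i c
    have h1 := congrFun hq i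
    simp only [Matrix.vecMul, dotProduct, Pi.zero_apply] at h1
    rw [← zero_mul c, ← h1, Finset.sum_mul]
    exact Finset.sum_congr rfl fun j _ => by ring
  ext k (⟨i, l⟩ | ⟨i, l⟩) <;>
  simp [weightedProtocol, closedLoopMatrix, Matrix.mul_apply (M := Matrix.of _),
    Matrix.mul_apply (M := K.Ac ρ), Fintype.sum_prod_type, Matrix.one_apply, mul_add,
    Finset.sum_add_distrib, hq', mul_comm (q _)]

theorem weightedState_mulVec_single (i : Fin G.N) (l : Fin n) (k : Fin n) :
    (weightedState K G q *ᵥ Pi.single (Sum.inl (i, l)) 1) k = if l = k then q i else 0 := by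
  simp [weightedState]

theorem weightedProtocol_mulVec_single (i : Fin G.N) (l : Fin n) :
    weightedProtocol K G q *ᵥ Pi.single (Sum.inl (i, l)) 1 = 0 := by
  ext k
  simp [weightedProtocol]

theorem weightedState_mul_inputMatrix (k : Fin n) (i : Fin G.N) (l : Fin w) :
    (weightedState K G q * inputMatrix S K G) k (i, l) = q i * S.E k l := by
  simp [weightedState, inputMatrix, Matrix.mul_apply, Fintype.sum_prod_type, Matrix.one_apply]

theorem weightedProtocol_mul_inputMatrix : weightedProtocol K G q * inputMatrix S K G = 0 := by
  ext k s
  simp [weightedProtocol, inputMatrix, Matrix.mul_apply]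

variable {q} in
theorem sum_smul_diffOutputMatrix (hq : ∑ i, q i = 0) (j : Fin G.N) :
    ∑ i, q i • diffOutputMatrix K G i j = weightedState K G q := by
  ext k (⟨i, l⟩ | ⟨i, l⟩)
  · rcases eq_or_ne l k with rfl | h
    · simp [weightedState, diffOutputMatrix, Matrix.sum_apply, mul_sub, Finset.sum_sub_distrib, hq]
    · simp [weightedState, diffOutputMatrix, Matrix.sum_apply, h]
  · simp [weightedState, diffOutputMatrix, Matrix.sum_apply]

variable {S K G ρ q}

theorem isTrajectory_exp (z : Fin G.N × Fin n ⊕ Fin G.N × Fin K.nc → ℝ) :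
    IsTrajectory S K G ρ (fun _ => 0)
      (fun t i k => (NormedSpace.exp (t • closedLoopMatrix S K G ρ) *ᵥ z) (Sum.inl (i, k)))
      (fun t i k => (NormedSpace.exp (t • closedLoopMatrix S K G ρ) *ᵥ z) (Sum.inr (i, k))) := by
  intro t _ i
  have hd := hasDerivAt_exp_smul_mulVec (closedLoopMatrix S K G ρ) z t
  set y := NormedSpace.exp (t • closedLoopMatrix S K G ρ) *ᵥ z with hy
  have e := closedLoop_mulVec S K G ρ (fun i k => y (Sum.inl (i, k))) (fun i k => y (Sum.inr (i, k)))
    (fun _ _ => 0)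
  have e0 : inputMatrix S K G *ᵥ (fun _ => (0 : ℝ)) = 0 := Matrix.mulVec_zero _
  have e1 : stack (fun i k => y (Sum.inl (i, k))) (fun i k => y (Sum.inr (i, k))) = y := by
    ext (⟨i, k⟩ | ⟨i, k⟩) <;> rfl
  rw [e0, add_zero, e1] at e
  rw [e] at hd
  exact ⟨(hasDerivAt_pi.2 fun k => hasDerivAt_pi.1 hd (Sum.inl (i, k))).hasDerivWithinAt,
    (hasDerivAt_pi.2 fun k => hasDerivAt_pi.1 hd (Sum.inr (i, k))).hasDerivWithinAt⟩

theorem weightedProtocol_exp_mulVec (hq : q ᵥ* G.laplacian = 0)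
    {z : Fin G.N × Fin n ⊕ Fin G.N × Fin K.nc → ℝ} (hz : weightedProtocol K G q *ᵥ z = 0) (t : ℝ) :
    weightedProtocol K G q *ᵥ (NormedSpace.exp (t • closedLoopMatrix S K G ρ) *ᵥ z) = 0 := by
  rw [Matrix.mulVec_mulVec,
    mul_exp_smul_eq_exp_smul_mul (weightedProtocol_mul_closedLoopMatrix S K G ρ hq),
    ← Matrix.mulVec_mulVec, hz, Matrix.mulVec_zero]

theorem weightedState_mulVec_closedLoop (z : Fin G.N × Fin n ⊕ Fin G.N × Fin K.nc → ℝ) :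
    weightedState K G q *ᵥ (closedLoopMatrix S K G ρ *ᵥ z)
      = S.A *ᵥ (weightedState K G q *ᵥ z)
        + (S.B * K.Fc ρ) *ᵥ (weightedProtocol K G q *ᵥ z) := by
  rw [Matrix.mulVec_mulVec, weightedState_mul_closedLoopMatrix, Matrix.add_mulVec,
    Matrix.mulVec_mulVec, Matrix.mulVec_mulVec]

theorem hasDerivAt_weightedState (z : Fin G.N × Fin n ⊕ Fin G.N × Fin K.nc → ℝ) (t : ℝ) :
    HasDerivAt (fun t : ℝ => weightedState K G q *ᵥ
        (NormedSpace.exp (t • closedLoopMatrix S K G ρ) *ᵥ z))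
      (S.A *ᵥ (weightedState K G q *ᵥ (NormedSpace.exp (t • closedLoopMatrix S K G ρ) *ᵥ z))
        + (S.B * K.Fc ρ) *ᵥ (weightedProtocol K G q *ᵥ
          (NormedSpace.exp (t • closedLoopMatrix S K G ρ) *ᵥ z))) t := by
  rw [← weightedState_mulVec_closedLoop]
  have hd := hasDerivAt_exp_smul_mulVec (closedLoopMatrix S K G ρ) z t
  refine hasDerivAt_pi.2 fun k => ?_
  exact HasDerivAt.fun_sum (u := Finset.univ) fun s _ =>
    (hasDerivAt_pi.1 hd s).const_mul (weightedState K G q k s)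

/-- If some left null vector of the Laplacian has sum zero, then synchronization requires that the
agents are stable. -/
theorem Synchronizes.stable (h : Synchronizes S K G ρ) (hq : q ᵥ* G.laplacian = 0)
    (hq0 : q ≠ 0) (hq1 : ∑ i, q i = 0) : Stable S.A := by
  obtain ⟨i, hi⟩ := Function.ne_iff.1 hq0
  refine tendsto_pi_nhds.2 fun k => tendsto_pi_nhds.2 fun l => ?_
  -- Only agent `i` starts away from zero. The weighted protocol state stays at zero, so the
  -- weighted agent state follows `exp (t A)`.
  set z : Fin G.N × Fin n ⊕ Fin G.N × Fin K.nc → ℝ := Pi.single (Sum.inl (i, l)) 1 with hz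
  have hs := weightedProtocol_exp_mulVec (S := S) (ρ := ρ) (z := z) hq
    (weightedProtocol_mulVec_single K G q i l)
  have hr : ∀ t : ℝ, 0 ≤ t →
      weightedState K G q *ᵥ (NormedSpace.exp (t • closedLoopMatrix S K G ρ) *ᵥ z)
        = NormedSpace.exp (t • S.A) *ᵥ (q i • Pi.single l 1) := by
    intro t ht
    have h1 := eq_exp_mulVec_of_hasDerivWithinAt (M := S.A)
      (z := fun t : ℝ => weightedState K G q *ᵥ
        (NormedSpace.exp (t • closedLoopMatrix S K G ρ) *ᵥ z)) (fun s _ => by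
        have := hasDerivAt_weightedState (S := S) (ρ := ρ) (q := q) z s
        rw [hs, Matrix.mulVec_zero, add_zero] at this
        exact this.hasDerivWithinAt) ht
    rw [h1]
    congr 1
    ext k
    rw [zero_smul, NormedSpace.exp_zero, Matrix.one_mulVec, hz, weightedState_mulVec_single]
    simp [Pi.single_apply, eq_comm]
  have htend := tendsto_finsetSum Finset.univ fun j (_ : j ∈ Finset.univ) =>
    (tendsto_pi_nhds.1 (h _ _ (isTrajectory_exp z) j i) k).const_mul (q j)
  have h2 : Filter.Tendsto (fun t : ℝ => q i * NormedSpace.exp (t • S.A) k l)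
      Filter.atTop (𝓝 0) := by
    simp only [Pi.zero_apply, mul_zero, Finset.sum_const_zero] at htend
    refine htend.congr' ?_
    filter_upwards [Filter.eventually_ge_atTop 0] with t ht
    have h3 := congrFun (hr t ht) k
    rw [Matrix.mulVec_smul, Matrix.mulVec_single_one (NormedSpace.exp (t • S.A)), Pi.smul_apply, smul_eq_mul] at h3
    refine Eq.trans ?_ h3
    simp only [Pi.sub_apply, mul_sub, Finset.sum_sub_distrib, ← Finset.sum_mul, hq1, zero_mul,
      sub_zero]
    rw [Matrix.mulVec, dotProduct]
    simp [weightedState, Fintype.sum_prod_type]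
  have h3 := h2.const_mul (q i)⁻¹
  rw [mul_zero] at h3
  refine h3.congr fun t => ?_
  rw [← mul_assoc, inv_mul_cancel₀ hi, one_mul]

theorem continuous_impulseResponse {ι κ μ : Type*} [Fintype ι] [DecidableEq ι] (M : Matrix ι ι ℝ)
    (D : Matrix ι κ ℝ) (C : Matrix μ ι ℝ) : Continuous (impulseResponse M D C) :=
  (continuous_const.matrix_mul (continuous_exp_smul M)).matrix_mul continuous_const

/-- If the `H₂` norms can be made arbitrarily small, then the disturbances do not act on those
combinations of the states that are not controlled. -/
theorem mul_vecMul_eq_zero_of_h2Norm (hq : ∑ i, q i = 0) {v : Fin n → ℝ} {i : Fin G.N} {l : Fin w}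
    (h : ∀ γ : ℝ, 0 < γ → ∃ ρ : ℝ, ∀ j, syncH2Norm S K G ρ j i < ENNReal.ofReal γ)
    (hv : ∀ ρ t : ℝ, v ⬝ᵥ ((S.B * K.Fc ρ) *ᵥ (weightedProtocol K G q *ᵥ
      (NormedSpace.exp (t • closedLoopMatrix S K G ρ) *ᵥ
        (inputMatrix S K G *ᵥ Pi.single (i, l) 1)))) = 0) :
    q i * (v ᵥ* S.E) l = 0 := by
  set c : (Fin n → ℝ) → ℝ := fun v => ∑ k, |v k| * ∑ j, |q j| with hc
  have hc0 : ∀ v, 0 ≤ c v := fun v => Finset.sum_nonneg fun k _ =>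
    mul_nonneg (abs_nonneg _) (Finset.sum_nonneg fun j _ => abs_nonneg _)
  have key : ∀ γ : ℝ, 0 < γ → |q i * (v ᵥ* S.E) l| ≤ (c v + c (v ᵥ* S.A)) * γ := by
    intro γ hγ
    obtain ⟨ρ, hρ⟩ := h γ hγ
    -- Component along `v` of the weighted sum after an impulse. By `hv` its derivative is the same
    -- quantity for `v ᵥ* S.A`, so both are controlled by the `H₂` norms of the differences.
    set y : (Fin n → ℝ) → ℝ → ℝ := fun v t => v ⬝ᵥ (weightedState K G q *ᵥ
      (NormedSpace.exp (t • closedLoopMatrix S K G ρ) *ᵥ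
        (inputMatrix S K G *ᵥ Pi.single (i, l) 1))) with hy
    set g : Fin G.N → ℝ → Matrix (Fin n) (Fin G.N × Fin w) ℝ := fun j =>
      impulseResponse (closedLoopMatrix S K G ρ) (inputMatrix S K G) (diffOutputMatrix K G j i)
      with hg
    have hgc : ∀ j k, Continuous fun t => g j t k (i, l) := fun j k =>
      (continuous_impulseResponse _ _ _).matrix_elem k (i, l)
    have hyg : ∀ v t, y v t = ∑ k, ∑ j, v k * (q j * g j t k (i, l)) := by
      intro v t
      simp only [hy, Matrix.mulVec_mulVec (M := weightedState K G q)]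
      rw [Matrix.mulVec_mulVec, Matrix.mulVec_single_one, ← sum_smul_diffOutputMatrix K G hq i,
        Matrix.sum_mul, Matrix.sum_mul]
      simp only [dotProduct, Matrix.col_apply, Matrix.smul_mul, Matrix.sum_apply,
        Matrix.smul_apply, smul_eq_mul, Finset.mul_sum, hg, impulseResponse]
    have hyint : ∀ v, ∫ t in (0 : ℝ)..1, |y v t| ≤ c v * γ := by
      intro v
      have h1 : ∀ k j, Continuous fun t => |v k| * (|q j| * |g j t k (i, l)|) := fun k j =>
        continuous_const.mul (continuous_const.mul (hgc j k).abs)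
      have h2 : ∀ k, Continuous fun t => ∑ j, |v k| * (|q j| * |g j t k (i, l)|) := fun k =>
        continuous_finsetSum _ fun j _ => h1 k j
      have hyc : Continuous fun t => y v t := by
        simp only [hyg]
        exact continuous_finsetSum _ fun k _ => continuous_finsetSum _ fun j _ =>
          continuous_const.mul (continuous_const.mul (hgc j k))
      have h3 : ∀ t ∈ Set.Icc (0 : ℝ) 1,
          |y v t| ≤ ∑ k, ∑ j, |v k| * (|q j| * |g j t k (i, l)|) := by
        intro t _
        rw [hyg]
        refine (Finset.abs_sum_le_sum_abs _ _).trans (Finset.sum_le_sum fun k _ =>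
          (Finset.abs_sum_le_sum_abs _ _).trans (Finset.sum_le_sum fun j _ => ?_))
        rw [abs_mul, abs_mul]
      refine (intervalIntegral.integral_mono_on zero_le_one (hyc.abs.intervalIntegrable _ _)
        ((continuous_finsetSum _ fun k _ => h2 k).intervalIntegrable _ _) h3).trans ?_
      rw [intervalIntegral.integral_finsetSum fun k _ => (h2 k).intervalIntegrable _ _]
      simp only [hc, Finset.sum_mul]
      refine Finset.sum_le_sum fun k _ => ?_
      rw [intervalIntegral.integral_finsetSum fun j _ => (h1 k j).intervalIntegrable _ _,
        mul_assoc, Finset.sum_mul, Finset.mul_sum]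
      refine Finset.sum_le_sum fun j _ => ?_
      rw [intervalIntegral.integral_const_mul, intervalIntegral.integral_const_mul]
      gcongr
      exact integral_abs_le_of_h2Norm_lt (continuous_impulseResponse _ _ _) hγ (hρ j) k (i, l)
    have hyd : ∀ t, HasDerivAt (y v) (y (v ᵥ* S.A) t) t := by
      intro t
      have h1 := hasDerivAt_weightedState (S := S) (ρ := ρ) (q := q)
        (inputMatrix S K G *ᵥ Pi.single (i, l) 1) t
      have h2 := HasDerivAt.fun_sum (u := Finset.univ) fun k _ =>
        (hasDerivAt_pi.1 h1 k).const_mul (v k)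
      refine h2.congr_deriv ?_
      have h3 := hv ρ t
      simp only [hy, ← Matrix.dotProduct_mulVec]
      rw [← add_zero (v ⬝ᵥ _), ← h3, ← dotProduct_add]
      rfl
    have hyc : Continuous (y (v ᵥ* S.A)) := by
      simp only [funext (hyg (v ᵥ* S.A))]
      exact continuous_finsetSum _ fun k _ => continuous_finsetSum _ fun j _ =>
        continuous_const.mul (continuous_const.mul (hgc j k))
    have h1 := abs_le_integral_add_integral hyd hyc
    have h2 : y v 0 = q i * (v ᵥ* S.E) l := by
      simp only [hy, zero_smul, NormedSpace.exp_zero, Matrix.one_mulVec]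
      rw [Matrix.mulVec_mulVec, Matrix.mulVec_single_one]
      simp only [dotProduct, Matrix.col_apply, weightedState_mul_inputMatrix, Matrix.vecMul,
        Finset.mul_sum]
      exact Finset.sum_congr rfl fun k _ => by ring
    rw [h2] at h1
    have := hyint v
    have := hyint (v ᵥ* S.A)
    linarith
  by_contra hne
  have hpos : 0 < |q i * (v ᵥ* S.E) l| := abs_pos.2 hne
  set d := c v + c (v ᵥ* S.A) with hd
  have hd0 : 0 ≤ d := add_nonneg (hc0 _) (hc0 _)
  have h1 := key (|q i * (v ᵥ* S.E) l| / (d + 1)) (by positivity)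
  rw [mul_div_assoc', le_div_iff₀ (by positivity)] at h1
  nlinarith

end WeightedSum

/-! ### Necessity -/

section Necessity

variable {n m w : ℕ} {A : Matrix (Fin n) (Fin n) ℝ} {B : Matrix (Fin n) (Fin m) ℝ}
  {E : Matrix (Fin n) (Fin w) ℝ} {K : Protocol n m n} {𝒢 : Set CommGraph}

theorem Solves.exists_h2Norm_lt {p : ℕ} {S : Agent n m p w} {K : Protocol n m p}
    (h : Solves S K 𝒢) {G : CommGraph} (hG : G ∈ 𝒢) (i : Fin G.N) (γ : ℝ) (hγ : 0 < γ) :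
    ∃ ρ : ℝ, ∀ j, syncH2Norm S K G ρ j i < ENNReal.ofReal γ := by
  obtain ⟨ρ, -, hρ⟩ := (h G hG).2 γ hγ
  exact ⟨ρ, fun j => hρ ρ le_rfl j i⟩

/-- A functional `v` that kills the range of `B` but not `E x` selects a component no control
reaches, in particular for the difference of two agents. -/
theorem Solves.range_le (h : Solves (⟨A, B, 1, E⟩ : Agent n m n w) K 𝒢)
    (h𝒢 : {G | G.HasDirectedSpanningTree} ⊆ 𝒢) :
    LinearMap.range E.mulVecLin ≤ LinearMap.range B.mulVecLin := by
  rintro _ ⟨x, rfl⟩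
  by_contra hx
  obtain ⟨φ, hφx, hφ⟩ := Submodule.exists_dual_map_eq_bot_of_notMem hx inferInstance
  set v : Fin n → ℝ := fun k => φ (Pi.single k 1) with hv
  have hvφ : ∀ y, v ⬝ᵥ y = φ y := by
    intro y
    rw [LinearMap.pi_apply_eq_sum_univ φ y]
    simp only [dotProduct, hv, smul_eq_mul, mul_comm]
    refine Finset.sum_congr rfl fun k _ => ?_
    congr 2
    ext l
    simp [Pi.single_apply, eq_comm]
  have hvB : v ᵥ* B = 0 := by
    refine dotProduct_eq_zero _ fun y => ?_
    rw [← Matrix.dotProduct_mulVec, hvφ]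
    have : φ (B.mulVecLin y) ∈ (LinearMap.range B.mulVecLin).map φ :=
      Submodule.mem_map_of_mem ⟨y, rfl⟩
    rw [hφ] at this
    exact this
  have hvE : v ᵥ* E = 0 := by
    ext l
    have := mul_vecMul_eq_zero_of_h2Norm (G := pairGraph 1 zero_le_one) (q := ![1, -1])
      (i := (0 : Fin 2)) (l := l) (v := v) (S := (⟨A, B, 1, E⟩ : Agent n m n w)) (K := K)
      (by exact (Fin.sum_univ_two _).trans (by simp))
      (h.exists_h2Norm_lt (h𝒢 (hasDirectedSpanningTree_pairGraph one_pos)) _)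
      (fun ρ t => by
        rw [Matrix.dotProduct_mulVec, ← Matrix.vecMul_vecMul, hvB, Matrix.zero_vecMul,
          zero_dotProduct])
    exact (one_mul _).symm.trans this
  refine hφx ?_
  rw [← hvφ, Matrix.mulVecLin_apply, Matrix.dotProduct_mulVec, hvE, zero_dotProduct]

/-- Without a tree there is a combination of differences that evolves without control.
Synchronization makes `A` Hurwitz, and small `H₂` norms make every entry of `E` zero, against the
assumption. -/
theorem Solves.hasDirectedSpanningTree (h : Solves (⟨A, B, 1, E⟩ : Agent n m n w) K 𝒢)
    (hEA : E ≠ 0 ∨ ¬ Hurwitz A) {G : CommGraph} (hG : G ∈ 𝒢) : G.HasDirectedSpanningTree := by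
  by_contra hT
  obtain ⟨q, hq0, hq1, hq⟩ := CommGraph.exists_vecMul_eq_zero_of_not_tree hT
  have hA : Stable A := ((h G hG).1 1 le_rfl).stable hq hq0 hq1
  refine hEA.elim (fun hE => hE ?_) fun hA' => hA' ((hurwitz_iff_eigStable A).2 hA.eigStable)
  obtain ⟨i, hi⟩ := Function.ne_iff.1 hq0
  ext k l
  have h1 := mul_vecMul_eq_zero_of_h2Norm (q := q) (i := i) (l := l) (v := Pi.single k 1) hq1
    (h.exists_h2Norm_lt hG i) fun ρ t => by
      rw [weightedProtocol_exp_mulVec hq, Matrix.mulVec_zero, dotProduct_zero]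
      rw [Matrix.mulVec_mulVec, weightedProtocol_mul_inputMatrix, Matrix.zero_mulVec]
  rw [Matrix.single_one_vecMul] at h1
  exact (mul_eq_zero.1 h1).resolve_left hi

end Necessity

end MAS

end

theorem theorem1 {n m w : ℕ} (A : Matrix (Fin n) (Fin n) ℝ) (B : Matrix (Fin n) (Fin m) ℝ)
    (E : Matrix (Fin n) (Fin w) ℝ) :
    -- solvability, for a class of graphs that includes all those with a directed spanning tree
    ((E ≠ 0 ∨ ¬ MAS.Hurwitz A) →
      ∀ 𝒢 : Set MAS.CommGraph, {G | G.HasDirectedSpanningTree} ⊆ 𝒢 →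
        (MAS.Solvable (⟨A, B, 1, E⟩ : MAS.Agent n m n w) 𝒢 ↔
          MAS.Stabilizable A B ∧
          (∀ μ : ℂ, MAS.IsEigenvalue A μ → μ.re ≤ 0) ∧
          (∀ G ∈ 𝒢, G.HasDirectedSpanningTree) ∧
          LinearMap.range E.mulVecLin ≤ LinearMap.range B.mulVecLin)) ∧
    -- the explicit protocol
    (MAS.Stabilizable A B →
      (∀ μ : ℂ, MAS.IsEigenvalue A μ → μ.re ≤ 0) →
      LinearMap.range E.mulVecLin ≤ LinearMap.range B.mulVecLin →
        (∃! P : Matrix (Fin n) (Fin n) ℝ, MAS.IsRiccatiSolution A B P) ∧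
        ∀ P : Matrix (Fin n) (Fin n) ℝ, MAS.IsRiccatiSolution A B P →
          MAS.Solves (⟨A, B, 1, E⟩ : MAS.Agent n m n w) (MAS.riccatiProtocol A B P)
            {G | G.HasDirectedSpanningTree} ∧
          ∀ G : MAS.CommGraph, G.HasDirectedSpanningTree →
            ∃ M : ℝ, 0 < M ∧ ∀ ρ : ℝ, 1 ≤ ρ → ∀ i j : Fin G.N,
              MAS.syncH2Norm (⟨A, B, 1, E⟩ : MAS.Agent n m n w) (MAS.riccatiProtocol A B P) G ρ i j
                < ENNReal.ofReal (M / Real.sqrt ρ)) := by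
  refine ⟨fun h 𝒢 h𝒢 => ⟨?_, ?_⟩, fun hAB hA hE =>
    ⟨MAS.existsUnique_riccatiSolution hAB, fun P hP =>
      ⟨MAS.solves_riccatiProtocol hA hP hE, fun G hG => MAS.exists_h2Norm_bound hG hA hP hE⟩⟩⟩
  · rintro ⟨K, hK⟩
    -- Every positive edge weight is allowed; arbitrarily small weights are what excludes unstable
    -- eigenvalues.
    have hS := fun (a : ℝ) (ha : 0 < a) =>
      (hK _ (h𝒢 (MAS.hasDirectedSpanningTree_pairGraph ha))).1 1 le_rfl
    exact ⟨MAS.stabilizable_of_synchronizes (hS 1 one_pos),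
      fun μ hμ => MAS.eigenvalue_re_nonpos hS hμ,
      fun G hG => hK.hasDirectedSpanningTree h hG, hK.range_le h𝒢⟩
  · rintro ⟨hAB, hA, hG, hE⟩
    obtain ⟨P, hP, -⟩ := MAS.existsUnique_riccatiSolution hAB
    exact ⟨MAS.riccatiProtocol A B P, fun G hG' =>
      MAS.solves_riccatiProtocol hA hP hE G (hG G hG')⟩
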